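/- **Setting.** Let $(V_i,J_i,h_i)$, $1\le i\le r$, be closed connected manifolds of real dimension $2n_i\ge 0$ with a Riemannian metric $h_i$, a compatible almost complex structure $J_i$ and fundamental form $\eta_i=h_i(J_i\cdot,\cdot)$ (for instance Fano Kähler–Einstein manifolds with $\mathrm{Ric}(h_i)=p_ih_i$, $c_1(V_i)=p_ia_i$, $\eta_i\in 2\pi a_i$). Let $L_i\to V_i$ be principal $U(1)$-bundles with Euler classes $a_i$ and principal connections $\theta_i$ with curvature $d\theta_i=\eta_i$ (pulled back to $L_i$); for $i=1$ let $V_1=\mathbb{C}P^{n_1}$ with the Fubini–Study metric $h_1$ normalized by $\mathrm{Ric}(h_1)=(n_1+1)h_1$, and let $L_1=S^{2n_1+1}\to\mathbb{C}P^{n_1}$ be the Hopf fibration with its standard connection. Let $p_i$ be positive integers with $p_1=n_1+1$, and $q_i$ nonzero integers with $|q_1|=1$. Let $\hat\pi:P_q\to V_1\times\cdots\times V_r$ be the principal circle bundle with Euler class $\oplus_i q_ia_i$ (i.e. the circle bundle associated with $L_1\times\cdots\times L_r$ through the character $(c_i)\mapsto\prod_i c_i^{q_i}$) with the principal connection $\theta$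 induced by $\sum_i q_i\theta_i$, whose curvature is $\sum_i q_i\hat\pi^*\eta_i$. Put $m=2+\sum_i 2n_i\ge 4$, $p=m+n$ with an integer $n\ge 0$, and let $\epsilon\in\mathbb{R}$ be such that $\epsilon=0$ if $n=1$. For $\nu<0$ and $A_1,\dots,A_r<0$ put $s_*=-\frac1{2A_1}$, $$\beta_i(s)=A_i\Big(s^2-\frac{q_i^2}{4A_i^2}\Big),\qquad w=\prod_{i=1}^r\beta_i^{n_i},\qquad \alpha(s)=\frac{s^{p-1}}{w(s)}\int_s^{s_*}\frac{w(\tau)(\epsilon\tau^2-\nu)}{\tau^p}\,d\tau\quad(0<s<s_*),$$ $\varphi(s)=(p-2)(\log s+\log\kappa_1)$ with $\kappa_1>0$ arbitrary, and consider $\hat M=(0,s_*)\times P_q$ with the metric $$\hat g=\alpha(s)^{-1}ds^2+\alpha(s)\,\theta\otimes\theta+\sum_{i=1}^r\beta_i(s)\,\hat\pi^*h_i .$$ **Choices of constants.** Let $\phi=\min_{1\le i\le r}p_i^2q_i^{-2}$, and $A_i^{\pm}=\frac1{2\nu}\big(p_i\pm\sqrt{p_i^2+\nu\epsilon q_i^2}\big)$.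 Then $\phi\le p_1^2$; $\phi<p_1^2$ if $p_1|q_i|>p_i$ for some $i\ge2$; and $\phi=p_1^2$ if $p_1|q_i|\le p_i$ for all $i\ge2$. Suppose that one of the following holds. * $\epsilon=0$, $p_1|q_i|>p_i$ for all $i\ge2$, $\nu<0$ and $A_i=p_i/\nu$ for all $i$. * $\epsilon<0$, $p_1|q_i|>p_i$ for all $i\ge2$, $\nu<0$ and $A_i=A_i^+$ for all $i$. * $\epsilon>0$, $p_1|q_i|>p_i$ for some $i\ge2$, $\nu\in[-\frac{\phi}{\epsilon},0)$, $A_1=A_1^+$, and for each $i\ge2$: $A_i\in\{A_i^+,A_i^-\}$ if $p_1|q_i|>p_i$, and $A_i=A_i^-$ if $p_1|q_i|\le p_i$. * $\epsilon>0$, $p_1|q_i|\le p_i$ for all $i\ge2$ with equality for some $i\ge2$, $\nu\in(-\frac{\phi}{\epsilon},0)$, $A_1=A_1^+$ and $A_i=A_i^-$ for $i\ge2$. * $\epsilon>0$, $p_1|q_i|<p_i$ for all $i\ge2$, $\nu\in[-\frac{\phi}{\epsilon},0)$, $A_1\in\{A_1^+,A_1^-\}$ and $A_i=A_i^-$ for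 $i\ge2$. **Conclusion.** Then $A_i<0$ and $\frac{\epsilon q_i^2}{4A_i^2}+\frac{p_i}{A_i}=\nu$ for all $i$; $s_*>0$; $\beta_i>0$ on $[0,s_*)$ for all $i$; $\beta_1(s_*)=0$, $\beta_1'(s_*)=-1$; and $\beta_i(s_*)>0$ for $i\ge2$. The function $\alpha$ extends to a $C^\infty$ function on $[0,s_*]$ with $\alpha>0$ on $[0,s_*)$, $\alpha(0)=\frac{\nu}{1-p}$, $\alpha(s_*)=0$ and $\alpha'(s_*)=-2$. On $(0,s_*)$ the functions $\alpha,\beta_i,\varphi$ solve the system $$\alpha\Big(\varphi''+\tfrac{\varphi'^2}{p-2}-\sum_i n_i\Big(\tfrac{\beta_i''}{\beta_i}-\tfrac12\big(\tfrac{\beta_i'}{\beta_i}\big)^2\Big)\Big)+\tfrac{\alpha'}2(\varphi'-(\log w)')-\tfrac{\alpha''}2=\epsilon,$$ $$\tfrac{\alpha'}2(\varphi'-(\log w)')-\tfrac{\alpha''}2+\tfrac\alpha2\sum_i\tfrac{n_iq_i^2}{\beta_i^2}=\epsilon,$$ $$\tfrac\alpha2\Big(\tfrac{\beta_i'}{\beta_i}(\varphi'-(\log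 w)')-\tfrac{\beta_i''}{\beta_i}+\big(\tfrac{\beta_i'}{\beta_i}\big)^2-\tfrac{q_i^2}{\beta_i^2}\Big)-\tfrac{\alpha'}2\tfrac{\beta_i'}{\beta_i}+\tfrac{p_i}{\beta_i}=\epsilon\quad(1\le i\le r).$$ Finally $(\hat M,\hat g)$ can be smoothly compactified at $s=s_*$ and extended to $s=0$: there are a smooth compact Hausdorff $m$-manifold $\bar M$ with boundary, a smooth Riemannian metric $g_{\bar M}$ on $\bar M$ and a continuous map $\Psi:[0,s_*]\times P_q\to\bar M$ such that $\Psi$ restricts to a diffeomorphism of $[0,s_*)\times P_q$ onto an open subset under which $g_{\bar M}$ corresponds to $\hat g$, the image of $(0,s_*)\times P_q$ is dense, $\partial\bar M=\Psi(\{0\}\times P_q)$, the complement of $\Psi([0,s_*)\times P_q)$ is a smoothly embedded copy of $V_2\times\cdots\times V_r$ onto which $\Psi(s_*,\cdot)$ is the projection of $P_q$, and the coordinate $s$ extends to a smooth function on $\bar M$. -/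

import Mathlib

open scoped Manifold ContDiff Topology InnerProductSpace
open Set Bundle

noncomputable section

/-! ### Principal circle bundles and connections -/

section CircleBundles

variable {E : Type*} [NormedAddCommGroup E] [NormedSpace ℝ E]
  {H : Type*} [TopologicalSpace H]

/-- A (not necessarily continuous) one-form on a manifold. -/
abbrev OneForm (I : ModelWithCorners ℝ E H) (M : Type*) [TopologicalSpace M] [ChartedSpace H M] :
    Type _ :=
  ∀ x : M, TangentSpace I x →L[ℝ] ℝ

/-- The exterior derivative of a one-form on a boundaryless manifold. At `x` it is computed in
the preferred chart around `x`, which is the chart that identifies `TangentSpace I x` with `E`;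
the convention is `dη(X, Y) = X(η(Y)) - Y(η(X)) - η([X, Y])`. -/
def OneForm.extDeriv {I : ModelWithCorners ℝ E H} {M : Type*} [TopologicalSpace M]
    [ChartedSpace H M] (η : OneForm I M) (x : M) (u v : TangentSpace I x) : ℝ :=
  let χ : E → M := (extChartAt I x).symm
  let ηχ : E → E →L[ℝ] ℝ := fun y => (η (χ y)).comp (mfderiv 𝓘(ℝ, E) I χ y)
  let D : E →L[ℝ] E →L[ℝ] ℝ := fderiv ℝ ηχ (extChartAt I x x)
  D u v - D v u

variable {E' : Type*} [NormedAddCommGroup E'] [NormedSpace ℝ E']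
  {H' : Type*} [TopologicalSpace H']

/-- `pr : L → B` is a smooth principal bundle for the structure group `U(1)`: the group acts
smoothly and freely on `L`, the projection is smooth and invariant, and `L` is locally trivial
(over `U`, the map `x ↦ (pr x, τ x)` is an equivariant diffeomorphism of `pr⁻¹(U)` with `U × U(1)`
whose inverse is `(b, c) ↦ c • σ b`). -/
structure IsPrincipalCircleBundle (I : ModelWithCorners ℝ E H) (I' : ModelWithCorners ℝ E' H')
    {L B : Type*} [TopologicalSpace L] [ChartedSpace H L] [MulAction Circle L]
    [TopologicalSpace B] [ChartedSpace H' B] (pr : L → B) : Prop where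
  contMDiff_smul : ContMDiff ((𝓡 1).prod I) I ∞ (fun x : Circle × L => x.1 • x.2)
  contMDiff_proj : ContMDiff I I' ∞ pr
  free : ∀ (c : Circle) (x : L), c • x = x → c = 1
  proj_smul : ∀ (c : Circle) (x : L), pr (c • x) = pr x
  locally_trivial : ∀ b : B, ∃ U : Set B, IsOpen U ∧ b ∈ U ∧
    ∃ (σ : B → L) (τ : L → Circle),
      ContMDiffOn I' I ∞ σ U ∧ (∀ y ∈ U, pr (σ y) = y) ∧
      ContMDiffOn I (𝓡 1) ∞ τ (pr ⁻¹' U) ∧ ∀ x ∈ pr ⁻¹' U, x = τ x • σ (pr x)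

/-- `θ` is (`√-1` times) a principal connection: a smooth invariant one-form with `θ(Λ) = 1`, where
`Λ(x)` is the velocity at `υ = 0` of the curve `υ ↦ exp(√-1 υ) • x`. -/
structure IsPrincipalConnection (I : ModelWithCorners ℝ E H)
    {L : Type*} [TopologicalSpace L] [ChartedSpace H L] [IsManifold I ∞ L] [MulAction Circle L]
    (θ : OneForm I L) : Prop where
  contMDiff : ContMDiff I (I.prod 𝓘(ℝ, E →L[ℝ] ℝ)) ∞
    (fun x => (TotalSpace.mk' (E →L[ℝ] ℝ) x (θ x) :
      TotalSpace (E →L[ℝ] ℝ) (fun x : L => TangentSpace I x →L[ℝ] ℝ)))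
  invariant : ∀ (c : Circle) (x : L) (u : TangentSpace I x),
    θ (c • x) (mfderiv I I (fun y : L => c • y) x u) = θ x u
  apply_vertical : ∀ x : L, θ (Circle.exp 0 • x)
    (mfderiv 𝓘(ℝ, ℝ) I (fun υ : ℝ => Circle.exp υ • x) 0 (1 : ℝ)) = 1

end CircleBundles

/-! ### Base manifolds -/

/-- A smooth Riemannian metric on a smooth manifold, possibly with boundary. -/
abbrev SmoothMetric {E : Type*} [NormedAddCommGroup E] [NormedSpace ℝ E]
    {H : Type*} [TopologicalSpace H] (I : ModelWithCorners ℝ E H)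
    (M : Type*) [TopologicalSpace M] [ChartedSpace H M] [IsManifold I ∞ M] :=
  ContMDiffRiemannianMetric I ∞ E (fun x : M => TangentSpace I x)

/-- `J` is an almost complex structure and `h` is Hermitian with respect to it. The associated
fundamental (Kähler) form is `η(X, Y) = h(J X, Y)`. -/
structure IsAlmostHermitian {a : ℕ} {V : Type*} [TopologicalSpace V]
    [ChartedSpace (EuclideanSpace ℝ (Fin a)) V] [IsManifold (𝓡 a) ∞ V]
    (h : SmoothMetric (𝓡 a) V)
    (J : ∀ x : V, TangentSpace (𝓡 a) x →L[ℝ] TangentSpace (𝓡 a) x) : Prop where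
  sq : ∀ (x : V) (u : TangentSpace (𝓡 a) x), J x (J x u) = -u
  hermitian : ∀ (x : V) (u v : TangentSpace (𝓡 a) x),
    h.inner x (J x u) (J x v) = h.inner x u v

/-- `pr : L → V` is a principal circle bundle, and `θ` is a principal connection on it with curvature
form `dθ = pr^* η`, where `η = h(J ·, ·)`. In particular `η` is closed, and `η / 2π` represents the
Euler class of `L`. -/
structure IsPrequantumBundle {a b : ℕ} {V L : Type*} [TopologicalSpace V]
    [ChartedSpace (EuclideanSpace ℝ (Fin a)) V] [IsManifold (𝓡 a) ∞ V]
    [TopologicalSpace L] [ChartedSpace (EuclideanSpace ℝ (Fin b)) L] [IsManifold (𝓡 b) ∞ L]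
    [MulAction Circle L] (h : SmoothMetric (𝓡 a) V)
    (J : ∀ x : V, TangentSpace (𝓡 a) x →L[ℝ] TangentSpace (𝓡 a) x)
    (pr : L → V) (θ : OneForm (𝓡 b) L) : Prop where
  principal : IsPrincipalCircleBundle (𝓡 b) (𝓡 a) pr
  connection : IsPrincipalConnection (𝓡 b) θ
  curvature : ∀ (x : L) (u v : TangentSpace (𝓡 b) x),
    θ.extDeriv x u v =
      h.inner (pr x) (J (pr x) (mfderiv (𝓡 b) (𝓡 a) pr x u)) (mfderiv (𝓡 b) (𝓡 a) pr x v)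

instance fact_finrank_complexEuclidean (a : ℕ) :
    Fact (Module.finrank ℝ (EuclideanSpace ℂ (Fin (a + 1))) = 2 * a + 1 + 1) :=
  ⟨by
    rw [← Module.finrank_mul_finrank ℝ ℂ (EuclideanSpace ℂ (Fin (a + 1)))]
    simp
    ring⟩

/-- The unit sphere `S^{2a+1}` in `ℂ^{a+1}`. -/
abbrev ComplexSphere (a : ℕ) : Type :=
  Metric.sphere (0 : EuclideanSpace ℂ (Fin (a + 1))) 1

/-- The differential of the inclusion of `S^{2a+1}` in `ℂ^{a+1}`. -/
def ComplexSphere.tangentCoe {a : ℕ} (z : ComplexSphere a)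
    (u : TangentSpace (𝓡 (2 * a + 1)) z) : EuclideanSpace ℂ (Fin (a + 1)) :=
  mfderiv (𝓡 (2 * a + 1)) 𝓘(ℝ, EuclideanSpace ℂ (Fin (a + 1)))
    ((↑) : ComplexSphere a → EuclideanSpace ℂ (Fin (a + 1))) z u

/-- The standard connection form `u ↦ Re ⟨√-1 z, u⟩` on `S^{2a+1}`. -/
def ComplexSphere.stdForm {a : ℕ} (z : ComplexSphere a)
    (u : TangentSpace (𝓡 (2 * a + 1)) z) : ℝ :=
  ⟪Complex.I • (z : EuclideanSpace ℂ (Fin (a + 1))), z.tangentCoe u⟫_ℝ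

/-- The principal circle bundle `pr : L → V` with connection `θ` is the Hopf fibration
`S^{2a+1} → S^{2a+1} / U(1) = ℂP^a` with its standard connection, and `h` is the Fubini-Study metric
on `V = ℂP^a`, normalized so that its Ricci tensor is `(a + 1) h`: its pull-back to `S^{2a+1}` is
twice the horizontal part of the round metric. -/
def IsHopfFibration {a : ℕ} {V L : Type*} [TopologicalSpace V]
    [ChartedSpace (EuclideanSpace ℝ (Fin (2 * a))) V] [IsManifold (𝓡 (2 * a)) ∞ V]
    [TopologicalSpace L] [ChartedSpace (EuclideanSpace ℝ (Fin (2 * a + 1))) L]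
    [MulAction Circle L] (h : SmoothMetric (𝓡 (2 * a)) V) (pr : L → V)
    (θ : OneForm (𝓡 (2 * a + 1)) L) : Prop :=
  ∃ F : Diffeomorph (𝓡 (2 * a + 1)) (𝓡 (2 * a + 1)) (ComplexSphere a) L ∞,
    (∀ (c : Circle) (z z' : ComplexSphere a),
      (z' : EuclideanSpace ℂ (Fin (a + 1))) = (c : ℂ) • (z : EuclideanSpace ℂ (Fin (a + 1))) →
        F z' = c • F z) ∧
    (∀ (z : ComplexSphere a) (u : TangentSpace (𝓡 (2 * a + 1)) z),
      θ (F z) (mfderiv (𝓡 (2 * a + 1)) (𝓡 (2 * a + 1)) F z u) = z.stdForm u) ∧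
    ∀ (z : ComplexSphere a) (u v : TangentSpace (𝓡 (2 * a + 1)) z),
      h.inner (pr (F z))
          (mfderiv (𝓡 (2 * a + 1)) (𝓡 (2 * a)) (fun y : ComplexSphere a => pr (F y)) z u)
          (mfderiv (𝓡 (2 * a + 1)) (𝓡 (2 * a)) (fun y : ComplexSphere a => pr (F y)) z v) =
        2 * (⟪z.tangentCoe u, z.tangentCoe v⟫_ℝ - z.stdForm u * z.stdForm v)

/-- Let `proj i : L i → V i` be principal circle bundles with connections `ϑ i` and Euler classes
`a i`. The principal circle bundle `pr : P → ∏ V i` with principal connection `θ` has Euler class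
`⊕ q i • a i` and curvature `∑ q i pr^* η i`: it is the circle bundle associated with `∏ L i` through
the character `c ↦ ∏ c i ^ q i` of the torus `U(1)^r`, and `θ` is induced by `∑ q i • ϑ i`. -/
structure IsCircleBundleOfWeight {k d : ℕ} {n : Fin (k + 1) → ℕ} {V L : Fin (k + 1) → Type*}
    {P : Type*}
    [∀ i, TopologicalSpace (V i)] [∀ i, ChartedSpace (EuclideanSpace ℝ (Fin (2 * n i))) (V i)]
    [∀ i, TopologicalSpace (L i)] [∀ i, ChartedSpace (EuclideanSpace ℝ (Fin (2 * n i + 1))) (L i)]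
    [∀ i, MulAction Circle (L i)]
    [TopologicalSpace P] [ChartedSpace (EuclideanSpace ℝ (Fin d)) P] [IsManifold (𝓡 d) ∞ P]
    [MulAction Circle P]
    (q : Fin (k + 1) → ℤ) (proj : ∀ i, L i → V i) (ϑ : ∀ i, OneForm (𝓡 (2 * n i + 1)) (L i))
    (pr : P → ∀ i, V i) (θ : OneForm (𝓡 d) P) : Prop where
  principal : IsPrincipalCircleBundle (𝓡 d) (ModelWithCorners.pi fun i => 𝓡 (2 * n i)) pr
  connection : IsPrincipalConnection (𝓡 d) θ
  associated : ∃ κ : (∀ i, L i) → P,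
    ContMDiff (ModelWithCorners.pi fun i => 𝓡 (2 * n i + 1)) (𝓡 d) ∞ κ ∧
    (∀ (l : ∀ i, L i) (i : Fin (k + 1)), pr (κ l) i = proj i (l i)) ∧
    (∀ (c : Fin (k + 1) → Circle) (l : ∀ i, L i),
      κ (fun i => c i • l i) = (∏ i, c i ^ q i) • κ l) ∧
    ∀ (l : ∀ i, L i) (u : ∀ i, TangentSpace (𝓡 (2 * n i + 1)) (l i)),
      θ (κ l) (mfderiv (ModelWithCorners.pi fun i => 𝓡 (2 * n i + 1)) (𝓡 d) κ l u) =
        ∑ i, (q i : ℝ) * ϑ i (l i) (u i)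

/-! ### The explicit functions -/

section Profile

variable {k : ℕ}

/-- `β_i(s) = A_i (s² - q_i² / (4 A_i²))`. -/
def betaFun (A : Fin (k + 1) → ℝ) (q : Fin (k + 1) → ℤ) (i : Fin (k + 1)) (s : ℝ) : ℝ :=
  A i * (s ^ 2 - (q i : ℝ) ^ 2 / (4 * A i ^ 2))

/-- `w = ∏ β_i ^ n_i`. -/
def wFun (n : Fin (k + 1) → ℕ) (A : Fin (k + 1) → ℝ) (q : Fin (k + 1) → ℤ) (s : ℝ) : ℝ :=
  ∏ i, betaFun A q i s ^ n i

/-- `s_* = -1 / (2 A_1)`. -/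
def sStar (A : Fin (k + 1) → ℝ) : ℝ := -1 / (2 * A 0)

/-- `α(s) = s^(p-1) / w(s) ∫_s^{s_*} w(τ) (ε τ² - ν) / τ^p dτ`, to be used for `0 < s < s_*`. -/
def alphaFun (pdim : ℕ) (n : Fin (k + 1) → ℕ) (A : Fin (k + 1) → ℝ) (q : Fin (k + 1) → ℤ)
    (ε ν s : ℝ) : ℝ :=
  s ^ (pdim - 1) / wFun n A q s *
    ∫ τ in s..sStar A, wFun n A q τ * (ε * τ ^ 2 - ν) / τ ^ pdim

/-- `φ(s) = (p - 2) (log s + log κ₁)`. -/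
def varphiFun (pdim : ℕ) (κ₁ s : ℝ) : ℝ := ((pdim : ℝ) - 2) * (Real.log s + Real.log κ₁)

/-- The system of ordinary differential equations satisfied by `α`, `β_i` and `φ` at `s`. -/
def SatisfiesODE (pdim : ℕ) (n p : Fin (k + 1) → ℕ) (q : Fin (k + 1) → ℤ) (ε : ℝ)
    (α φ : ℝ → ℝ) (β : Fin (k + 1) → ℝ → ℝ) (s : ℝ) : Prop :=
  let w : ℝ → ℝ := fun s => ∏ i, β i s ^ n i
  let lw : ℝ := deriv (fun s => Real.log (w s)) s
  α s * (deriv (deriv φ) s + deriv φ s ^ 2 / ((pdim : ℝ) - 2)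
      - ∑ i, (n i : ℝ) *
          (deriv (deriv (β i)) s / β i s - 1 / 2 * (deriv (β i) s / β i s) ^ 2))
    + deriv α s / 2 * (deriv φ s - lw) - deriv (deriv α) s / 2 = ε ∧
  deriv α s / 2 * (deriv φ s - lw) - deriv (deriv α) s / 2
    + α s / 2 * ∑ i, (n i : ℝ) * (q i : ℝ) ^ 2 / β i s ^ 2 = ε ∧
  ∀ i, α s / 2 * (deriv (β i) s / β i s * (deriv φ s - lw) - deriv (deriv (β i)) s / β i s
      + (deriv (β i) s / β i s) ^ 2 - (q i : ℝ) ^ 2 / β i s ^ 2)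
    - deriv α s / 2 * (deriv (β i) s / β i s) + (p i : ℝ) / β i s = ε

/-- `φ = min_i p_i² / q_i²`. -/
def phiMin (p : Fin (k + 1) → ℕ) (q : Fin (k + 1) → ℤ) : ℝ :=
  Finset.univ.inf' Finset.univ_nonempty fun i => (p i : ℝ) ^ 2 / (q i : ℝ) ^ 2

/-- The root `(p_i + √(p_i² + ν ε q_i²)) / (2 ν)`. -/
def rootPlus (p : Fin (k + 1) → ℕ) (q : Fin (k + 1) → ℤ) (ε ν : ℝ) (i : Fin (k + 1)) : ℝ :=
  1 / (2 * ν) * ((p i : ℝ) + √((p i : ℝ) ^ 2 + ν * ε * (q i : ℝ) ^ 2))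

/-- The root `(p_i - √(p_i² + ν ε q_i²)) / (2 ν)`. -/
def rootMinus (p : Fin (k + 1) → ℕ) (q : Fin (k + 1) → ℤ) (ε ν : ℝ) (i : Fin (k + 1)) : ℝ :=
  1 / (2 * ν) * ((p i : ℝ) - √((p i : ℝ) ^ 2 + ν * ε * (q i : ℝ) ^ 2))

/-- The list of choices of the constants `ν` and `A_i`. The index `0` plays the role of the first
factor `ℂP^{n_1}`, and the indices `i ≠ 0` that of the remaining factors. -/
inductive AdmissibleConstants (p : Fin (k + 1) → ℕ) (q : Fin (k + 1) → ℤ) (ε ν : ℝ)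
    (A : Fin (k + 1) → ℝ) : Prop
  | zero (hε : ε = 0) (hpq : ∀ i, i ≠ 0 → (p i : ℤ) < p 0 * |q i|) (hν : ν < 0)
      (hA : ∀ i, A i = p i / ν)
  | neg (hε : ε < 0) (hpq : ∀ i, i ≠ 0 → (p i : ℤ) < p 0 * |q i|) (hν : ν < 0)
      (hA : ∀ i, A i = rootPlus p q ε ν i)
  | pos_some (hε : 0 < ε) (hpq : ∃ i, i ≠ 0 ∧ (p i : ℤ) < p 0 * |q i|)
      (hν : ν ∈ Ico (-(phiMin p q / ε)) 0) (hA₀ : A 0 = rootPlus p q ε ν 0)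
      (hA : ∀ i, i ≠ 0 → A i = rootMinus p q ε ν i ∨
        ((p i : ℤ) < p 0 * |q i| ∧ A i = rootPlus p q ε ν i))
  | pos_eq (hε : 0 < ε) (hpq : ∀ i, i ≠ 0 → p 0 * |q i| ≤ (p i : ℤ))
      (hpq' : ∃ i, i ≠ 0 ∧ p 0 * |q i| = (p i : ℤ))
      (hν : ν ∈ Ioo (-(phiMin p q / ε)) 0) (hA₀ : A 0 = rootPlus p q ε ν 0)
      (hA : ∀ i, i ≠ 0 → A i = rootMinus p q ε ν i)
  | pos_lt (hε : 0 < ε) (hpq : ∀ i, i ≠ 0 → p 0 * |q i| < (p i : ℤ))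
      (hν : ν ∈ Ico (-(phiMin p q / ε)) 0)
      (hA₀ : A 0 = rootPlus p q ε ν 0 ∨ A 0 = rootMinus p q ε ν 0)
      (hA : ∀ i, i ≠ 0 → A i = rootMinus p q ε ν i)

end Profile

/-! ### Compactifications -/

/-- The Riemannian manifold `(0, T) × P` with the metric
`ds² / α(s) + α(s) θ ⊗ θ + ∑ β_i(s) pr^* h_i` extends to a smooth compact Riemannian manifold `(M, g)`
with boundary, by adding a copy of `V_2 × ⋯ × V_r` at `s = T` and the boundary `{0} × P` at `s = 0`.
The map `Ψ : [0, T] × P → M` is the collapsing map, `Φ` is the inverse of its restriction to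
`[0, T) × P`, which is a diffeomorphism onto an open set and an isometry, `ι` is the embedding of
`V_2 × ⋯ × V_r` onto the complement of this open set, and `S` is the smooth extension to `M` of the
coordinate `s`. -/
def CompactifiesSmoothly.{u, v} {k d : ℕ} {n : Fin (k + 1) → ℕ} {V : Fin (k + 1) → Type u}
    {P : Type v}
    [∀ i, TopologicalSpace (V i)] [∀ i, ChartedSpace (EuclideanSpace ℝ (Fin (2 * n i))) (V i)]
    [∀ i, IsManifold (𝓡 (2 * n i)) ∞ (V i)]
    [TopologicalSpace P] [ChartedSpace (EuclideanSpace ℝ (Fin d)) P]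
    (h : ∀ i, SmoothMetric (𝓡 (2 * n i)) (V i))
    (pr : P → ∀ i, V i) (θ : OneForm (𝓡 d) P)
    (α : ℝ → ℝ) (β : Fin (k + 1) → ℝ → ℝ) (T : ℝ) : Prop :=
  ∃ (M : Type v) (_ : TopologicalSpace M) (_ : ChartedSpace (EuclideanHalfSpace (d + 1)) M)
    (_ : IsManifold (𝓡∂ (d + 1)) ∞ M) (_ : T2Space M) (_ : CompactSpace M)
    (g : SmoothMetric (𝓡∂ (d + 1)) M)
    (Ψ : ℝ × P → M) (Φ : M → ℝ × P) (ι : (∀ j : Fin k, V j.succ) → M) (S : M → ℝ),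
    let U : Set (ℝ × P) := Ico 0 T ×ˢ univ
    let IP := 𝓘(ℝ, ℝ).prod (𝓡 d)
    -- `[0, T) × P` is an open submanifold with boundary, whose interior is dense
    ContMDiffOn IP (𝓡∂ (d + 1)) ∞ Ψ U ∧ IsOpen (Ψ '' U) ∧
    ContMDiffOn (𝓡∂ (d + 1)) IP ∞ Φ (Ψ '' U) ∧ (∀ y ∈ U, Φ (Ψ y) = y) ∧
    Dense (Ψ '' (Ioo 0 T ×ˢ univ)) ∧
    (𝓡∂ (d + 1)).boundary M = Ψ '' ({0} ×ˢ univ) ∧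
    -- the metric is the given one
    (∀ s ∈ Ico 0 T, ∀ (x : P) (u v : TangentSpace IP ((s, x) : ℝ × P)),
      g.inner (Ψ (s, x)) (mfderivWithin IP (𝓡∂ (d + 1)) Ψ U (s, x) u)
          (mfderivWithin IP (𝓡∂ (d + 1)) Ψ U (s, x) v) =
        u.1 * v.1 / α s + α s * (θ x u.2 * θ x v.2) +
          ∑ i, β i s * (h i).inner (pr x i)
            (mfderiv (𝓡 d) (𝓡 (2 * n i)) (fun y => pr y i) x u.2)
            (mfderiv (𝓡 d) (𝓡 (2 * n i)) (fun y => pr y i) x v.2)) ∧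
    -- at `s = T` the slices `{s} × P` collapse onto an embedded copy of `V_2 × ⋯ × V_r`
    ContinuousOn Ψ (Icc 0 T ×ˢ univ) ∧ (∀ x, Ψ (T, x) = ι fun j => pr x j.succ) ∧
    ContMDiff (ModelWithCorners.pi fun j : Fin k => 𝓡 (2 * n j.succ)) (𝓡∂ (d + 1)) ∞ ι ∧
    Function.Injective ι ∧
    (∀ b, Function.Injective
      (mfderiv (ModelWithCorners.pi fun j : Fin k => 𝓡 (2 * n j.succ)) (𝓡∂ (d + 1)) ι b)) ∧
    range ι = (Ψ '' U)ᶜ ∧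
    -- the coordinate `s` extends smoothly
    ContMDiff (𝓡∂ (d + 1)) 𝓘(ℝ, ℝ) ∞ S ∧ ∀ s ∈ Icc 0 T, ∀ x, S (Ψ (s, x)) = s

end

/-!
Write `T = s_*`. The factor with the Hopf fibration has the index `0`.

The functions. The function `α` is characterized by the first-order linear equation
`α' = α ((p - 1) / s - (log w)') - (ε s - ν / s)` and `α(T) = 0`. Since `w` is an even polynomial
of degree `m - 2`, the polynomial `w (ε s² - ν)` has no term of degree `p - 1` (for `p = m + 1`
because `ε = 0`), so the integral of `w (ε s² - ν) / s^p` contains no logarithm, and `α w` is a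
polynomial (`Polynomial.exists_X_mul_derivative_sub_eq`). The equation shows that this polynomial
vanishes at `T` to one order more than `w`, whence `α = 2 (T - s) f` with a smooth positive
function `f`, and `f(T) = 1` follows from `ε T² - ν = 2 p_0 T`, which is the quadratic equation
for `A_0` (`exists_profile`). The system of ordinary differential equations reduces to the
first-order equation and to the quadratic equations for the `A_i` (`satisfiesODE_of_hasDerivAt`).
The inequality `|A_i| < |q_i| |A_0|`, which keeps `β_i` positive up to `T`, holds because all
admissible `A_i` are of the form `|q_i| (a ± √(a² + ν ε)) / (2 ν)` with `a = p_i / |q_i|`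
(`AdmissibleConstants.properties`).

The topology. As `|q_0| = 1`, the circle of the Hopf fibration absorbs the structure group of `P`,
and the projection of `P` to the product of the other factors is a bundle of unit spheres in
`ℂ^{n_0 + 1}` with transition functions in `U(1)` (`HopfAssociated.sphereBundle`). Collapsing its
fibres at `s = T` in `[0, T] × P` gives the closed disc bundle of the associated vector bundle,
with the coordinate `ζ = √(2 (T - s)) z` in the fibres (`SphereBundle.Collapse`). Its charts are
those of `[0, T) × P`, and products of charts of the base with `ζ`, moved into the interior of the
half space by the exponential function.

The metric. The connection on `P` is `θ = ± ⟪i z, dz⟫ + a`, with a potential `a` on the base, so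
that `Dζ = dζ ± a i ζ` is smooth on the disc bundle (`HopfAssociated.form_eq`). Since
`β_0 = (T - s) b` with `b = (s + T) / 2T`, the part of the metric along the fibres is
`b |Dζ|² + c₁ ⟪ζ, Dζ⟫² + c₂ ⟪i ζ, Dζ⟫²` with `2 (T - s) c₁ = 1 / f - b` and `2 (T - s) c₂ = f - b`
(`polar_identity`). Both right-hand sides vanish at `T`, so `c₁` and `c₂` are smooth, and the
metric extends smoothly over the zero section; it is positive because `b`, `f` and the other `β_i`
are (`SphereBundle.Geometry.discMetric`).
-/

noncomputable section

/-! ### Polynomial solutions of the first-order profile equation -/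

section PolynomialODE

open Polynomial

/-- The Euler operator `Q ↦ X Q' - N Q` is diagonal on monomials, with kernel spanned by `X ^ N`. -/
lemma Polynomial.exists_X_mul_derivative_sub_eq (N : ℕ) (f : ℝ[X]) (hf : f.coeff N = 0) :
    ∃ Q : ℝ[X], X * derivative Q - C (N : ℝ) * Q = f := by
  refine ⟨∑ k ∈ f.support, monomial k (f.coeff k / ((k : ℝ) - N)), ?_⟩
  set Q : ℝ[X] := ∑ k ∈ f.support, monomial k (f.coeff k / ((k : ℝ) - N)) with hQ
  have hc : ∀ k, Q.coeff k = f.coeff k / ((k : ℝ) - N) := by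
    intro k
    rw [hQ, finsetSum_coeff]
    simp only [coeff_monomial]
    rw [Finset.sum_ite_eq']
    split_ifs with h
    · rfl
    · rw [notMem_support_iff.1 h, zero_div]
  ext k
  have h1 : (X * derivative Q).coeff k = k * Q.coeff k := by
    cases k with
    | zero => simp
    | succ k => rw [coeff_X_mul, coeff_derivative]; push_cast; ring
  rw [coeff_sub, h1, coeff_C_mul, hc]
  by_cases hk : k = N
  · subst hk; simp [hf]
  · have : (k : ℝ) - N ≠ 0 := sub_ne_zero.2 (by exact_mod_cast hk)
    field_simp

/-- A solution of `X P' - N P = -f` that vanishes at `T ≠ 0` vanishes there to one order more than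
`f` does. -/
lemma Polynomial.pow_succ_dvd_of_X_mul_derivative_sub_eq {N : ℕ} {f P : ℝ[X]} {T : ℝ} (hT : T ≠ 0)
    (hP : X * derivative P - C (N : ℝ) * P = -f) {n : ℕ} (hf : (X - C T) ^ n ∣ f)
    (h0 : P.eval T = 0) : (X - C T) ^ (n + 1) ∣ P := by
  suffices h : ∀ j ≤ n, (X - C T) ^ (j + 1) ∣ P from h n le_rfl
  intro j
  induction j with
  | zero => intro _; simpa using dvd_iff_isRoot.2 h0
  | succ j ih =>
    intro hj
    obtain ⟨R, hR⟩ := ih (by omega)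
    obtain ⟨f', hf'⟩ := (pow_dvd_pow (X - C T) hj).trans hf
    have hne : (X - C T) ^ j ≠ 0 := pow_ne_zero _ (X_sub_C_ne_zero T)
    have key : C ((j : ℝ) + 1) * X * R
        = (X - C T) * (C (N : ℝ) * R - f' - X * derivative R) := by
      have h2 := hP
      rw [hR, derivative_mul, derivative_X_sub_C_pow, hf'] at h2
      simp only [Nat.cast_add, Nat.cast_one, Nat.add_sub_cancel] at h2
      apply mul_left_cancel₀ hne
      linear_combination h2
    have hroot : R.eval T = 0 := by
      have := congrArg (Polynomial.eval T) key
      simp only [eval_mul, eval_C, eval_X, eval_sub, sub_self, zero_mul] at this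
      have h3 : ((j : ℝ) + 1) * T ≠ 0 := mul_ne_zero (by positivity) hT
      exact (mul_eq_zero.1 this).resolve_left h3
    obtain ⟨R', hR'⟩ := dvd_iff_isRoot.2 hroot
    exact ⟨R', by rw [hR, hR']; ring⟩

/-- The leading coefficient at `T` of a solution of `X P' - N P = -f` vanishing at `T`. -/
lemma Polynomial.eval_of_X_mul_derivative_sub_eq {N : ℕ} {f' R : ℝ[X]} {T : ℝ} {n : ℕ}
    (hP : X * derivative ((X - C T) ^ (n + 1) * R) - C (N : ℝ) * ((X - C T) ^ (n + 1) * R)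
      = -((X - C T) ^ n * f')) : T * (n + 1) * R.eval T = -f'.eval T := by
  have hne : (X - C T) ^ n ≠ 0 := pow_ne_zero _ (X_sub_C_ne_zero T)
  have key : C ((n : ℝ) + 1) * X * R
      = (X - C T) * (C (N : ℝ) * R - X * derivative R) - f' := by
    have h2 := hP
    rw [derivative_mul, derivative_X_sub_C_pow] at h2
    simp only [Nat.cast_add, Nat.cast_one, Nat.add_sub_cancel] at h2
    apply mul_left_cancel₀ hne
    linear_combination h2
  have := congrArg (Polynomial.eval T) key
  simp only [eval_mul, eval_C, eval_X, eval_sub, sub_self, zero_mul] at this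
  linear_combination this

end PolynomialODE

/-! ### The profile functions -/

section ProfileFunctions

open Polynomial

variable {k : ℕ}

/-- `β_i` as a polynomial in `s ^ 2`. -/
def betaPoly (A : Fin (k + 1) → ℝ) (q : Fin (k + 1) → ℤ) (i : Fin (k + 1)) : ℝ[X] :=
  C (A i) * (X - C ((q i : ℝ) ^ 2 / (4 * A i ^ 2)))

/-- The polynomial `w (ε s ^ 2 - ν)`, as a polynomial in `s ^ 2`. -/
def forcingPoly (n : Fin (k + 1) → ℕ) (A : Fin (k + 1) → ℝ) (q : Fin (k + 1) → ℤ) (ε ν : ℝ) :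
    ℝ[X] :=
  (∏ i, betaPoly A q i ^ n i) * (C ε * X - C ν)

lemma eval_expand_betaPoly (A : Fin (k + 1) → ℝ) (q : Fin (k + 1) → ℤ) (i : Fin (k + 1)) (s : ℝ) :
    (betaPoly A q i).eval (s ^ 2) = betaFun A q i s := by
  simp [betaPoly, betaFun]

lemma eval_expand_forcingPoly (n : Fin (k + 1) → ℕ) (A : Fin (k + 1) → ℝ)
    (q : Fin (k + 1) → ℤ) (ε ν s : ℝ) :
    (expand ℝ 2 (forcingPoly n A q ε ν)).eval s = wFun n A q s * (ε * s ^ 2 - ν) := by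
  rw [expand_eval, forcingPoly, eval_mul, eval_prod]
  simp [eval_expand_betaPoly, wFun]

lemma natDegree_prod_betaPoly_le (n : Fin (k + 1) → ℕ) (A : Fin (k + 1) → ℝ)
    (q : Fin (k + 1) → ℤ) : (∏ i, betaPoly A q i ^ n i).natDegree ≤ ∑ i, n i := by
  refine (natDegree_prod_le _ _).trans (Finset.sum_le_sum fun i _ => ?_)
  refine natDegree_pow_le.trans ?_
  have : (betaPoly A q i).natDegree ≤ 1 :=
    (natDegree_C_mul_le _ _).trans (natDegree_X_sub_C_le _)
  nlinarith

/-- The absence of a logarithmic term: `w (ε s ^ 2 - ν)` has no term of degree `p - 1`. It is an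
even polynomial of degree at most `m`, respectively `m - 2` if `ε = 0`. -/
lemma coeff_expand_forcingPoly (n : Fin (k + 1) → ℕ) (A : Fin (k + 1) → ℝ)
    (q : Fin (k + 1) → ℤ) (ε ν : ℝ) {m dimN : ℕ} (hm : m = 2 + ∑ i, 2 * n i)
    (hN : dimN = 1 → ε = 0) :
    (expand ℝ 2 (forcingPoly n A q ε ν)).coeff (m + dimN - 1) = 0 := by
  rw [coeff_expand (by norm_num)]
  split_ifs with h
  · obtain ⟨t, ht⟩ := h
    rw [ht, Nat.mul_div_cancel_left _ (by norm_num)]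
    rw [← Finset.mul_sum] at hm
    have h1 := natDegree_prod_betaPoly_le n A q
    apply coeff_eq_zero_of_natDegree_lt
    by_cases h2 : dimN = 1
    · have hε := hN h2
      subst hε
      refine lt_of_le_of_lt natDegree_mul_le ?_
      have : (C (0 : ℝ) * X - C ν).natDegree = 0 := by simp
      omega
    · refine lt_of_le_of_lt natDegree_mul_le ?_
      have : (C ε * X - C ν).natDegree ≤ 1 := by
        refine (natDegree_sub_C).le.trans ?_
        exact (natDegree_C_mul_le _ _).trans natDegree_X_le
      omega
  · rfl

end ProfileFunctions

/-! ### Smoothness and positivity of the profile -/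

section ProfileExistence

open Polynomial

variable {k : ℕ}

/-- The integral in the definition of `α`, in terms of a polynomial solution of
`X Q' - (p - 1) Q = w (ε s ^ 2 - ν)`. -/
lemma integral_forcing_eq {N : ℕ} {f Q : ℝ[X]} (hQ : X * derivative Q - C (N : ℝ) * Q = f)
    {s T : ℝ} (hs : 0 < s) (hT : 0 < T) :
    ∫ τ in s..T, f.eval τ / τ ^ (N + 1) = Q.eval T / T ^ N - Q.eval s / s ^ N := by
  have hpos : ∀ τ ∈ uIcc s T, 0 < τ := fun τ hτ =>
    lt_of_lt_of_le (lt_min hs hT) (by simpa [uIcc] using hτ.1)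
  refine intervalIntegral.integral_eq_sub_of_hasDerivAt (f := fun τ => Q.eval τ / τ ^ N) ?_ ?_
  · intro τ hτ
    have hτ0 := (hpos τ hτ).ne'
    refine ((Q.hasDerivAt τ).div (hasDerivAt_pow N τ) (pow_ne_zero _ hτ0)).congr_deriv ?_
    rw [← hQ]
    simp only [eval_sub, eval_mul, eval_X, eval_C]
    cases N with
    | zero => simp; field_simp
    | succ N => field_simp; push_cast; ring
  · apply ContinuousOn.intervalIntegrable
    exact f.continuous.continuousOn.div (by fun_prop)
      fun τ hτ => pow_ne_zero _ (hpos τ hτ).ne'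

/-- The logarithmic derivative of `w`. -/
def logDerivW (n : Fin (k + 1) → ℕ) (A : Fin (k + 1) → ℝ) (q : Fin (k + 1) → ℤ) (s : ℝ) : ℝ :=
  ∑ i, (n i : ℝ) * (2 * A i * s / betaFun A q i s)

lemma hasDerivAt_betaFun (A : Fin (k + 1) → ℝ) (q : Fin (k + 1) → ℤ) (i : Fin (k + 1)) (s : ℝ) :
    HasDerivAt (betaFun A q i) (2 * A i * s) s := by
  refine (((hasDerivAt_pow 2 s).sub_const _).const_mul (A i)).congr_deriv ?_
  simp; ring

lemma hasDerivAt_wFun (n : Fin (k + 1) → ℕ) (A : Fin (k + 1) → ℝ) (q : Fin (k + 1) → ℤ) {s : ℝ}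
    (h : ∀ i, betaFun A q i s ≠ 0) :
    HasDerivAt (wFun n A q) (wFun n A q s * logDerivW n A q s) s := by
  have h1 : HasDerivAt (fun s => ∏ i, betaFun A q i s ^ n i)
      (∑ i, (∏ j ∈ Finset.univ.erase i, betaFun A q j s ^ n j) •
        ((n i : ℝ) * betaFun A q i s ^ (n i - 1) * (2 * A i * s))) s :=
    HasDerivAt.fun_finsetProd fun i _ => (hasDerivAt_betaFun A q i s).fun_pow (n i)
  refine h1.congr_deriv ?_
  rw [logDerivW, Finset.mul_sum]
  refine Finset.sum_congr rfl fun i _ => ?_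
  rw [wFun, ← Finset.mul_prod_erase _ _ (Finset.mem_univ i), smul_eq_mul]
  rcases Nat.eq_zero_or_pos (n i) with h0 | h0
  · simp [h0]
  · obtain ⟨t, ht⟩ : ∃ t, n i = t + 1 := ⟨n i - 1, by omega⟩
    have := h i
    rw [ht, Nat.add_sub_cancel, pow_succ]
    field_simp

lemma contDiffOn_eval_div {R W : ℝ[X]} {s : Set ℝ} (hW : ∀ x ∈ s, W.eval x ≠ 0) :
    ContDiffOn ℝ ∞ (fun x => R.eval x / W.eval x) s :=
  R.contDiff_aeval ∞ |>.contDiffOn.div (W.contDiff_aeval ∞).contDiffOn hW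

/-- The function `α` extends smoothly to `[0, T]`, where `T = s_*`, in the form
`α = 2 (T - s) f` with `f > 0`. The functions `(1 / f - b) / (2 (T - s))` and
`(f - b) / (2 (T - s))` with `b = (s + T) / (2 T)`, which are the coefficients of the metric around
`s = T`, are smooth as well. -/
theorem exists_profile {n p : Fin (k + 1) → ℕ} {A : Fin (k + 1) → ℝ} {q : Fin (k + 1) → ℤ}
    {ε ν : ℝ} {m dimN pdim : ℕ} (hm : m = 2 + ∑ i, 2 * n i) (hm4 : 4 ≤ m)
    (hpdim : pdim = m + dimN) (hN : dimN = 1 → ε = 0) (hq₀ : |q 0| = 1) (hp₀ : p 0 = n 0 + 1)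
    (hν : ν < 0) (hA : A 0 < 0) (hA' : ε * (q 0 : ℝ) ^ 2 / (4 * A 0 ^ 2) + p 0 / A 0 = ν)
    (hβ : ∀ i, ∀ s ∈ Ico 0 (sStar A), 0 < betaFun A q i s)
    (hβT : ∀ i, i ≠ 0 → 0 < betaFun A q i (sStar A)) :
    ∃ α f c₁ c₂ : ℝ → ℝ,
      ContDiffOn ℝ ∞ α (Icc 0 (sStar A)) ∧ ContDiffOn ℝ ∞ f (Icc 0 (sStar A)) ∧
      ContDiffOn ℝ ∞ c₁ (Icc 0 (sStar A)) ∧ ContDiffOn ℝ ∞ c₂ (Icc 0 (sStar A)) ∧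
      (∀ s ∈ Icc 0 (sStar A), 0 < f s) ∧
      (∀ s, α s = 2 * (sStar A - s) * f s) ∧
      f (sStar A) = 1 ∧
      (∀ s ∈ Icc 0 (sStar A),
        2 * (sStar A - s) * c₁ s = 1 / f s - (s + sStar A) / (2 * sStar A)) ∧
      (∀ s ∈ Icc 0 (sStar A),
        2 * (sStar A - s) * c₂ s = f s - (s + sStar A) / (2 * sStar A)) ∧
      (∀ s ∈ Ioo 0 (sStar A), α s = alphaFun pdim n A q ε ν s) ∧
      α 0 = ν / (1 - pdim) ∧
      ∀ s ∈ Ioo 0 (sStar A), HasDerivAt α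
        (α s * (((pdim : ℝ) - 1) / s - logDerivW n A q s) - (ε * s - ν / s)) s := by
  set T := sStar A with hTdef
  have hT : 0 < T := by
    rw [hTdef, sStar]; exact div_pos_of_neg_of_neg (by norm_num) (by linarith)
  have hAT : A 0 = -1 / (2 * T) := by
    rw [hTdef, sStar]; field_simp
  have hq2 : (q 0 : ℝ) ^ 2 = 1 := by
    have : (q 0) ^ 2 = 1 := by rw [← sq_abs, hq₀]; norm_num
    exact_mod_cast this
  -- the value of `ε s ^ 2 - ν` at `T`
  have hεT : ε * T ^ 2 - ν = 2 * p 0 * T := by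
    rw [← hA', hq2, hAT]; field_simp; ring
  obtain ⟨N, hNp⟩ : ∃ N, pdim = N + 1 := ⟨pdim - 1, by omega⟩
  have hN1 : N = m + dimN - 1 := by omega
  have hNpos : 0 < N := by omega
  set F : ℝ[X] := expand ℝ 2 (forcingPoly n A q ε ν) with hF
  have hFe : ∀ s, F.eval s = wFun n A q s * (ε * s ^ 2 - ν) := eval_expand_forcingPoly n A q ε ν
  obtain ⟨Q, hQ⟩ := exists_X_mul_derivative_sub_eq N F
    (by rw [hN1]; exact coeff_expand_forcingPoly n A q ε ν hm hN)
  -- the polynomial `α w`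
  set P : ℝ[X] := C (Q.eval T / T ^ N) * X ^ N - Q with hP
  have hPode : X * derivative P - C (N : ℝ) * P = -F := by
    rw [← hQ, hP, derivative_sub, derivative_C_mul_X_pow]
    obtain ⟨t, rfl⟩ : ∃ t, N = t + 1 := ⟨N - 1, by omega⟩
    rw [Nat.add_sub_cancel, C_mul, pow_succ]
    ring
  have hP0 : P.eval T = 0 := by
    simp only [hP, eval_sub, eval_mul, eval_C, eval_pow, eval_X]
    field_simp; ring
  -- `W` is the quotient of `w` by `(s - T) ^ n 0`; it has no zeros in `[0, T]`
  set W : ℝ[X] := (C (A 0) * (X + C T)) ^ n 0 *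
    ∏ j : Fin k, (expand ℝ 2 (betaPoly A q j.succ)) ^ n j.succ with hW
  have hβ0 : ∀ s, betaFun A q 0 s = A 0 * ((s - T) * (s + T)) := by
    intro s
    rw [betaFun, hq2, hAT]; field_simp; ring
  have hWe : ∀ s, (s - T) ^ n 0 * W.eval s = wFun n A q s := by
    intro s
    rw [wFun, Fin.prod_univ_succ, hβ0, hW, eval_mul, eval_prod]
    simp only [eval_pow, eval_mul, eval_C, eval_add, eval_X, expand_eval, eval_expand_betaPoly]
    rw [← mul_assoc, ← mul_pow]
    congr 2
    ring
  have hWne : ∀ s ∈ Icc 0 T, W.eval s ≠ 0 := by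
    intro s hs
    rw [hW, eval_mul, eval_prod]
    simp only [eval_pow, eval_mul, eval_C, eval_add, eval_X, expand_eval, eval_expand_betaPoly]
    refine mul_ne_zero (pow_ne_zero _ (mul_ne_zero hA.ne (by linarith [hs.1])))
      (Finset.prod_ne_zero_iff.2 fun j _ => pow_ne_zero _ ?_)
    rcases hs.2.lt_or_eq with h | h
    · exact (hβ _ s ⟨hs.1, h⟩).ne'
    · rw [h]; exact (hβT _ (Fin.succ_ne_zero j)).ne'
  have hFW : F = (X - C T) ^ n 0 * (W * (C ε * X ^ 2 - C ν)) := by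
    apply Polynomial.funext
    intro s
    rw [hFe, ← hWe]
    simp
    ring
  obtain ⟨R, hR⟩ := pow_succ_dvd_of_X_mul_derivative_sub_eq hT.ne' hPode ⟨_, hFW⟩ hP0
  -- the residue at `T` which makes `α' = -2` there
  have hRT : R.eval T = -2 * W.eval T := by
    have h1 := hPode
    rw [hR, hFW] at h1
    have h2 := eval_of_X_mul_derivative_sub_eq h1
    simp only [eval_mul, eval_sub, eval_C, eval_pow, eval_X, hεT, hp₀] at h2
    push_cast at h2
    have h3 : T * ((n 0 : ℝ) + 1) ≠ 0 := by positivity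
    apply mul_left_cancel₀ h3
    linear_combination h2
  set f : ℝ → ℝ := fun s => (C (-1 / 2) * R).eval s / W.eval s with hf
  set α : ℝ → ℝ := fun s => 2 * (T - s) * f s with hα
  have hwpos : ∀ s ∈ Ico 0 T, 0 < wFun n A q s := fun s hs =>
    Finset.prod_pos fun i _ => pow_pos (hβ i s hs) _
  have hαw : ∀ s ∈ Ico 0 T, α s = P.eval s / wFun n A q s := by
    intro s hs
    have h1 : s - T ≠ 0 := sub_ne_zero.2 hs.2.ne
    have h2 := hWne s (Ico_subset_Icc_self hs)
    rw [← hWe, hR, hα, hf]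
    simp only [eval_mul, eval_pow, eval_sub, eval_X, eval_C]
    field_simp
    ring
  have hint : ∀ s ∈ Ioo 0 T, α s = alphaFun pdim n A q ε ν s := by
    intro s hs
    have hw := (hwpos s (Ioo_subset_Ico_self hs)).ne'
    rw [hαw s (Ioo_subset_Ico_self hs), alphaFun, hNp, Nat.add_sub_cancel]
    have h1 := integral_forcing_eq hQ hs.1 hT
    simp only [hFe] at h1
    rw [← hTdef, h1, hP]
    simp only [eval_sub, eval_mul, eval_C, eval_pow, eval_X]
    have := hs.1.ne'
    field_simp
  have hQ0 : -(N : ℝ) * Q.eval 0 = wFun n A q 0 * (-ν) := by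
    have h1 := congrArg (Polynomial.eval 0) hQ
    rw [hFe] at h1
    simp only [eval_sub, eval_mul, eval_C, eval_X] at h1
    linear_combination h1
  have hα0 : α 0 = ν / (1 - pdim) := by
    have hw := (hwpos 0 ⟨le_rfl, hT⟩).ne'
    have hN0 : (N : ℝ) ≠ 0 := by exact_mod_cast hNpos.ne'
    rw [hαw 0 ⟨le_rfl, hT⟩, hP, hNp]
    simp only [eval_sub, eval_mul, eval_C, eval_pow, eval_X, zero_pow hNpos.ne']
    have h4 : (1 : ℝ) - ((N + 1 : ℕ) : ℝ) ≠ 0 := by push_cast; simpa using hN0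
    rw [div_eq_div_iff hw h4]
    push_cast
    linear_combination -hQ0
  -- `ε τ ^ 2 - ν` is positive at both ends of `[0, T]`, and monotone in between
  have hforce : ∀ τ ∈ Icc 0 T, 0 < ε * τ ^ 2 - ν := by
    intro τ hτ
    have h1 : 0 < ε * T ^ 2 - ν := by rw [hεT, hp₀]; positivity
    have h2 : τ ^ 2 ≤ T ^ 2 := pow_le_pow_left₀ hτ.1 hτ.2 2
    rcases le_or_gt 0 ε with h | h
    · have := mul_nonneg h (sq_nonneg τ); linarith
    · nlinarith
  have hαpos : ∀ s ∈ Ico 0 T, 0 < α s := by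
    intro s hs
    rcases hs.1.eq_or_lt with h | h
    · rw [← h, hα0]
      refine div_pos_of_neg_of_neg hν ?_
      have : (1 : ℝ) < pdim := by rw [hNp]; exact_mod_cast Nat.succ_lt_succ hNpos
      linarith
    · rw [hint s ⟨h, hs.2⟩, alphaFun]
      refine mul_pos (div_pos (pow_pos h _) (hwpos s hs)) ?_
      refine intervalIntegral.intervalIntegral_pos_of_pos_on ?_ ?_ hs.2
      · apply ContinuousOn.intervalIntegrable
        have hc : Continuous (wFun n A q) := by
          have : wFun n A q = fun s => (∏ i, (expand ℝ 2 (betaPoly A q i)) ^ n i).eval s := by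
            ext s; simp [wFun, eval_prod, eval_expand_betaPoly]
          rw [this]; exact Polynomial.continuous _
        refine ContinuousOn.div (by fun_prop) (by fun_prop) fun τ hτ => pow_ne_zero _ ?_
        rw [uIcc_of_le hs.2.le] at hτ
        exact (h.trans_le hτ.1).ne'
      · intro τ hτ
        have h0 : 0 < τ := h.trans hτ.1
        exact div_pos (mul_pos (hwpos τ ⟨h0.le, hτ.2⟩) (hforce τ ⟨h0.le, hτ.2.le⟩)) (pow_pos h0 _)
  have hfT : f T = 1 := by
    simp only [hf, eval_mul, eval_C, hRT]
    have := hWne T ⟨hT.le, le_rfl⟩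
    field_simp
  have hfpos : ∀ s ∈ Icc 0 T, 0 < f s := by
    intro s hs
    rcases hs.2.lt_or_eq with h | h
    · have h1 := hαpos s ⟨hs.1, h⟩
      simp only [hα] at h1
      exact (pos_iff_pos_of_mul_pos h1).1 (by linarith)
    · rw [h, hfT]; norm_num
  have hRne : ∀ s ∈ Icc 0 T, R.eval s ≠ 0 := by
    intro s hs h0
    have := hfpos s hs
    simp [hf, h0] at this
  -- `f - b` and `1 / f - b` have polynomial numerators that vanish at `T`
  obtain ⟨R₁, hR₁⟩ : ∃ R₁ : ℝ[X], W * C (-2) - C (1 / (2 * T)) * (X + C T) * R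
      = (X - C T) * R₁ := by
    refine dvd_iff_isRoot.2 ?_
    simp only [IsRoot, eval_sub, eval_mul, eval_C, eval_add, eval_X, hRT]
    field_simp
    ring
  obtain ⟨R₂, hR₂⟩ : ∃ R₂ : ℝ[X], C (-1 / 2) * R - C (1 / (2 * T)) * (X + C T) * W
      = (X - C T) * R₂ := by
    refine dvd_iff_isRoot.2 ?_
    simp only [IsRoot, eval_sub, eval_mul, eval_C, eval_add, eval_X, hRT]
    field_simp
    ring
  have hfs : ContDiffOn ℝ ∞ f (Icc 0 T) := contDiffOn_eval_div hWne
  have hαs : ContDiffOn ℝ ∞ α (Icc 0 T) := ContDiffOn.mul (by fun_prop) hfs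
  refine ⟨α, f, fun s => (C (-1 / 2) * R₁).eval s / R.eval s,
    fun s => (C (-1 / 2) * R₂).eval s / W.eval s, hαs, hfs, contDiffOn_eval_div hRne,
    contDiffOn_eval_div hWne, hfpos, fun s => rfl, hfT, ?_, ?_, hint, hα0, ?_⟩
  · intro s hs
    have h1 := congrArg (Polynomial.eval s) hR₁
    simp only [eval_sub, eval_mul, eval_C, eval_add, eval_X] at h1
    have h2 := hRne s hs
    have h3 := hWne s hs
    simp only [hf, eval_mul, eval_C]
    field_simp at h1 ⊢
    linear_combination -h1
  · intro s hs
    have h1 := congrArg (Polynomial.eval s) hR₂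
    simp only [eval_sub, eval_mul, eval_C, eval_add, eval_X] at h1
    have h3 := hWne s hs
    simp only [hf, eval_mul, eval_C]
    field_simp at h1 ⊢
    linear_combination -h1
  · intro s hs
    have hw := hwpos s (Ioo_subset_Ico_self hs)
    have h1 : HasDerivAt (fun s => P.eval s / wFun n A q s)
        (((derivative P).eval s * wFun n A q s -
          P.eval s * (wFun n A q s * logDerivW n A q s)) / wFun n A q s ^ 2) s :=
      (P.hasDerivAt s).div
        (hasDerivAt_wFun n A q fun i => (hβ i s (Ioo_subset_Ico_self hs)).ne') hw.ne'
    refine (h1.congr_of_eventuallyEq ?_).congr_deriv ?_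
    · filter_upwards [Ioo_mem_nhds hs.1 hs.2] with x hx
      exact hαw x (Ioo_subset_Ico_self hx)
    · have h2 := congrArg (Polynomial.eval s) hPode
      simp only [eval_sub, eval_mul, eval_C, eval_X, eval_neg, hFe] at h2
      rw [hαw s (Ioo_subset_Ico_self hs), hNp]
      have hs0 := hs.1.ne'
      push_cast
      field_simp
      linear_combination h2

end ProfileExistence

/-! ### The system of ordinary differential equations -/

section System

variable {k : ℕ}

lemma hasDerivAt_logDerivW (n : Fin (k + 1) → ℕ) (A : Fin (k + 1) → ℝ) (q : Fin (k + 1) → ℤ)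
    {s : ℝ} (h : ∀ i, betaFun A q i s ≠ 0) :
    HasDerivAt (logDerivW n A q)
      (∑ i, (n i : ℝ) * (2 * A i / betaFun A q i s - (2 * A i * s / betaFun A q i s) ^ 2)) s := by
  have h1 : HasDerivAt (fun s => ∑ i, (n i : ℝ) * (2 * A i * s / betaFun A q i s))
      (∑ i, (n i : ℝ) * ((2 * A i * 1 * betaFun A q i s - 2 * A i * s * (2 * A i * s))
        / betaFun A q i s ^ 2)) s :=
    HasDerivAt.fun_sum fun i _ =>
      ((((hasDerivAt_id s).const_mul (2 * A i)).div (hasDerivAt_betaFun A q i s) (h i)).const_mul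
        (n i : ℝ))
  refine h1.congr_deriv (Finset.sum_congr rfl fun i _ => ?_)
  have := h i
  field_simp

lemma deriv_betaFun (A : Fin (k + 1) → ℝ) (q : Fin (k + 1) → ℤ) (i : Fin (k + 1)) :
    deriv (betaFun A q i) = fun s => 2 * A i * s :=
  funext fun s => (hasDerivAt_betaFun A q i s).deriv

lemma deriv_deriv_betaFun (A : Fin (k + 1) → ℝ) (q : Fin (k + 1) → ℤ) (i : Fin (k + 1)) (s : ℝ) :
    deriv (deriv (betaFun A q i)) s = 2 * A i := by
  rw [deriv_betaFun]
  simp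

lemma hasDerivAt_varphiFun (pdim : ℕ) (κ₁ : ℝ) {s : ℝ} (hs : 0 < s) :
    HasDerivAt (varphiFun pdim κ₁) (((pdim : ℝ) - 2) / s) s := by
  refine (((Real.hasDerivAt_log hs.ne').add_const _).const_mul _).congr_deriv ?_
  rw [div_eq_mul_inv]

lemma deriv_deriv_varphiFun (pdim : ℕ) (κ₁ : ℝ) {s : ℝ} (hs : 0 < s) :
    deriv (deriv (varphiFun pdim κ₁)) s = -(((pdim : ℝ) - 2) / s ^ 2) := by
  have h1 : deriv (varphiFun pdim κ₁) =ᶠ[𝓝 s] fun s => ((pdim : ℝ) - 2) / s := by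
    filter_upwards [Ioi_mem_nhds hs] with x hx
    exact (hasDerivAt_varphiFun pdim κ₁ hx).deriv
  rw [h1.deriv_eq]
  have h2 := ((hasDerivAt_const s ((pdim : ℝ) - 2)).div (hasDerivAt_id s) hs.ne').deriv
  refine h2.trans ?_
  simp
  ring

/-- The first-order linear equation for `α` implies the whole system. By the quadratic equation for
`A i`, it is equivalent to the third equation of the system. Its derivative gives the second one,
since `s⁻¹ (log w)' + (log w)'' = -∑ n_i q_i² / β_i²`. The first equation agrees with the second,
because `β_i'' / β_i - (β_i' / β_i)² / 2 = -q_i² / (2 β_i²)` and `φ'' + φ'² / (p - 2) = 0`. -/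
theorem satisfiesODE_of_hasDerivAt {n p : Fin (k + 1) → ℕ} {A : Fin (k + 1) → ℝ}
    {q : Fin (k + 1) → ℤ} {ε ν T : ℝ} {pdim : ℕ} (hpdim : 2 < pdim)
    (hA : ∀ i, A i < 0 ∧ ε * (q i : ℝ) ^ 2 / (4 * A i ^ 2) + p i / A i = ν)
    (hβ : ∀ i, ∀ s ∈ Ico 0 T, 0 < betaFun A q i s) {α : ℝ → ℝ}
    (hα : ∀ s ∈ Ioo 0 T, HasDerivAt α
        (α s * (((pdim : ℝ) - 1) / s - logDerivW n A q s) - (ε * s - ν / s)) s)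
    (κ₁ : ℝ) {s : ℝ} (hs : s ∈ Ioo 0 T) :
    SatisfiesODE pdim n p q ε α (varphiFun pdim κ₁) (betaFun A q) s := by
  have hs0 : s ≠ 0 := hs.1.ne'
  have hβ0 : ∀ i, betaFun A q i s ≠ 0 := fun i => (hβ i s (Ioo_subset_Ico_self hs)).ne'
  have hw0 : wFun n A q s ≠ 0 := Finset.prod_ne_zero_iff.2 fun i _ => pow_ne_zero _ (hβ0 i)
  have hlw : deriv (fun s => Real.log (∏ i, betaFun A q i s ^ n i)) s = logDerivW n A q s := by
    have h1 : HasDerivAt (fun s => Real.log (wFun n A q s))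
        (wFun n A q s * logDerivW n A q s / wFun n A q s) s :=
      (hasDerivAt_wFun n A q hβ0).log hw0
    rw [mul_div_cancel_left₀ _ hw0] at h1
    exact h1.deriv
  have hα1 := (hα s hs).deriv
  set L := logDerivW n A q s with hL
  set L' := ∑ i, (n i : ℝ) * (2 * A i / betaFun A q i s - (2 * A i * s / betaFun A q i s) ^ 2)
    with hL'
  have hα2 : deriv (deriv α) s = deriv α s * (((pdim : ℝ) - 1) / s - L)
      + α s * (-(((pdim : ℝ) - 1) / s ^ 2) - L') - (ε + ν / s ^ 2) := by
    have h1 : deriv α =ᶠ[𝓝 s] fun s =>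
        α s * (((pdim : ℝ) - 1) / s - logDerivW n A q s) - (ε * s - ν / s) := by
      filter_upwards [Ioo_mem_nhds hs.1 hs.2] with x hx
      exact (hα x hx).deriv
    rw [h1.deriv_eq]
    have h2 := (((hα s hs).mul (((hasDerivAt_const s ((pdim : ℝ) - 1)).div (hasDerivAt_id s) hs0).sub
      (hasDerivAt_logDerivW n A q hβ0))).sub (((hasDerivAt_id s).const_mul ε).sub
      ((hasDerivAt_const s ν).div (hasDerivAt_id s) hs0))).deriv
    refine h2.trans ?_
    simp only [hα1, id_eq, Pi.div_apply, Pi.sub_apply, ← hL, ← hL']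
    field_simp
    ring
  have hp2 : (pdim : ℝ) - 2 ≠ 0 := by
    have : (2 : ℝ) < pdim := by exact_mod_cast hpdim
    linarith
  have hA0 : ∀ i, A i ≠ 0 := fun i => (hA i).1.ne
  have hβA : ∀ i, betaFun A q i s = A i * s ^ 2 - (q i : ℝ) ^ 2 / (4 * A i) := fun i => by
    have := hA0 i
    rw [betaFun]; field_simp
  have hq : ∀ i, (q i : ℝ) ^ 2 = 4 * A i * (A i * s ^ 2 - betaFun A q i s) := fun i => by
    have := hA0 i
    rw [hβA]; field_simp; ring
  have hterm : ∀ i, 2 * A i / betaFun A q i s - 1 / 2 * (2 * A i * s / betaFun A q i s) ^ 2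
      = -((q i : ℝ) ^ 2 / betaFun A q i s ^ 2) / 2 := fun i => by
    have := hβ0 i
    rw [hq]; field_simp; ring
  have hsum : L / s + L' = -∑ i, (n i : ℝ) * (q i : ℝ) ^ 2 / betaFun A q i s ^ 2 := by
    rw [hL, hL', logDerivW, Finset.sum_div, ← Finset.sum_add_distrib, ← Finset.sum_neg_distrib]
    refine Finset.sum_congr rfl fun i _ => ?_
    have := hβ0 i
    rw [mul_div_assoc, hq]; field_simp; ring
  have second : deriv α s / 2 * (((pdim : ℝ) - 2) / s - L) - deriv (deriv α) s / 2
      + α s / 2 * ∑ i, (n i : ℝ) * (q i : ℝ) ^ 2 / betaFun A q i s ^ 2 = ε := by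
    have h3 : ∑ i, (n i : ℝ) * (q i : ℝ) ^ 2 / betaFun A q i s ^ 2 = -(L / s + L') := by
      rw [hsum, neg_neg]
    rw [h3, hα2, hα1]
    field_simp
    ring
  refine ⟨?_, ?_, fun i => ?_⟩
  · simp only [hlw, (hasDerivAt_varphiFun pdim κ₁ hs.1).deriv, deriv_deriv_varphiFun pdim κ₁ hs.1,
      deriv_deriv_betaFun]
    simp only [deriv_betaFun, hterm]
    refine Eq.trans ?_ second
    have h4 : ∑ i, (n i : ℝ) * (-((q i : ℝ) ^ 2 / betaFun A q i s ^ 2) / 2)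
        = -(∑ i, (n i : ℝ) * (q i : ℝ) ^ 2 / betaFun A q i s ^ 2) / 2 := by
      rw [← Finset.sum_neg_distrib, Finset.sum_div]
      exact Finset.sum_congr rfl fun i _ => by ring
    rw [h4]
    have h5 : -(((pdim : ℝ) - 2) / s ^ 2) + (((pdim : ℝ) - 2) / s) ^ 2 / ((pdim : ℝ) - 2) = 0 := by
      field_simp; ring
    rw [h5]
    ring
  · simp only [hlw, (hasDerivAt_varphiFun pdim κ₁ hs.1).deriv]
    exact second
  · simp only [hlw, (hasDerivAt_varphiFun pdim κ₁ hs.1).deriv, deriv_deriv_betaFun]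
    simp only [deriv_betaFun]
    rw [hα1]
    have h6 : (p i : ℝ) = A i * ν - ε * (q i : ℝ) ^ 2 / (4 * A i) := by
      have := hA0 i
      rw [← (hA i).2]; field_simp; ring
    have := hβ0 i
    rw [h6, hq]
    have := hA0 i
    field_simp
    ring

end System

/-! ### The choice of constants -/

section Constants

variable {k : ℕ}

lemma sqrt_discriminant (p : Fin (k + 1) → ℕ) (q : Fin (k + 1) → ℤ) (ε ν : ℝ) {i : Fin (k + 1)}
    (hq : q i ≠ 0) :
    √((p i : ℝ) ^ 2 + ν * ε * (q i : ℝ) ^ 2)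
      = |(q i : ℝ)| * √(((p i : ℝ) / |(q i : ℝ)|) ^ 2 - -(ν * ε)) := by
  have hq' : 0 < |(q i : ℝ)| := abs_pos.2 (by exact_mod_cast hq)
  rw [← Real.sqrt_sq hq'.le, ← Real.sqrt_mul (sq_nonneg _), Real.sqrt_sq hq'.le]
  congr 1
  rw [← sq_abs (q i : ℝ)]
  field_simp
  ring

lemma rootPlus_eq (p : Fin (k + 1) → ℕ) (q : Fin (k + 1) → ℤ) (ε ν : ℝ) {i : Fin (k + 1)}
    (hq : q i ≠ 0) :
    rootPlus p q ε ν i = |(q i : ℝ)| / (2 * ν) *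
      ((p i : ℝ) / |(q i : ℝ)| + √(((p i : ℝ) / |(q i : ℝ)|) ^ 2 - -(ν * ε))) := by
  have hq' : 0 < |(q i : ℝ)| := abs_pos.2 (by exact_mod_cast hq)
  rw [rootPlus, sqrt_discriminant p q ε ν hq]
  field_simp

lemma rootMinus_eq (p : Fin (k + 1) → ℕ) (q : Fin (k + 1) → ℤ) (ε ν : ℝ) {i : Fin (k + 1)}
    (hq : q i ≠ 0) :
    rootMinus p q ε ν i = |(q i : ℝ)| / (2 * ν) *
      ((p i : ℝ) / |(q i : ℝ)| - √(((p i : ℝ) / |(q i : ℝ)|) ^ 2 - -(ν * ε))) := by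
  have hq' : 0 < |(q i : ℝ)| := abs_pos.2 (by exact_mod_cast hq)
  rw [rootMinus, sqrt_discriminant p q ε ν hq]
  field_simp

lemma sub_sqrt_pos {a t : ℝ} (ha : 0 < a) (ht : 0 < t) : 0 < a - √(a ^ 2 - t) := by
  rw [sub_pos, Real.sqrt_lt' ha]
  linarith

/-- The smaller root is at most the geometric mean `√t` of the two roots. -/
lemma sub_sqrt_le_sqrt {a t : ℝ} (ha : 0 < a) (ht : 0 ≤ t) (hta : t ≤ a ^ 2) :
    a - √(a ^ 2 - t) ≤ √t := by
  have h1 : √t ≤ a := by rw [Real.sqrt_le_left ha.le]; exact hta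
  have h2 : a - √t ≤ √(a ^ 2 - t) := by
    apply Real.le_sqrt_of_sq_le
    nlinarith [Real.sq_sqrt ht, Real.sqrt_nonneg t]
  linarith

/-- `a - √(a² - t)` decreases in `a`, because it is equal to `t / (a + √(a² - t))`. -/
lemma sub_sqrt_lt_sub_sqrt {a b t : ℝ} (ha : 0 < a) (hab : a < b) (ht : 0 < t) (hta : t ≤ a ^ 2) :
    b - √(b ^ 2 - t) < a - √(a ^ 2 - t) := by
  have h1 : a ^ 2 - t < b ^ 2 - t := by nlinarith
  have h2 := Real.sqrt_lt_sqrt (by linarith) h1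
  have h3 := Real.sq_sqrt (show 0 ≤ a ^ 2 - t by linarith)
  have h4 := Real.sq_sqrt (show 0 ≤ b ^ 2 - t by linarith)
  have h5 := sub_sqrt_pos ha ht
  have h6 := sub_sqrt_pos (ha.trans hab) ht
  have h7 := Real.sqrt_nonneg (a ^ 2 - t)
  have h8 := Real.sqrt_nonneg (b ^ 2 - t)
  nlinarith

lemma add_sqrt_lt_add_sqrt {a b t : ℝ} (ha : 0 < a) (hab : a < b) :
    a + √(a ^ 2 - t) < b + √(b ^ 2 - t) := by
  have h1 : a ^ 2 - t ≤ b ^ 2 - t := by nlinarith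
  have := Real.sqrt_le_sqrt h1
  linarith

/-- The defining quadratic equation, up to a factor `A ^ 2`. -/
lemma quadratic_of_root {p q ε ν A : ℝ} (hA : A ≠ 0) (h : ν * A ^ 2 - p * A - ε * q ^ 2 / 4 = 0) :
    ε * q ^ 2 / (4 * A ^ 2) + p / A = ν := by
  field_simp
  linear_combination -4 * h

lemma phiMin_le (p : Fin (k + 1) → ℕ) (q : Fin (k + 1) → ℤ) (i : Fin (k + 1)) :
    phiMin p q ≤ ((p i : ℝ) / |(q i : ℝ)|) ^ 2 := by
  rw [div_pow, sq_abs]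
  exact Finset.inf'_le (fun i => (p i : ℝ) ^ 2 / (q i : ℝ) ^ 2) (Finset.mem_univ i)

lemma div_abs_lt {p p₀ : ℕ} {q : ℤ} (hq : q ≠ 0) (h : (p : ℤ) < p₀ * |q|) :
    (p : ℝ) / |(q : ℝ)| < p₀ := by
  have hq' : 0 < |(q : ℝ)| := abs_pos.2 (by exact_mod_cast hq)
  rw [div_lt_iff₀ hq']
  exact_mod_cast h

lemma lt_div_abs {p p₀ : ℕ} {q : ℤ} (hq : q ≠ 0) (h : p₀ * |q| < (p : ℤ)) :
    (p₀ : ℝ) < (p : ℝ) / |(q : ℝ)| := by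
  have hq' : 0 < |(q : ℝ)| := abs_pos.2 (by exact_mod_cast hq)
  rw [lt_div_iff₀ hq']
  exact_mod_cast h

lemma le_div_abs {p p₀ : ℕ} {q : ℤ} (hq : q ≠ 0) (h : p₀ * |q| ≤ (p : ℤ)) :
    (p₀ : ℝ) ≤ (p : ℝ) / |(q : ℝ)| := by
  have hq' : 0 < |(q : ℝ)| := abs_pos.2 (by exact_mod_cast hq)
  rw [le_div_iff₀ hq']
  exact_mod_cast h

variable {p : Fin (k + 1) → ℕ} {q : Fin (k + 1) → ℤ}

theorem phiMin_properties (hq : ∀ i, q i ≠ 0) (hq₀ : |q 0| = 1) :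
    phiMin p q ≤ (p 0 : ℝ) ^ 2 ∧
      ((∃ i, i ≠ 0 ∧ (p i : ℤ) < p 0 * |q i|) → phiMin p q < (p 0 : ℝ) ^ 2) ∧
      ((∀ i, i ≠ 0 → p 0 * |q i| ≤ (p i : ℤ)) → phiMin p q = (p 0 : ℝ) ^ 2) := by
  have hq₀' : |(q 0 : ℝ)| = 1 := by exact_mod_cast hq₀
  have h0 : phiMin p q ≤ (p 0 : ℝ) ^ 2 := by simpa [hq₀'] using phiMin_le p q 0
  refine ⟨h0, ?_, fun h => le_antisymm h0 ?_⟩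
  · rintro ⟨i, -, hi⟩
    refine (phiMin_le p q i).trans_lt ?_
    exact pow_lt_pow_left₀ (div_abs_lt (hq i) hi) (by positivity) two_ne_zero
  · refine Finset.le_inf' _ _ fun i _ => ?_
    rw [← sq_abs (q i : ℝ), ← div_pow]
    refine pow_le_pow_left₀ (by positivity) ?_ 2
    by_cases hi : i = 0
    · subst hi; simp [hq₀']
    · exact le_div_abs (hq i) (h i hi)

/-- On all branches, `A i` is a negative root of the quadratic equation, and `|A i| < |q i| |A 0|`,
which says that `β_i` has no zero before that of `β_0`. For the inequality, the roots are written as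
`A i = |q i| (a ± √(a² - t)) / (2 ν)` with `a = p i / |q i|` and `t = -ν ε`, and `a ± √(a² - t)` are
compared as functions of `a`. -/
theorem AdmissibleConstants.properties {ε ν : ℝ} {A : Fin (k + 1) → ℝ} (hp : ∀ i, 0 < p i)
    (hq : ∀ i, q i ≠ 0) (hq₀ : |q 0| = 1) (h : AdmissibleConstants p q ε ν A) :
    ν < 0 ∧ (∀ i, A i < 0 ∧ ε * (q i : ℝ) ^ 2 / (4 * A i ^ 2) + p i / A i = ν) ∧
      ∀ i, i ≠ 0 → -A i < |(q i : ℝ)| * -A 0 := by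
  have hq₀' : |(q 0 : ℝ)| = 1 := by exact_mod_cast hq₀
  have hQ : ∀ i, 0 < |(q i : ℝ)| := fun i => abs_pos.2 (by exact_mod_cast hq i)
  have hP : ∀ i, (0 : ℝ) < p i := fun i => by exact_mod_cast hp i
  have ha : ∀ i, 0 < (p i : ℝ) / |(q i : ℝ)| := fun i => div_pos (hP i) (hQ i)
  obtain ⟨hφ, hφ', -⟩ := phiMin_properties (p := p) hq hq₀
  have quadP : ∀ i, ν < 0 → -(ν * ε) ≤ ((p i : ℝ) / |(q i : ℝ)|) ^ 2 →
      ν * rootPlus p q ε ν i ^ 2 - p i * rootPlus p q ε ν i - ε * (q i : ℝ) ^ 2 / 4 = 0 := by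
    intro i hν ht
    have h1 := Real.sq_sqrt (sub_nonneg.2 ht)
    rw [rootPlus_eq p q ε ν (hq i)]
    set S := √(((p i : ℝ) / |(q i : ℝ)|) ^ 2 - -(ν * ε))
    have hQ' := (hQ i).ne'
    have hν' := hν.ne
    rw [← sq_abs (q i : ℝ)]
    have h2 : ε = (S ^ 2 - ((p i : ℝ) / |(q i : ℝ)|) ^ 2) / ν := by
      rw [h1]; field_simp; ring
    rw [h2]
    field_simp
    ring
  have quadM : ∀ i, ν < 0 → -(ν * ε) ≤ ((p i : ℝ) / |(q i : ℝ)|) ^ 2 →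
      ν * rootMinus p q ε ν i ^ 2 - p i * rootMinus p q ε ν i - ε * (q i : ℝ) ^ 2 / 4 = 0 := by
    intro i hν ht
    have h1 := Real.sq_sqrt (sub_nonneg.2 ht)
    rw [rootMinus_eq p q ε ν (hq i)]
    set S := √(((p i : ℝ) / |(q i : ℝ)|) ^ 2 - -(ν * ε))
    have hQ' := (hQ i).ne'
    have hν' := hν.ne
    rw [← sq_abs (q i : ℝ)]
    have h2 : ε = (S ^ 2 - ((p i : ℝ) / |(q i : ℝ)|) ^ 2) / ν := by
      rw [h1]; field_simp; ring
    rw [h2]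
    field_simp
    ring
  have negP : ∀ i, ν < 0 → rootPlus p q ε ν i < 0 := by
    intro i hν
    rw [rootPlus_eq p q ε ν (hq i)]
    exact mul_neg_of_neg_of_pos (div_neg_of_pos_of_neg (hQ i) (by linarith))
      (add_pos_of_pos_of_nonneg (ha i) (Real.sqrt_nonneg _))
  have negM : ∀ i, ν < 0 → 0 < -(ν * ε) → rootMinus p q ε ν i < 0 := by
    intro i hν ht
    rw [rootMinus_eq p q ε ν (hq i)]
    exact mul_neg_of_neg_of_pos (div_neg_of_pos_of_neg (hQ i) (by linarith))
      (sub_sqrt_pos (ha i) ht)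
  -- comparison of `|q| r / (2 ν)` with `|q| r₀ / (2 ν)`
  have cmp : ∀ i (r r₀ : ℝ), ν < 0 → r < r₀ →
      -(|(q i : ℝ)| / (2 * ν) * r) < |(q i : ℝ)| * -(1 / (2 * ν) * r₀) := by
    intro i r r₀ hν hr
    have h1 : 0 < |(q i : ℝ)| / (2 * -ν) := div_pos (hQ i) (by linarith)
    have h2 := mul_lt_mul_of_pos_left hr h1
    have hν' := hν.ne
    calc -(|(q i : ℝ)| / (2 * ν) * r) = |(q i : ℝ)| / (2 * -ν) * r := by field_simp
      _ < _ := h2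
      _ = _ := by field_simp
  cases h with
  | zero hε hpq hν hA =>
    refine ⟨hν, fun i => ⟨?_, ?_⟩, fun i hi => ?_⟩
    · rw [hA]; exact div_neg_of_pos_of_neg (hP i) hν
    · rw [hA, hε]
      have := (hP i).ne'
      field_simp
      ring
    · have h1 := div_abs_lt (hq i) (hpq i hi)
      rw [div_lt_iff₀ (hQ i)] at h1
      rw [hA, hA, ← div_neg, ← div_neg, ← mul_div_assoc, mul_comm]
      exact div_lt_div_of_pos_right h1 (by linarith)
  | neg hε hpq hν hA =>
    have ht : -(ν * ε) < 0 := by nlinarith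
    refine ⟨hν, fun i => ⟨?_, ?_⟩, fun i hi => ?_⟩
    · rw [hA]; exact negP i hν
    · rw [hA]
      exact quadratic_of_root (negP i hν).ne (quadP i hν (ht.le.trans (sq_nonneg _)))
    · rw [hA, hA, rootPlus_eq p q ε ν (hq i), rootPlus_eq p q ε ν (hq 0), hq₀', div_one]
      exact cmp i _ _ hν (add_sqrt_lt_add_sqrt (ha i) (div_abs_lt (hq i) (hpq i hi)))
  | pos_some hε hpq hν hA₀ hA =>
    have hν0 := hν.2
    have ht : 0 < -(ν * ε) := by nlinarith
    have htφ : -(ν * ε) ≤ phiMin p q := by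
      have h2 : -ν ≤ phiMin p q / ε := by linarith [hν.1]
      rw [le_div_iff₀ hε] at h2
      linarith
    have hta := fun i => htφ.trans (phiMin_le p q i)
    refine ⟨hν0, fun i => ?_, fun i hi => ?_⟩
    · by_cases hi : i = 0
      · subst hi
        rw [hA₀]
        exact ⟨negP 0 hν0, quadratic_of_root (negP 0 hν0).ne (quadP 0 hν0 (hta 0))⟩
      · rcases hA i hi with h | ⟨-, h⟩
        · rw [h]
          exact ⟨negM i hν0 ht, quadratic_of_root (negM i hν0 ht).ne (quadM i hν0 (hta i))⟩
        · rw [h]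
          exact ⟨negP i hν0, quadratic_of_root (negP i hν0).ne (quadP i hν0 (hta i))⟩
    · rw [hA₀, rootPlus_eq p q ε ν (hq 0), hq₀', div_one]
      rcases hA i hi with h | ⟨h', h⟩
      · rw [h, rootMinus_eq p q ε ν (hq i)]
        refine cmp i _ _ hν0 ((sub_sqrt_le_sqrt (ha i) ht.le (hta i)).trans_lt ?_)
        have h1 : √(-(ν * ε)) < p 0 := by
          rw [Real.sqrt_lt' (hP 0)]
          exact htφ.trans_lt (hφ' hpq)
        linarith [Real.sqrt_nonneg ((p 0 : ℝ) ^ 2 - -(ν * ε))]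
      · rw [h, rootPlus_eq p q ε ν (hq i)]
        exact cmp i _ _ hν0 (add_sqrt_lt_add_sqrt (ha i) (div_abs_lt (hq i) h'))
  | pos_eq hε hpq hpq' hν hA₀ hA =>
    have hν0 := hν.2
    have ht : 0 < -(ν * ε) := by nlinarith
    have htφ : -(ν * ε) < phiMin p q := by
      have h2 : -ν < phiMin p q / ε := by linarith [hν.1]
      rw [lt_div_iff₀ hε] at h2
      linarith
    have hta := fun i => htφ.le.trans (phiMin_le p q i)
    refine ⟨hν0, fun i => ?_, fun i hi => ?_⟩
    · by_cases hi : i = 0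
      · subst hi
        rw [hA₀]
        exact ⟨negP 0 hν0, quadratic_of_root (negP 0 hν0).ne (quadP 0 hν0 (hta 0))⟩
      · rw [hA i hi]
        exact ⟨negM i hν0 ht, quadratic_of_root (negM i hν0 ht).ne (quadM i hν0 (hta i))⟩
    · rw [hA₀, rootPlus_eq p q ε ν (hq 0), hq₀', div_one, hA i hi, rootMinus_eq p q ε ν (hq i)]
      refine cmp i _ _ hν0 ((sub_sqrt_le_sqrt (ha i) ht.le (hta i)).trans_lt ?_)
      have h1 : √(-(ν * ε)) < p 0 := by
        rw [Real.sqrt_lt' (hP 0)]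
        exact htφ.trans_le hφ
      linarith [Real.sqrt_nonneg ((p 0 : ℝ) ^ 2 - -(ν * ε))]
  | pos_lt hε hpq hν hA₀ hA =>
    have hν0 := hν.2
    have ht : 0 < -(ν * ε) := by nlinarith
    have htφ : -(ν * ε) ≤ phiMin p q := by
      have h2 : -ν ≤ phiMin p q / ε := by linarith [hν.1]
      rw [le_div_iff₀ hε] at h2
      linarith
    have hta := fun i => htφ.trans (phiMin_le p q i)
    have ht0 : -(ν * ε) ≤ (p 0 : ℝ) ^ 2 := htφ.trans hφ
    refine ⟨hν0, fun i => ?_, fun i hi => ?_⟩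
    · by_cases hi : i = 0
      · subst hi
        rcases hA₀ with h | h
        · rw [h]
          exact ⟨negP 0 hν0, quadratic_of_root (negP 0 hν0).ne (quadP 0 hν0 (hta 0))⟩
        · rw [h]
          exact ⟨negM 0 hν0 ht, quadratic_of_root (negM 0 hν0 ht).ne (quadM 0 hν0 (hta 0))⟩
      · rw [hA i hi]
        exact ⟨negM i hν0 ht, quadratic_of_root (negM i hν0 ht).ne (quadM i hν0 (hta i))⟩
    · have hlt := sub_sqrt_lt_sub_sqrt (hP 0) (lt_div_abs (hq i) (hpq i hi)) ht ht0
      rw [hA i hi, rootMinus_eq p q ε ν (hq i)]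
      rcases hA₀ with h | h
      · rw [h, rootPlus_eq p q ε ν (hq 0), hq₀', div_one]
        refine cmp i _ _ hν0 (hlt.trans_le ?_)
        linarith [Real.sqrt_nonneg ((p 0 : ℝ) ^ 2 - -(ν * ε))]
      · rw [h, rootMinus_eq p q ε ν (hq 0), hq₀', div_one]
        exact cmp i _ _ hν0 hlt

/-- The elementary properties of `β_i` on `[0, s_*]`. -/
theorem betaFun_properties {A : Fin (k + 1) → ℝ} (hq₀ : |q 0| = 1) (hA : ∀ i, A i < 0)
    (hlt : ∀ i, i ≠ 0 → -A i < |(q i : ℝ)| * -A 0) :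
    0 < sStar A ∧ (∀ i, ∀ s ∈ Ico 0 (sStar A), 0 < betaFun A q i s) ∧
      betaFun A q 0 (sStar A) = 0 ∧ HasDerivAt (betaFun A q 0) (-1) (sStar A) ∧
      ∀ i, i ≠ 0 → 0 < betaFun A q i (sStar A) := by
  have hq2 : (q 0 : ℝ) ^ 2 = 1 := by
    have : (q 0) ^ 2 = 1 := by rw [← sq_abs, hq₀]; norm_num
    exact_mod_cast this
  have h0 := (hA 0).ne
  have hT : 0 < sStar A := div_pos_of_neg_of_neg (by norm_num) (by linarith [hA 0])
  have hT2 : sStar A ^ 2 = 1 / (4 * A 0 ^ 2) := by rw [sStar]; field_simp; norm_num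
  have hi : ∀ i, i ≠ 0 → 0 < betaFun A q i (sStar A) := by
    intro i hi
    refine mul_pos_of_neg_of_neg (hA i) (sub_neg.2 ?_)
    have h1 := hA i
    have h2 : A i ^ 2 < (q i : ℝ) ^ 2 * A 0 ^ 2 := by
      have := pow_lt_pow_left₀ (hlt i hi) (by linarith) two_ne_zero
      rwa [neg_sq, mul_pow, sq_abs, neg_sq] at this
    have h3 : 0 < A 0 ^ 2 := by positivity
    have h4 : 0 < A i ^ 2 := by have := h1.ne; positivity
    rw [hT2, div_lt_div_iff₀ (by positivity) (by positivity)]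
    linarith
  have hβ0 : betaFun A q 0 (sStar A) = 0 := by
    rw [betaFun, hT2, hq2]; ring
  refine ⟨hT, fun i s hs => ?_, hβ0, ?_, hi⟩
  · have hlt : s ^ 2 < sStar A ^ 2 := pow_lt_pow_left₀ hs.2 hs.1 two_ne_zero
    have h1 : betaFun A q i (sStar A) < betaFun A q i s :=
      mul_lt_mul_of_neg_left (by linarith) (hA i)
    by_cases h : i = 0
    · subst h; linarith
    · linarith [hi i h]
  · refine (hasDerivAt_betaFun A q 0 _).congr_deriv ?_
    rw [sStar]; field_simp

end Constants

/-! ### Products of manifolds -/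

section PiManifold

variable {ι : Type*} [Fintype ι] {E : ι → Type*} [∀ i, NormedAddCommGroup (E i)]
  [∀ i, NormedSpace ℝ (E i)] {H : ι → Type*} [∀ i, TopologicalSpace (H i)]
  {I : ∀ i, ModelWithCorners ℝ (E i) (H i)} {M : ι → Type*} [∀ i, TopologicalSpace (M i)]
  [∀ i, ChartedSpace (H i) (M i)]
  {E' : Type*} [NormedAddCommGroup E'] [NormedSpace ℝ E'] {H' : Type*} [TopologicalSpace H']
  {I' : ModelWithCorners ℝ E' H'} {N : Type*} [TopologicalSpace N] [ChartedSpace H' N]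
  {n : ℕ∞ω}

instance IsManifold.pi [∀ i, IsManifold (I i) n (M i)] :
    IsManifold (ModelWithCorners.pi I) n (∀ i, M i) := by
  refine isManifold_of_contDiffOn _ _ _ ?_
  rintro _ _ ⟨e, he, rfl⟩ ⟨e', he', rfl⟩
  refine contDiffOn_pi.2 fun i => ?_
  have h1 := HasGroupoid.compatible (G := contDiffGroupoid n (I i)) (he i trivial) (he' i trivial)
  rw [contDiffGroupoid, mem_groupoid_of_pregroupoid] at h1
  have h2 : ContDiffOn ℝ n (I i ∘ (e i).symm ≫ₕ e' i ∘ (I i).symm)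
    ((I i).symm ⁻¹' ((e i).symm ≫ₕ e' i).source ∩ range (I i)) := h1.1
  refine h2.comp ((ContinuousLinearMap.proj (R := ℝ) (φ := E) i).contDiff.contDiffOn) ?_
  rintro y ⟨hy, x, rfl⟩
  refine ⟨?_, mem_range_self (x i)⟩
  have h3 := hy.1 i trivial
  have h4 := hy.2 i trivial
  exact ⟨h3, h4⟩

lemma contMDiffWithinAt_pi_iff {f : N → ∀ i, M i} {s : Set N} {x : N} :
    ContMDiffWithinAt I' (ModelWithCorners.pi I) n f s x ↔
      ∀ i, ContMDiffWithinAt I' (I i) n (fun y => f y i) s x := by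
  simp only [contMDiffWithinAt_iff, continuousWithinAt_pi, forall_and]
  refine and_congr_right fun _ => ?_
  rw [contDiffWithinAt_pi]
  rfl

lemma contMDiffAt_pi_iff {f : N → ∀ i, M i} {x : N} :
    ContMDiffAt I' (ModelWithCorners.pi I) n f x ↔
      ∀ i, ContMDiffAt I' (I i) n (fun y => f y i) x :=
  contMDiffWithinAt_pi_iff

lemma contMDiff_pi_iff {f : N → ∀ i, M i} :
    ContMDiff I' (ModelWithCorners.pi I) n f ↔ ∀ i, ContMDiff I' (I i) n (fun y => f y i) := by
  simp only [ContMDiff, contMDiffAt_pi_iff]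
  exact ⟨fun h i x => h x i, fun h x i => h i x⟩

lemma contMDiff_eval (i : ι) :
    ContMDiff (ModelWithCorners.pi I) (I i) n (fun f : ∀ i, M i => f i) :=
  contMDiff_pi_iff.1 contMDiff_id i

lemma hasMFDerivAt_eval (i : ι) (f : ∀ i, M i) :
    HasMFDerivAt (ModelWithCorners.pi I) (I i) (fun f : ∀ i, M i => f i) f
      (ContinuousLinearMap.proj (R := ℝ) (φ := E) i) := by
  refine ⟨(continuous_apply i).continuousAt, ?_⟩
  have h1 : HasFDerivWithinAt (fun y : ∀ i, E i => y i)
      (ContinuousLinearMap.proj (R := ℝ) (φ := E) i) (range (ModelWithCorners.pi I))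
      (extChartAt (ModelWithCorners.pi I) f f) :=
    (ContinuousLinearMap.proj (R := ℝ) (φ := E) i).hasFDerivWithinAt
  refine h1.congr_of_eventuallyEq ?_ ?_
  · filter_upwards [extChartAt_target_mem_nhdsWithin (I := ModelWithCorners.pi I) f] with y hy
    exact congrFun ((extChartAt (ModelWithCorners.pi I) f).right_inv hy) i
  · exact congrFun ((extChartAt (ModelWithCorners.pi I) f).right_inv
      (mem_extChartAt_target (I := ModelWithCorners.pi I) f)) i

lemma mfderiv_apply_pi {f : N → ∀ i, M i} {x : N}
    (hf : MDifferentiableAt I' (ModelWithCorners.pi I) f x) (i : ι) (u : TangentSpace I' x) :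
    mfderiv I' (I i) (fun y => f y i) x u
      = (mfderiv I' (ModelWithCorners.pi I) f x u : ∀ i, E i) i := by
  have h1 := (hasMFDerivAt_eval (I := I) i (f x)).comp x hf.hasMFDerivAt
  have h2 := h1.mfderiv
  change mfderiv I' (I i) (fun y => f y i) x = _ at h2
  rw [h2]
  rfl

instance ModelWithCorners.pi_boundaryless [∀ i, (I i).Boundaryless] :
    (ModelWithCorners.pi I).Boundaryless where
  range_eq_univ := by
    refine eq_univ_of_forall fun y => ?_
    have h : ∀ i, ∃ x, I i x = y i := fun i => by
      have := (I i).range_eq_univ ▸ mem_univ (y i)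
      exact this
    choose x hx using h
    exact ⟨x, funext hx⟩

end PiManifold

/-! ### Vector fields with constant coefficients in a chart -/

section ConstFields

variable {E : Type*} [NormedAddCommGroup E] [NormedSpace ℝ E] {H : Type*} [TopologicalSpace H]
  {I : ModelWithCorners ℝ E H} {M : Type*} [TopologicalSpace M] [ChartedSpace H M]
  [IsManifold I ∞ M]
  {E' : Type*} [NormedAddCommGroup E'] [NormedSpace ℝ E'] {H' : Type*} [TopologicalSpace H']
  {I' : ModelWithCorners ℝ E' H'} {N : Type*} [TopologicalSpace N] [ChartedSpace H' N]
  [IsManifold I' ∞ N]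

variable (I) in
/-- The vector field around `m₀` with constant coefficients `a` in the preferred chart at `m₀`. -/
def constField (m₀ : M) (a : E) (m : M) : TangentSpace I m :=
  (trivializationAt E (TangentSpace I : M → Type _) m₀).symmL ℝ m a

lemma contMDiffAt_constField (m₀ : M) (a : E) :
    ContMDiffAt I I.tangent ∞ (fun m => (⟨m, constField I m₀ a m⟩ : TangentBundle I M)) m₀ := by
  have h := (trivializationAt E (TangentSpace I : M → Type _) m₀).contMDiffAt_symmL
    (IB := I) (n := ∞) (mem_baseSet_trivializationAt E (TangentSpace I : M → Type _) m₀)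
  exact h.clm_bundle_apply (F₁ := E) (E₁ := Bundle.Trivial M E) (v := fun _ => a)
    (by rw [contMDiffAt_totalSpace]; exact ⟨contMDiffAt_id, contMDiffAt_const⟩)

omit [IsManifold I ∞ M] in
/-- A family of linear maps on a finite-dimensional space is smooth if all its values are. -/
lemma contMDiffAt_clm_of_apply {F G : Type*} [NormedAddCommGroup F] [NormedSpace ℝ F]
    [NormedAddCommGroup G] [NormedSpace ℝ G] [FiniteDimensional ℝ F] {f : M → F →L[ℝ] G} {m₀ : M}
    (h : ∀ a, ContMDiffAt I 𝓘(ℝ, G) ∞ (fun m => f m a) m₀) :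
    ContMDiffAt I 𝓘(ℝ, F →L[ℝ] G) ∞ f m₀ := by
  have hd : Module.finrank ℝ F = Module.finrank ℝ (Fin (Module.finrank ℝ F) → ℝ) :=
    (Module.finrank_fin_fun ℝ).symm
  let e₁ := ContinuousLinearEquiv.ofFinrankEq hd
  let e₂ := (e₁.arrowCongr (1 : G ≃L[ℝ] G)).trans
    (ContinuousLinearEquiv.piRing (Fin (Module.finrank ℝ F)))
  have h1 : ContMDiffAt I 𝓘(ℝ, Fin (Module.finrank ℝ F) → G) ∞ (fun m => e₂ (f m)) m₀ :=
    contMDiffAt_pi_space.2 fun i => h _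
  have h2 := e₂.symm.contDiff.contMDiff.contMDiffAt.comp m₀ h1
  refine h2.congr_of_eventuallyEq (Filter.Eventually.of_forall fun m => ?_)
  simp

lemma contMDiffAt_mfderiv_constField {φ : M → N} {m₀ : M} (hφ : ContMDiffAt I I' ∞ φ m₀) (a : E) :
    ContMDiffAt I I'.tangent ∞
      (fun m => (⟨φ m, mfderiv I I' φ m (constField I m₀ a m)⟩ : TangentBundle I' N)) m₀ := by
  exact ContMDiffAt.clm_apply_of_inCoordinates (hφ.mfderiv_const (by simp))
    (contMDiffAt_constField m₀ a) hφ

lemma contMDiffAt_oneForm_pullback {φ : M → N} {m₀ : M} (hφ : ContMDiffAt I I' ∞ φ m₀) (a : E)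
    {θ : OneForm I' N} (hθ : ContMDiff I' (I'.prod 𝓘(ℝ, E' →L[ℝ] ℝ)) ∞
    (fun x => (TotalSpace.mk' (E' →L[ℝ] ℝ) x (θ x) :
      TotalSpace (E' →L[ℝ] ℝ) (fun x : N => TangentSpace I' x →L[ℝ] ℝ)))) :
    ContMDiffAt I 𝓘(ℝ, ℝ) ∞ (fun m => θ (φ m) (mfderiv I I' φ m (constField I m₀ a m))) m₀ := by
  have h1 := hθ.contMDiffAt.comp m₀ hφ
  have h2 := ContMDiffAt.clm_bundle_apply (F₂ := ℝ) (E₂ := Bundle.Trivial N ℝ) h1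
    (contMDiffAt_mfderiv_constField hφ a)
  rw [contMDiffAt_totalSpace] at h2
  exact h2.2

lemma contMDiffAt_metric_pullback {φ : M → N} {m₀ : M} (hφ : ContMDiffAt I I' ∞ φ m₀) (a b : E)
    (h : SmoothMetric I' N) :
    ContMDiffAt I 𝓘(ℝ, ℝ) ∞ (fun m => h.inner (φ m) (mfderiv I I' φ m (constField I m₀ a m))
      (mfderiv I I' φ m (constField I m₀ b m))) m₀ := by
  have h1 := h.contMDiff.contMDiffAt.comp m₀ hφ
  have h2 := ContMDiffAt.clm_bundle_apply₂ (F₃ := ℝ) (E₃ := Bundle.Trivial N ℝ) h1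
    (contMDiffAt_mfderiv_constField hφ a)
    (contMDiffAt_mfderiv_constField hφ b)
  rw [contMDiffAt_totalSpace] at h2
  exact h2.2

lemma contMDiff_metric_of_constField [FiniteDimensional ℝ E]
    {B : ∀ m : M, TangentSpace I m →L[ℝ] TangentSpace I m →L[ℝ] ℝ}
    (hB : ∀ m₀ a b, ContMDiffAt I 𝓘(ℝ, ℝ) ∞
      (fun m => B m (constField I m₀ a m) (constField I m₀ b m)) m₀) :
    ContMDiff I (I.prod 𝓘(ℝ, E →L[ℝ] E →L[ℝ] ℝ)) ∞
      (fun m => (TotalSpace.mk' (E →L[ℝ] E →L[ℝ] ℝ) m (B m) : TotalSpace (E →L[ℝ] E →L[ℝ] ℝ)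
        (fun m : M => TangentSpace I m →L[ℝ] TangentSpace I m →L[ℝ] ℝ))) := by
  intro m₀
  rw [contMDiffAt_hom_bundle]
  refine ⟨contMDiffAt_id, contMDiffAt_clm_of_apply fun a => contMDiffAt_clm_of_apply fun b => ?_⟩
  refine (hB m₀ a b).congr_of_eventuallyEq ?_
  filter_upwards [(trivializationAt E (TangentSpace I : M → Type _) m₀).open_baseSet.mem_nhds
    (mem_baseSet_trivializationAt E (TangentSpace I : M → Type _) m₀)] with m hm
  have h2 : m ∈ (trivializationAt (E →L[ℝ] ℝ)
      (fun m : M => TangentSpace I m →L[ℝ] ℝ) m₀).baseSet := by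
    rw [hom_trivializationAt_baseSet]; exact ⟨hm, mem_univ _⟩
  simp only [ContinuousLinearMap.inCoordinates, ContinuousLinearMap.comp_apply,
    Trivialization.continuousLinearMapAt_apply, Trivialization.coe_linearMapAt_of_mem _ h2,
    hom_trivializationAt_apply]
  simp [constField]

lemma contMDiffAt_mfderiv_constField_vector {W : Type*} [NormedAddCommGroup W] [NormedSpace ℝ W]
    {φ : M → W} {m₀ : M} (hφ : ContMDiffAt I 𝓘(ℝ, W) ∞ φ m₀) (a : E) :
    ContMDiffAt I 𝓘(ℝ, W) ∞
      (fun m => (mfderiv I 𝓘(ℝ, W) φ m (constField I m₀ a m) : W)) m₀ := by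
  have h := contMDiffAt_mfderiv_constField hφ a
  rw [contMDiffAt_totalSpace] at h
  refine h.2.congr_of_eventuallyEq (Filter.Eventually.of_forall fun m => ?_)
  simp
  rfl

/-- A positive definite form is bounded below by a multiple of the square of the norm. -/
lemma isVonNBounded_of_posDef {F : Type*} [NormedAddCommGroup F] [NormedSpace ℝ F]
    [FiniteDimensional ℝ F] (B : F →L[ℝ] F →L[ℝ] ℝ) (hB : ∀ v, v ≠ 0 → 0 < B v v) :
    Bornology.IsVonNBounded ℝ {v : F | B v v < 1} := by
  rw [NormedSpace.isVonNBounded_iff]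
  have : ProperSpace F := FiniteDimensional.proper ℝ F
  obtain hE | hE := (Metric.sphere (0 : F) 1).eq_empty_or_nonempty
  · have : ∀ v : F, v = 0 := by
      intro v
      by_contra hv
      have h1 : ‖v‖⁻¹ • v ∈ Metric.sphere (0 : F) 1 := by
        simp [norm_smul, hv]
      rw [hE] at h1
      exact h1
    exact (Bornology.isBounded_singleton (x := (0 : F))).subset fun v _ => this v
  · obtain ⟨w, hw, hmin⟩ := (isCompact_sphere (0 : F) 1).exists_isMinOn hE
      (f := fun v => B v v) (B.continuous.clm_apply continuous_id).continuousOn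
    have hw0 : w ≠ 0 := by rintro rfl; simp at hw
    have hc := hB w hw0
    refine (Metric.isBounded_closedBall (x := (0 : F)) (r := 1 + 1 / B w w)).subset fun v hv => ?_
    rw [mem_closedBall_zero_iff]
    by_cases hv0 : v = 0
    · subst hv0; rw [norm_zero]; positivity
    have hn : 0 < ‖v‖ := norm_pos_iff.2 hv0
    have h1 : B w w ≤ B (‖v‖⁻¹ • v) (‖v‖⁻¹ • v) := hmin (by simp [norm_smul, hv0])
    simp only [map_smul, smul_apply, smul_eq_mul] at h1
    have h2 : B w w * ‖v‖ ^ 2 ≤ B v v := by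
      calc B w w * ‖v‖ ^ 2 ≤ (‖v‖⁻¹ * (‖v‖⁻¹ * B v v)) * ‖v‖ ^ 2 := by gcongr
        _ = B v v := by field_simp
    have h3 : ‖v‖ ^ 2 < 1 / B w w := by
      rw [lt_div_iff₀ hc]; linarith [show B v v < 1 from hv]
    nlinarith [sq_nonneg (‖v‖ - 1)]

/-- A smooth Riemannian metric from a family of inner products that is smooth on the vector fields
with constant coefficients in the preferred charts. -/
def SmoothMetric.ofConstField [FiniteDimensional ℝ E]
    (B : ∀ m : M, TangentSpace I m →L[ℝ] TangentSpace I m →L[ℝ] ℝ)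
    (symm : ∀ m u v, B m u v = B m v u) (pos : ∀ m u, u ≠ 0 → 0 < B m u u)
    (hB : ∀ m₀ a b, ContMDiffAt I 𝓘(ℝ, ℝ) ∞
      (fun m => B m (constField I m₀ a m) (constField I m₀ b m)) m₀) : SmoothMetric I M where
  inner := B
  symm := symm
  pos := pos
  isVonNBounded m := isVonNBounded_of_posDef (F := E) (B m) (pos m)
  contMDiff := contMDiff_metric_of_constField hB

end ConstFields

/-! ### Manifolds with boundary from half-space charts -/

section HalfSpaceCharts

/-- The identification of `ℝ × ℝ^d` with `ℝ^(d+1)`; the real factor is the coordinate `0`, which is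
nonnegative on the half space. -/
def prodEuclidean (d : ℕ) : (ℝ × EuclideanSpace ℝ (Fin d)) ≃L[ℝ] EuclideanSpace ℝ (Fin (d + 1)) :=
  (((ContinuousLinearEquiv.refl ℝ ℝ).prodCongr (EuclideanSpace.equiv (Fin d) ℝ)).trans
    (Fin.consEquivL ℝ fun _ : Fin (d + 1) => ℝ)).trans (EuclideanSpace.equiv (Fin (d + 1)) ℝ).symm

@[simp]
lemma prodEuclidean_apply_zero (d : ℕ) (y : ℝ × EuclideanSpace ℝ (Fin d)) :
    prodEuclidean d y 0 = y.1 := rfl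

/-- The upper half of `ℝ × ℝ^d`. -/
def halfProd (d : ℕ) : Set (ℝ × EuclideanSpace ℝ (Fin d)) := {y | 0 ≤ y.1}

lemma mem_range_half_iff {d : ℕ} {y : EuclideanSpace ℝ (Fin (d + 1))} :
    y ∈ range (𝓡∂ (d + 1)) ↔ (prodEuclidean d).symm y ∈ halfProd d := by
  rw [range_modelWithCornersEuclideanHalfSpace]
  obtain ⟨z, rfl⟩ := (prodEuclidean d).surjective y
  simp [halfProd]

/-- A chart of a space `M` with values in the upper half of `ℝ × ℝ^d`: a homeomorphism of an open
subset `source` of `M` with the intersection of the half space and an open subset `dom` of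
`ℝ × ℝ^d`. -/
structure HalfSpaceChart (d : ℕ) (M : Type*) [TopologicalSpace M] where
  toFun : M → ℝ × EuclideanSpace ℝ (Fin d)
  invFun : ℝ × EuclideanSpace ℝ (Fin d) → M
  source : Set M
  dom : Set (ℝ × EuclideanSpace ℝ (Fin d))
  open_source : IsOpen source
  open_dom : IsOpen dom
  map_source : ∀ m ∈ source, toFun m ∈ dom ∩ halfProd d
  map_dom : ∀ y ∈ dom ∩ halfProd d, invFun y ∈ source
  left_inv : ∀ m ∈ source, invFun (toFun m) = m
  right_inv : ∀ y ∈ dom ∩ halfProd d, toFun (invFun y) = y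
  continuousOn_toFun : ContinuousOn toFun source
  continuousOn_invFun : ContinuousOn invFun (dom ∩ halfProd d)

namespace HalfSpaceChart

variable {d : ℕ} {M : Type*} [TopologicalSpace M] (c : HalfSpaceChart d M)

/-- A half-space chart as a chart with values in the model `EuclideanHalfSpace (d + 1)`. -/
def toOpenPartialHomeomorph : OpenPartialHomeomorph M (EuclideanHalfSpace (d + 1)) where
  toFun m := (𝓡∂ (d + 1)).symm (prodEuclidean d (c.toFun m))
  invFun y := c.invFun ((prodEuclidean d).symm ((𝓡∂ (d + 1)) y))
  source := c.source
  target := {y | (prodEuclidean d).symm ((𝓡∂ (d + 1)) y) ∈ c.dom}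
  map_source' m hm := by
    have h := c.map_source m hm
    rw [mem_ofPred_eq, (𝓡∂ (d + 1)).right_inv (mem_range_half_iff.2 (by simpa using h.2))]
    simpa using h.1
  map_target' y hy := c.map_dom _ ⟨hy, mem_range_half_iff.1 (mem_range_self y)⟩
  left_inv' m hm := by
    have h := c.map_source m hm
    rw [(𝓡∂ (d + 1)).right_inv (mem_range_half_iff.2 (by simpa using h.2))]
    simpa using c.left_inv m hm
  right_inv' y hy := by
    rw [c.right_inv _ ⟨hy, mem_range_half_iff.1 (mem_range_self y)⟩]
    simp only [ContinuousLinearEquiv.apply_symm_apply, ModelWithCorners.left_inv]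
  open_source := c.open_source
  open_target := c.open_dom.preimage
    ((prodEuclidean d).symm.continuous.comp (𝓡∂ (d + 1)).continuous)
  continuousOn_toFun := ((𝓡∂ (d + 1)).continuous_symm.comp
    (prodEuclidean d).continuous).comp_continuousOn c.continuousOn_toFun
  continuousOn_invFun := c.continuousOn_invFun.comp
    ((prodEuclidean d).symm.continuous.comp (𝓡∂ (d + 1)).continuous).continuousOn
    fun y hy => ⟨hy, mem_range_half_iff.1 (mem_range_self y)⟩

lemma extend_apply {m : M} (hm : m ∈ c.source) :
    c.toOpenPartialHomeomorph.extend (𝓡∂ (d + 1)) m = prodEuclidean d (c.toFun m) :=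
  (𝓡∂ (d + 1)).right_inv (mem_range_half_iff.2 (by simpa using (c.map_source m hm).2))

lemma extend_symm_apply {y : ℝ × EuclideanSpace ℝ (Fin d)} (hy : y ∈ halfProd d) :
    (c.toOpenPartialHomeomorph.extend (𝓡∂ (d + 1))).symm (prodEuclidean d y) = c.invFun y := by
  change c.invFun ((prodEuclidean d).symm ((𝓡∂ (d + 1)) ((𝓡∂ (d + 1)).symm (prodEuclidean d y))))
    = c.invFun y
  rw [(𝓡∂ (d + 1)).right_inv (mem_range_half_iff.2 (by simpa using hy))]
  simp

variable {ι : Type*} (a : ι → HalfSpaceChart d M) (sel : M → ι) (hsel : ∀ m, m ∈ (a (sel m)).source)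

/-- The charted space structure defined by a family of half-space charts; the preferred chart at `m`
is the one selected by `sel`. -/
@[reducible]
def chartedSpace : ChartedSpace (EuclideanHalfSpace (d + 1)) M where
  atlas := range fun i => (a i).toOpenPartialHomeomorph
  chartAt m := (a (sel m)).toOpenPartialHomeomorph
  mem_chart_source := hsel
  chart_mem_atlas m := mem_range_self (sel m)

/-- Half-space charts with smooth transition functions define a smooth manifold with boundary. -/
lemma isManifold (h : ∀ i j, ContDiffOn ℝ ∞ ((a j).toFun ∘ (a i).invFun)
      {y | y ∈ (a i).dom ∩ halfProd d ∧ (a i).invFun y ∈ (a j).source}) :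
    @IsManifold ℝ _ _ _ _ _ _ (𝓡∂ (d + 1)) ∞ M _ (chartedSpace a sel hsel) := by
  let := chartedSpace a sel hsel
  refine isManifold_of_contDiffOn _ _ _ ?_
  rintro _ _ ⟨i, rfl⟩ ⟨j, rfl⟩
  have h1 := (prodEuclidean d).contDiff.comp_contDiffOn
    ((h i j).comp (prodEuclidean d).symm.contDiff.contDiffOn (mapsTo_preimage _ _))
  have key : ∀ y ∈ (𝓡∂ (d + 1)).symm ⁻¹' ((a i).toOpenPartialHomeomorph.symm ≫ₕ
        (a j).toOpenPartialHomeomorph).source ∩ range (𝓡∂ (d + 1)),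
      (prodEuclidean d).symm y ∈ {y | y ∈ (a i).dom ∩ halfProd d ∧
        (a i).invFun y ∈ (a j).source} := by
    rintro _ ⟨hy, y, rfl⟩
    rw [mem_preimage, ModelWithCorners.left_inv, OpenPartialHomeomorph.trans_source] at hy
    exact ⟨⟨hy.1, mem_range_half_iff.1 (mem_range_self y)⟩, hy.2⟩
  refine (h1.mono key).congr ?_
  intro y hy
  have h2 := (key y hy).2
  obtain ⟨-, y, rfl⟩ := hy
  change (𝓡∂ (d + 1)) ((𝓡∂ (d + 1)).symm (prodEuclidean d ((a j).toFun ((a i).invFun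
    ((prodEuclidean d).symm ((𝓡∂ (d + 1)) ((𝓡∂ (d + 1)).symm ((𝓡∂ (d + 1)) y)))))))) = _
  rw [ModelWithCorners.left_inv, (𝓡∂ (d + 1)).right_inv]
  · rfl
  · rw [mem_range_half_iff, ContinuousLinearEquiv.symm_apply_apply]
    exact ((a j).map_source _ h2).2

lemma contMDiffOn_toFun [ChartedSpace (EuclideanHalfSpace (d + 1)) M]
    [IsManifold (𝓡∂ (d + 1)) ∞ M]
    (hc : c.toOpenPartialHomeomorph ∈ atlas (EuclideanHalfSpace (d + 1)) M) :
    ContMDiffOn (𝓡∂ (d + 1)) 𝓘(ℝ, ℝ × EuclideanSpace ℝ (Fin d)) ∞ c.toFun c.source := by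
  have h1 := OpenPartialHomeomorph.contMDiffOn_extend (I := 𝓡∂ (d + 1)) (n := ∞)
    (IsManifold.subset_maximalAtlas hc)
  refine ((prodEuclidean d).symm.contDiff.contMDiff.comp_contMDiffOn h1).congr fun m hm => ?_
  rw [Function.comp_apply, c.extend_apply hm, ContinuousLinearEquiv.symm_apply_apply]

lemma contMDiffOn_invFun [ChartedSpace (EuclideanHalfSpace (d + 1)) M]
    [IsManifold (𝓡∂ (d + 1)) ∞ M]
    (hc : c.toOpenPartialHomeomorph ∈ atlas (EuclideanHalfSpace (d + 1)) M) :
    ContMDiffOn 𝓘(ℝ, ℝ × EuclideanSpace ℝ (Fin d)) (𝓡∂ (d + 1)) ∞ c.invFun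
      (c.dom ∩ halfProd d) := by
  have h1 := contMDiffOn_extend_symm (I := 𝓡∂ (d + 1)) (n := ∞)
    (IsManifold.subset_maximalAtlas hc)
  refine (h1.comp (prodEuclidean d).contDiff.contMDiff.contMDiffOn ?_).congr fun y hy => ?_
  · intro y hy
    have h2 := (𝓡∂ (d + 1)).right_inv (x := prodEuclidean d y)
      (mem_range_half_iff.2 (by simpa using hy.2))
    refine ⟨(𝓡∂ (d + 1)).symm (prodEuclidean d y), ?_, h2⟩
    change (prodEuclidean d).symm ((𝓡∂ (d + 1)) _) ∈ c.dom
    rw [h2]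
    simpa using hy.1
  · rw [Function.comp_apply, c.extend_symm_apply hy.2]

/-- The boundary points are those at which the first coordinate of the preferred chart is zero. -/
lemma isBoundaryPoint_iff (m : M) :
    @ModelWithCorners.IsBoundaryPoint _ _ _ _ _ _ _ (𝓡∂ (d + 1)) M _ (chartedSpace a sel hsel) m ↔
      ((a (sel m)).toFun m).1 = 0 := by
  let := chartedSpace a sel hsel
  change (a (sel m)).toOpenPartialHomeomorph.extend (𝓡∂ (d + 1)) m ∈ frontier _ ↔ _
  rw [frontier_range_modelWithCornersEuclideanHalfSpace, (a (sel m)).extend_apply (hsel m)]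
  simp [eq_comm]

end HalfSpaceChart

end HalfSpaceCharts

/-! ### Collapsing the fibres of a sphere bundle -/

section SphereBundles

/-- `proj : P → Q` is the unit sphere bundle of a Euclidean vector bundle over `Q` with fibre `C`,
presented by local trivializations indexed by the points of `Q`. Over `U b`, the point `x` of `P`
corresponds to `(proj x, coord b x)` with `‖coord b x‖ = 1`, and `param b q ζ` is the point of `P`
over `q` in the direction of `ζ ≠ 0`. The transition functions `trans b b'` are linear. The
equivalence `model` identifies the model space of the vector bundle with that of `ℝ × P`. -/
structure SphereBundle (d : ℕ) (P : Type*) [TopologicalSpace P]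
    [ChartedSpace (EuclideanSpace ℝ (Fin d)) P] {EQ : Type*} [NormedAddCommGroup EQ]
    [NormedSpace ℝ EQ] {HQ : Type*} [TopologicalSpace HQ] (IQ : ModelWithCorners ℝ EQ HQ)
    (Q : Type*) [TopologicalSpace Q] [ChartedSpace HQ Q]
    (C : Type*) [NormedAddCommGroup C] [InnerProductSpace ℝ C] where
  model : (EQ × C) ≃L[ℝ] (ℝ × EuclideanSpace ℝ (Fin d))
  proj : P → Q
  U : Q → Set Q
  coord : Q → P → C
  param : Q → Q → C → P
  trans : Q → Q → Q → C →L[ℝ] C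
  contMDiff_proj : ContMDiff (𝓡 d) IQ ∞ proj
  surjective_proj : Function.Surjective proj
  isOpen_U : ∀ b, IsOpen (U b)
  mem_U : ∀ b, b ∈ U b
  norm_coord : ∀ b x, proj x ∈ U b → ‖coord b x‖ = 1
  contMDiffOn_coord : ∀ b, ContMDiffOn (𝓡 d) 𝓘(ℝ, C) ∞ (coord b) (proj ⁻¹' U b)
  contMDiffOn_param : ∀ b, ContMDiffOn (IQ.prod 𝓘(ℝ, C)) (𝓡 d) ∞
    (fun y : Q × C => param b y.1 y.2) (U b ×ˢ {0}ᶜ)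
  proj_param : ∀ b, ∀ q ∈ U b, ∀ ζ, ζ ≠ 0 → proj (param b q ζ) = q
  coord_param : ∀ b, ∀ q ∈ U b, ∀ ζ, ζ ≠ 0 → coord b (param b q ζ) = ‖ζ‖⁻¹ • ζ
  param_coord : ∀ b x, proj x ∈ U b → ∀ r : ℝ, 0 < r → param b (proj x) (r • coord b x) = x
  contMDiffOn_trans : ∀ b b', ContMDiffOn IQ 𝓘(ℝ, C →L[ℝ] C) ∞ (trans b b') (U b ∩ U b')
  trans_coord : ∀ b b' x, proj x ∈ U b → proj x ∈ U b' →
    coord b' x = trans b b' (proj x) (coord b x)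

namespace SphereBundle

variable {d : ℕ} {P : Type*} [TopologicalSpace P] [ChartedSpace (EuclideanSpace ℝ (Fin d)) P]
  {EQ : Type*} [NormedAddCommGroup EQ] [NormedSpace ℝ EQ] {HQ : Type*} [TopologicalSpace HQ]
  {IQ : ModelWithCorners ℝ EQ HQ} {Q : Type*} [TopologicalSpace Q] [ChartedSpace HQ Q]
  {C : Type*} [NormedAddCommGroup C] [InnerProductSpace ℝ C]
  (B : SphereBundle d P IQ Q C) (T : ℝ)

/-- The equivalence relation on `[0, T] × P` that collapses the fibres of `P → Q` at `T`. -/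
def collapseSetoid : Setoid (Icc 0 T × P) where
  r y z := y = z ∨ ((y.1 : ℝ) = T ∧ (z.1 : ℝ) = T ∧ B.proj y.2 = B.proj z.2)
  iseqv :=
    { refl := fun _ => Or.inl rfl
      symm := by
        rintro y z (h | ⟨h1, h2, h3⟩)
        · exact Or.inl h.symm
        · exact Or.inr ⟨h2, h1, h3.symm⟩
      trans := by
        rintro x y z (rfl | ⟨h1, h2, h3⟩) (rfl | ⟨h4, h5, h6⟩)
        · exact Or.inl rfl
        · exact Or.inr ⟨h4, h5, h6⟩
        · exact Or.inr ⟨h1, h2, h3⟩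
        · exact Or.inr ⟨h1, h5, h3.trans h6⟩ }

/-- The space obtained from `[0, T] × P` by collapsing the fibres of `P → Q` at `T`: the closed disc
bundle whose boundary is `{0} × P` and whose zero section is `Q`. -/
def Collapse : Type _ := Quotient (B.collapseSetoid T)

instance : TopologicalSpace (B.Collapse T) := inferInstanceAs (TopologicalSpace (Quotient _))

instance [CompactSpace P] : CompactSpace (B.Collapse T) :=
  inferInstanceAs (CompactSpace (Quotient _))

namespace Collapse

variable {T}

/-- The quotient map. -/
def mk (y : Icc 0 T × P) : B.Collapse T := Quotient.mk (B.collapseSetoid T) y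

lemma isQuotientMap_mk : Topology.IsQuotientMap (mk B (T := T)) := isQuotientMap_quotient_mk'

lemma continuous_mk : Continuous (mk B (T := T)) := continuous_quotient_mk'

lemma mk_surjective : Function.Surjective (mk B (T := T)) := Quotient.mk_surjective

lemma mk_eq_mk_iff {y z : Icc 0 T × P} : mk B y = mk B z ↔
    y = z ∨ ((y.1 : ℝ) = T ∧ (z.1 : ℝ) = T ∧ B.proj y.2 = B.proj z.2) :=
  Quotient.eq (r := B.collapseSetoid T)

/-- The coordinate `s`. -/
def height : B.Collapse T → ℝ :=
  Quotient.lift (fun y => (y.1 : ℝ)) (by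
    rintro y z (h | ⟨h1, h2, -⟩)
    · rw [h]
    · rw [h1, h2])

/-- The projection to `Q`. -/
def base : B.Collapse T → Q :=
  Quotient.lift (fun y => B.proj y.2) (by
    rintro y z (h | ⟨-, -, h⟩)
    · rw [h]
    · exact h)

/-- The coordinate in the fibre of the disc bundle over `U b`. Its norm is `√(2 (T - s))`, so that
`s` is a smooth function of it. -/
def fibre (b : Q) : B.Collapse T → C :=
  Quotient.lift (fun y => √(2 * (T - (y.1 : ℝ))) • B.coord b y.2) (by
    rintro y z (h | ⟨h1, h2, -⟩)
    · rw [h]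
    · simp [h1, h2])

/-- The component in `P` of a point with `s < T`; for `s = T`, it is some point of the collapsed
fibre. -/
def point (m : B.Collapse T) : P := (Quotient.out m).2

@[simp] lemma height_mk (y : Icc 0 T × P) : height B (mk B y) = y.1 := rfl

@[simp] lemma base_mk (y : Icc 0 T × P) : base B (mk B y) = B.proj y.2 := rfl

@[simp] lemma fibre_mk (b : Q) (y : Icc 0 T × P) :
    fibre B b (mk B y) = √(2 * (T - (y.1 : ℝ))) • B.coord b y.2 := rfl

lemma point_mk {y : Icc 0 T × P} (hy : (y.1 : ℝ) < T) : point B (mk B y) = y.2 := by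
  have h : mk B (Quotient.out (mk B y)) = mk B y := Quotient.out_eq _
  rcases (mk_eq_mk_iff B).1 h with h | ⟨-, h, -⟩
  · change (Quotient.out (mk B y)).2 = y.2
    rw [h]
  · exact absurd h hy.ne

lemma continuous_height : Continuous (height B (T := T)) :=
  (isQuotientMap_mk B).continuous_iff.2 (continuous_subtype_val.comp continuous_fst)

lemma continuous_base : Continuous (base B (T := T)) :=
  (isQuotientMap_mk B).continuous_iff.2 (B.contMDiff_proj.continuous.comp continuous_snd)

lemma height_mem (m : B.Collapse T) : height B m ∈ Icc 0 T := by
  obtain ⟨y, rfl⟩ := mk_surjective B m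
  exact y.1.2

lemma isOpen_height_lt : IsOpen {m : B.Collapse T | height B m < T} :=
  isOpen_Iio.preimage (continuous_height B)

lemma continuousOn_point : ContinuousOn (point B) {m : B.Collapse T | height B m < T} := by
  rw [(isQuotientMap_mk B).continuousOn_isOpen_iff (isOpen_height_lt B)]
  exact continuousOn_snd.congr fun y hy => point_mk B hy

lemma isOpen_base_preimage (b : Q) : IsOpen (base B (T := T) ⁻¹' B.U b) :=
  (B.isOpen_U b).preimage (continuous_base B)

lemma continuousOn_fibre (b : Q) : ContinuousOn (fibre B (T := T) b) (base B ⁻¹' B.U b) := by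
  rw [(isQuotientMap_mk B).continuousOn_isOpen_iff (isOpen_base_preimage B b)]
  have h1 : ContinuousOn (fun y : Icc 0 T × P => B.coord b y.2) (mk B ⁻¹' (base B ⁻¹' B.U b)) :=
    (B.contMDiffOn_coord b).continuousOn.comp continuousOn_snd fun y hy => hy
  exact ContinuousOn.smul (by fun_prop) h1

lemma norm_fibre_sq {b : Q} {m : B.Collapse T} (hm : base B m ∈ B.U b) :
    ‖fibre B b m‖ ^ 2 = 2 * (T - height B m) := by
  obtain ⟨y, rfl⟩ := mk_surjective B m
  have h : (y.1 : ℝ) ≤ T := y.1.2.2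
  rw [fibre_mk, norm_smul, B.norm_coord b _ hm, mul_one, Real.norm_eq_abs, sq_abs,
    Real.sq_sqrt (by linarith), height_mk]

lemma fibre_trans {b b' : Q} {m : B.Collapse T} (hb : base B m ∈ B.U b)
    (hb' : base B m ∈ B.U b') : fibre B b' m = B.trans b b' (base B m) (fibre B b m) := by
  obtain ⟨y, rfl⟩ := mk_surjective B m
  rw [fibre_mk, fibre_mk, B.trans_coord b b' _ hb hb', map_smul, base_mk]

lemma fibre_eq_zero_iff {b : Q} {m : B.Collapse T} (hm : base B m ∈ B.U b) :
    fibre B b m = 0 ↔ height B m = T := by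
  rw [← norm_eq_zero, ← sq_eq_zero_iff, norm_fibre_sq B hm]
  constructor <;> intro h <;> linarith

section

variable (hT : 0 ≤ T)

/-- The collapsing map on `ℝ × P`, constant in the real variable outside `[0, T]`. -/
def collapse (y : ℝ × P) : B.Collapse T := mk B (projIcc 0 T hT y.1, y.2)

lemma continuous_collapse : Continuous (collapse B hT) :=
  (continuous_mk B).comp
    ((continuous_projIcc.comp continuous_fst).prodMk continuous_snd)

lemma height_collapse {s : ℝ} (hs : s ∈ Icc 0 T) (x : P) : height B (collapse B hT (s, x)) = s := by
  simp [collapse, projIcc_of_mem hT hs]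

lemma base_collapse (y : ℝ × P) : base B (collapse B hT y) = B.proj y.2 := rfl

lemma point_collapse {s : ℝ} (hs : s ∈ Ico 0 T) (x : P) : point B (collapse B hT (s, x)) = x := by
  rw [collapse, point_mk]
  rw [projIcc_of_mem hT (Ico_subset_Icc_self hs)]
  exact hs.2

lemma fibre_collapse (b : Q) {s : ℝ} (hs : s ∈ Icc 0 T) (x : P) :
    fibre B b (collapse B hT (s, x)) = √(2 * (T - s)) • B.coord b x := by
  simp [collapse, projIcc_of_mem hT hs]

lemma collapse_height_point {m : B.Collapse T} (hm : height B m < T) :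
    collapse B hT (height B m, point B m) = m := by
  obtain ⟨y, rfl⟩ := mk_surjective B m
  rw [point_mk B hm, height_mk, collapse, projIcc_val]

lemma proj_point {m : B.Collapse T} (hm : height B m < T) : B.proj (point B m) = base B m := by
  obtain ⟨y, rfl⟩ := mk_surjective B m
  rw [point_mk B hm, base_mk]

/-- A point with `s = T` is determined by its projection to `Q`. -/
lemma eq_of_height_eq {m m' : B.Collapse T} (hm : height B m = T) (hm' : height B m' = T)
    (h : base B m = base B m') : m = m' := by
  obtain ⟨y, rfl⟩ := mk_surjective B m
  obtain ⟨z, rfl⟩ := mk_surjective B m'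
  exact (mk_eq_mk_iff B).2 (Or.inr ⟨hm, hm', h⟩)

/-- Two points with the same values of `s` and the same projection to `Q` have `s < T`, where the
collapsed space is homeomorphic to a product. -/
instance [T2Space P] [T2Space Q] : T2Space (B.Collapse T) where
  t2 m m' hne := by
    by_cases h1 : height B m = height B m'
    · by_cases h2 : base B m = base B m'
      · have h3 : height B m < T := by
          refine lt_of_le_of_ne (height_mem B m).2 fun h => hne ?_
          exact eq_of_height_eq B h (h1 ▸ h) h2
        have hT : 0 ≤ T := (height_mem B m).1.trans h3.le
        have h3' : height B m' < T := h1 ▸ h3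
        have h4 : point B m ≠ point B m' := fun h => hne (by
          have h5 := collapse_height_point B hT h3
          rwa [h1, h, collapse_height_point B hT h3', eq_comm] at h5)
        obtain ⟨u, v, hu, hv, hmu, hmv, huv⟩ := t2_separation h4
        refine ⟨_, _, (continuousOn_point B).isOpen_inter_preimage (isOpen_height_lt B) hu,
          (continuousOn_point B).isOpen_inter_preimage (isOpen_height_lt B) hv, ⟨h3, hmu⟩,
          ⟨h3', hmv⟩, ?_⟩
        exact (huv.preimage _).mono inter_subset_right inter_subset_right
      · exact separated_by_continuous (continuous_base B) h2
    · exact separated_by_continuous (continuous_height B) h1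

open Classical in
/-- The point of the disc bundle over `q ∈ U b` with coordinate `ζ` in the fibre. For `ζ = 0`, all
points of the fibre of `P` over `q` give the same value. -/
def ofFibre (b : Q) (y : Q × C) : B.Collapse T :=
  if y.2 = 0 then collapse B hT (T, Function.surjInv B.surjective_proj y.1)
  else collapse B hT (T - ‖y.2‖ ^ 2 / 2, B.param b y.1 y.2)

/-- The domain of `ofFibre b`. -/
def fibreDom (T : ℝ) (b : Q) : Set (Q × C) := {y | y.1 ∈ B.U b ∧ ‖y.2‖ ^ 2 ≤ 2 * T}

variable {B} in
lemma fibreDom_mem_Icc {b : Q} {y : Q × C} (hy : y ∈ fibreDom B T b) :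
    T - ‖y.2‖ ^ 2 / 2 ∈ Icc 0 T :=
  ⟨by linarith [hy.2], by linarith [sq_nonneg ‖y.2‖]⟩

lemma height_ofFibre {b : Q} {y : Q × C} (hy : y ∈ fibreDom B T b) :
    height B (ofFibre B hT b y) = T - ‖y.2‖ ^ 2 / 2 := by
  rw [ofFibre]
  split_ifs with h
  · rw [height_collapse B hT ⟨hT, le_rfl⟩, h]; simp
  · rw [height_collapse B hT (fibreDom_mem_Icc hy)]

lemma base_ofFibre {b : Q} {y : Q × C} (hy : y.1 ∈ B.U b) :
    base B (ofFibre B hT b y) = y.1 := by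
  rw [ofFibre]
  split_ifs with h
  · exact Function.surjInv_eq B.surjective_proj y.1
  · rw [base_collapse, B.proj_param b _ hy _ h]

lemma fibre_ofFibre {b : Q} {y : Q × C} (hy : y ∈ fibreDom B T b) :
    fibre B b (ofFibre B hT b y) = y.2 := by
  rw [ofFibre]
  split_ifs with h
  · rw [fibre_collapse B hT b ⟨hT, le_rfl⟩, h]; simp
  · rw [fibre_collapse B hT b (fibreDom_mem_Icc hy), B.coord_param b _ hy.1 _ h, smul_smul]
    have h1 : 2 * (T - (T - ‖y.2‖ ^ 2 / 2)) = ‖y.2‖ ^ 2 := by ring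
    rw [h1, Real.sqrt_sq (norm_nonneg _), mul_inv_cancel₀ (norm_ne_zero_iff.2 h), one_smul]

lemma mem_fibreDom {b : Q} {m : B.Collapse T} (hm : base B m ∈ B.U b) :
    (base B m, fibre B b m) ∈ fibreDom B T b :=
  ⟨hm, by rw [norm_fibre_sq B hm]; linarith [(height_mem B m).1]⟩

/-- For `s < T`, the component in `P` is the direction of the coordinate in the fibre. -/
lemma point_eq_param {b : Q} {m : B.Collapse T} (hm : base B m ∈ B.U b) (h : height B m < T) :
    point B m = B.param b (base B m) (fibre B b m) := by
  obtain ⟨y, rfl⟩ := mk_surjective B m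
  rw [point_mk B h, base_mk, fibre_mk]
  exact (B.param_coord b _ hm _ (Real.sqrt_pos.2 (by linarith [show (y.1 : ℝ) < T from h]))).symm

lemma ofFibre_base_fibre {b : Q} {m : B.Collapse T} (hm : base B m ∈ B.U b) :
    ofFibre B hT b (base B m, fibre B b m) = m := by
  by_cases h : height B m = T
  · refine eq_of_height_eq B ?_ h (base_ofFibre B hT hm)
    rw [height_ofFibre B hT (mem_fibreDom B hm), norm_fibre_sq B hm]; linarith
  · have h1 : height B m < T := lt_of_le_of_ne (height_mem B m).2 h
    rw [ofFibre, if_neg (by rwa [fibre_eq_zero_iff B hm]), norm_fibre_sq B hm,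
      ← point_eq_param B hm h1]
    have h2 : T - 2 * (T - height B m) / 2 = height B m := by ring
    rw [h2, collapse_height_point B hT h1]

/-- Near the zero section, the continuity follows from the compactness of `P`. -/
lemma continuousOn_ofFibre [CompactSpace P] [T2Space Q] (b : Q) :
    ContinuousOn (ofFibre B hT b) (fibreDom B T b) := by
  rintro ⟨q, ζ⟩ hy
  by_cases h : ζ = 0
  · subst h
    -- `(height, base)` is a closed map with one point over `(T, q)`, so neighbourhoods of this
    -- point are pulled back from neighbourhoods of `(T, q)`
    set m := ofFibre B hT b (q, 0) with hm
    have hf : Continuous fun m : B.Collapse T => (height B m, base B m) :=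
      (continuous_height B).prodMk (continuous_base B)
    have h1 := hf.isClosedMap.comap_nhds_eq hf (T, q)
    have h2 : (fun m : B.Collapse T => (height B m, base B m)) ⁻¹' {(T, q)} = {m} := by
      have h3 : height B m = T := by rw [hm, height_ofFibre B hT hy]; simp
      have h4 : base B m = q := base_ofFibre B hT hy.1
      ext m'
      simp only [mem_preimage, mem_singleton_iff, Prod.mk.injEq]
      constructor
      · rintro ⟨h5, h6⟩
        exact eq_of_height_eq B h5 h3 (h6.trans h4.symm)
      · rintro rfl; exact ⟨h3, h4⟩
    rw [h2, nhdsSet_singleton] at h1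
    rw [ContinuousWithinAt, ← hm, ← h1, Filter.tendsto_comap_iff]
    have h7 : ContinuousWithinAt (fun y : Q × C => (T - ‖y.2‖ ^ 2 / 2, y.1)) (fibreDom B T b)
        (q, 0) := Continuous.continuousWithinAt (by fun_prop)
    have h8 : Filter.Tendsto (fun y : Q × C => (T - ‖y.2‖ ^ 2 / 2, y.1))
        (𝓝[fibreDom B T b] (q, 0)) (𝓝 (T, q)) := by
      simpa [ContinuousWithinAt] using h7
    refine h8.congr' ?_
    filter_upwards [self_mem_nhdsWithin] with y hy
    simp only [Function.comp_apply]
    rw [height_ofFibre B hT hy, base_ofFibre B hT hy.1]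
  · have h1 : ContinuousWithinAt (fun y : Q × C => collapse B hT
        (T - ‖y.2‖ ^ 2 / 2, B.param b y.1 y.2)) (fibreDom B T b) (q, ζ) := by
      refine (continuous_collapse B hT).continuousAt.comp_continuousWithinAt ?_
      refine ContinuousWithinAt.prodMk (Continuous.continuousWithinAt (by fun_prop)) ?_
      have h2 := (B.contMDiffOn_param b).continuousOn (q, ζ) ⟨hy.1, h⟩
      refine (h2.continuousAt ?_).continuousWithinAt
      exact (((B.isOpen_U b).prod isOpen_compl_singleton)).mem_nhds ⟨hy.1, h⟩
    refine h1.congr_of_eventuallyEq ?_ (by rw [ofFibre, if_neg h])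
    have h3 : ∀ᶠ y : Q × C in 𝓝[fibreDom B T b] (q, ζ), y.2 ≠ 0 :=
      nhdsWithin_le_nhds (continuous_snd.continuousAt.eventually_ne h)
    filter_upwards [h3] with y hy
    rw [ofFibre, if_neg hy]

end

end Collapse

end SphereBundle

end SphereBundles

namespace SphereBundle

namespace Collapse

/-! ### The charts of the disc bundle -/

section Charts

variable {d : ℕ} {P : Type*} [TopologicalSpace P] [ChartedSpace (EuclideanSpace ℝ (Fin d)) P]
  {EQ : Type*} [NormedAddCommGroup EQ] [NormedSpace ℝ EQ] {HQ : Type*} [TopologicalSpace HQ]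
  {IQ : ModelWithCorners ℝ EQ HQ} {Q : Type*} [TopologicalSpace Q] [ChartedSpace HQ Q]
  {C : Type*} [NormedAddCommGroup C] [InnerProductSpace ℝ C]
  (B : SphereBundle d P IQ Q C) {T : ℝ} (hT : 0 ≤ T)

/-- The chart of `ℝ × P` at `(s, x₀)`. -/
def collarOut (x₀ : P) (y : ℝ × P) : ℝ × EuclideanSpace ℝ (Fin d) := (y.1, extChartAt (𝓡 d) x₀ y.2)

/-- The inverse of `collarOut x₀`. -/
def collarIn (x₀ : P) (y : ℝ × EuclideanSpace ℝ (Fin d)) : ℝ × P :=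
  (y.1, (extChartAt (𝓡 d) x₀).symm y.2)

variable (L : (EQ × C) ≃L[ℝ] (ℝ × EuclideanSpace ℝ (Fin d)))

/-- A chart of `Q × C`, with values in the open half of `ℝ × ℝ^d`. The exponential map moves the
values of the chart `L ∘ (extChartAt IQ b × id)` to the half space. -/
def coreOut (b : Q) (y : Q × C) : ℝ × EuclideanSpace ℝ (Fin d) :=
  (Real.exp (L (extChartAt IQ b y.1, y.2)).1, (L (extChartAt IQ b y.1, y.2)).2)

/-- The inverse of `coreOut L b`. -/
def coreIn (IQ : ModelWithCorners ℝ EQ HQ) (L : (EQ × C) ≃L[ℝ] (ℝ × EuclideanSpace ℝ (Fin d)))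
    (b : Q) (y : ℝ × EuclideanSpace ℝ (Fin d)) : Q × C :=
  ((extChartAt IQ b).symm (L.symm (Real.log y.1, y.2)).1, (L.symm (Real.log y.1, y.2)).2)

/-- The values of `coreOut L b`. -/
def coreTarget (IQ : ModelWithCorners ℝ EQ HQ)
    (L : (EQ × C) ≃L[ℝ] (ℝ × EuclideanSpace ℝ (Fin d))) (b : Q) :
    Set (ℝ × EuclideanSpace ℝ (Fin d)) :=
  {y | 0 < y.1 ∧ (L.symm (Real.log y.1, y.2)).1 ∈ (extChartAt IQ b).target}

lemma coreOut_mem {b : Q} {y : Q × C} (hy : y.1 ∈ (extChartAt IQ b).source) :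
    coreOut (IQ := IQ) L b y ∈ coreTarget IQ L b := by
  refine ⟨Real.exp_pos _, ?_⟩
  simpa [coreOut] using (extChartAt IQ b).map_source hy

lemma coreIn_coreOut {b : Q} {y : Q × C} (hy : y.1 ∈ (extChartAt IQ b).source) :
    coreIn IQ L b (coreOut (IQ := IQ) L b y) = y := by
  simp only [coreIn, coreOut, Real.log_exp, Prod.mk.eta, ContinuousLinearEquiv.symm_apply_apply,
    (extChartAt IQ b).left_inv hy]

lemma coreOut_coreIn {b : Q} {y : ℝ × EuclideanSpace ℝ (Fin d)} (hy : y ∈ coreTarget IQ L b) :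
    coreOut (IQ := IQ) L b (coreIn IQ L b y) = y := by
  simp only [coreIn, coreOut, (extChartAt IQ b).right_inv hy.2, Prod.mk.eta,
    ContinuousLinearEquiv.apply_symm_apply, Real.exp_log hy.1]

lemma contDiffOn_log_prod :
    ContDiffOn ℝ ∞ (fun y : ℝ × EuclideanSpace ℝ (Fin d) => L.symm (Real.log y.1, y.2))
      {y | 0 < y.1} :=
  L.symm.contDiff.comp_contDiffOn
    (ContDiffOn.prodMk (contDiffOn_fst.log fun _ hy => ne_of_gt hy) contDiffOn_snd)

lemma contMDiffOn_coreOut [IsManifold IQ ∞ Q] (b : Q) :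
    ContMDiffOn (IQ.prod 𝓘(ℝ, C)) 𝓘(ℝ, ℝ × EuclideanSpace ℝ (Fin d)) ∞ (coreOut (IQ := IQ) L b)
      ((extChartAt IQ b).source ×ˢ univ) := by
  have h1 : ContMDiffOn (IQ.prod 𝓘(ℝ, C)) 𝓘(ℝ, EQ × C) ∞
      (fun y : Q × C => (extChartAt IQ b y.1, y.2)) ((extChartAt IQ b).source ×ˢ univ) := by
    refine ContMDiffOn.prodMk_space ?_ contMDiffOn_snd
    have h2 := contMDiffOn_extChartAt (I := IQ) (n := ∞) (x := b)
    rw [← extChartAt_source IQ] at h2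
    exact h2.comp contMDiffOn_fst fun y hy => hy.1
  have h3 : ContDiff ℝ ∞ (fun z : EQ × C => (Real.exp (L z).1, (L z).2)) := by fun_prop
  exact h3.contMDiff.comp_contMDiffOn h1

lemma contMDiffOn_coreIn [IsManifold IQ ∞ Q] (b : Q) :
    ContMDiffOn 𝓘(ℝ, ℝ × EuclideanSpace ℝ (Fin d)) (IQ.prod 𝓘(ℝ, C)) ∞ (coreIn IQ L b)
      (coreTarget IQ L b) := by
  have h1 := (contDiffOn_log_prod L).mono (t := coreTarget IQ L b) fun y hy => hy.1
  refine ContMDiffOn.prodMk ?_ ?_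
  · exact (contMDiffOn_extChartAt_symm (I := IQ) (n := ∞) b).comp
      (contDiff_fst.comp_contDiffOn h1).contMDiffOn fun y hy => hy.2
  · exact (contDiff_snd.comp_contDiffOn h1).contMDiffOn

lemma isOpen_coreTarget_inter [IQ.Boundaryless] (b : Q) {s : Set (Q × C)} (hs : IsOpen s) :
    IsOpen (coreTarget IQ L b ∩ coreIn IQ L b ⁻¹' s) := by
  have h0 : IsOpen {y : ℝ × EuclideanSpace ℝ (Fin d) | 0 < y.1} :=
    isOpen_Ioi.preimage continuous_fst
  have h1 : IsOpen {z : EQ × C | z.1 ∈ (extChartAt IQ b).target ∧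
      ((extChartAt IQ b).symm z.1, z.2) ∈ s} := by
    have h2 : ContinuousOn (fun z : EQ × C => ((extChartAt IQ b).symm z.1, z.2))
        (Prod.fst ⁻¹' (extChartAt IQ b).target) :=
      ((continuousOn_extChartAt_symm b).comp continuousOn_fst fun z hz => hz).prodMk continuousOn_snd
    exact h2.isOpen_inter_preimage ((isOpen_extChartAt_target b).preimage continuous_fst) hs
  have h3 := (contDiffOn_log_prod L).continuousOn.isOpen_inter_preimage h0 h1
  convert! h3 using 1
  ext y
  simp only [coreTarget, coreIn, mem_inter_iff, mem_ofPred_eq, mem_preimage, and_assoc]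

lemma contMDiffOn_collarOut [IsManifold (𝓡 d) ∞ P] (x₀ : P) :
    ContMDiffOn (𝓘(ℝ, ℝ).prod (𝓡 d)) 𝓘(ℝ, ℝ × EuclideanSpace ℝ (Fin d)) ∞
      (collarOut (d := d) x₀) (univ ×ˢ (extChartAt (𝓡 d) x₀).source) := by
  refine ContMDiffOn.prodMk_space contMDiffOn_fst ?_
  have h2 := contMDiffOn_extChartAt (I := 𝓡 d) (n := ∞) (x := x₀)
  rw [← extChartAt_source (𝓡 d)] at h2
  exact h2.comp contMDiffOn_snd fun y hy => hy.2

lemma contMDiffOn_collarIn [IsManifold (𝓡 d) ∞ P] (x₀ : P) :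
    ContMDiffOn 𝓘(ℝ, ℝ × EuclideanSpace ℝ (Fin d)) (𝓘(ℝ, ℝ).prod (𝓡 d)) ∞ (collarIn x₀)
      (univ ×ˢ (extChartAt (𝓡 d) x₀).target) := by
  refine ContMDiffOn.prodMk contDiff_fst.contMDiff.contMDiffOn ?_
  exact (contMDiffOn_extChartAt_symm (I := 𝓡 d) (n := ∞) x₀).comp
    contDiff_snd.contMDiff.contMDiffOn fun y hy => hy.2

/-- The half-space chart around the points with `s < T` that is given by a chart of `P`. -/
def collarChart (x₀ : P) : HalfSpaceChart d (B.Collapse T) where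
  toFun m := collarOut x₀ (height B m, point B m)
  invFun y := collapse B hT (collarIn x₀ y)
  source := {m | height B m < T} ∩ point B ⁻¹' (extChartAt (𝓡 d) x₀).source
  dom := {y | y.1 < T ∧ y.2 ∈ (extChartAt (𝓡 d) x₀).target}
  open_source := (continuousOn_point B).isOpen_inter_preimage (isOpen_height_lt B)
    (isOpen_extChartAt_source x₀)
  open_dom := (isOpen_Iio.preimage continuous_fst).inter
    ((isOpen_extChartAt_target x₀).preimage continuous_snd)
  map_source m hm := ⟨⟨hm.1, (extChartAt (𝓡 d) x₀).map_source hm.2⟩, (height_mem B m).1⟩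
  map_dom y hy := by
    have hs : y.1 ∈ Ico 0 T := ⟨hy.2, hy.1.1⟩
    refine ⟨?_, ?_⟩
    · rw [mem_ofPred_eq, collarIn, height_collapse B hT (Ico_subset_Icc_self hs)]
      exact hs.2
    · rw [mem_preimage, collarIn, point_collapse B hT hs]
      exact (extChartAt (𝓡 d) x₀).map_target hy.1.2
  left_inv m hm := by
    rw [collarIn, collarOut, (extChartAt (𝓡 d) x₀).left_inv hm.2, collapse_height_point B hT hm.1]
  right_inv y hy := by
    have hs : y.1 ∈ Ico 0 T := ⟨hy.2, hy.1.1⟩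
    rw [collarIn, collarOut, height_collapse B hT (Ico_subset_Icc_self hs),
      point_collapse B hT hs, (extChartAt (𝓡 d) x₀).right_inv hy.1.2]
  continuousOn_toFun := (continuous_height B).continuousOn.prodMk
    ((continuousOn_extChartAt x₀).comp ((continuousOn_point B).mono inter_subset_left)
      fun m hm => hm.2)
  continuousOn_invFun := (continuous_collapse B hT).comp_continuousOn
    (continuousOn_fst.prodMk ((continuousOn_extChartAt_symm x₀).comp continuousOn_snd
      fun y hy => hy.1.2))

/-- The half-space chart around the points with `s = T`, with values in the interior of the half
space. -/
def coreChart [IQ.Boundaryless] [IsManifold IQ ∞ Q] [CompactSpace P] [T2Space Q] (b : Q) :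
    HalfSpaceChart d (B.Collapse T) where
  toFun m := coreOut (IQ := IQ) L b (base B m, fibre B b m)
  invFun y := ofFibre B hT b (coreIn IQ L b y)
  source := {m | base B m ∈ B.U b ∩ (extChartAt IQ b).source ∧ 0 < height B m}
  dom := coreTarget IQ L b ∩ coreIn IQ L b ⁻¹' {y | y.1 ∈ B.U b ∧ ‖y.2‖ ^ 2 < 2 * T}
  open_source := (((B.isOpen_U b).inter (isOpen_extChartAt_source b)).preimage
    (continuous_base B)).inter (isOpen_Ioi.preimage (continuous_height B))
  open_dom := isOpen_coreTarget_inter L b (((B.isOpen_U b).preimage continuous_fst).inter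
    (isOpen_Iio.preimage (by fun_prop : Continuous fun y : Q × C => ‖y.2‖ ^ 2)))
  map_source m hm := by
    refine ⟨⟨coreOut_mem L hm.1.2, ?_⟩, (Real.exp_pos _).le⟩
    rw [mem_preimage, coreIn_coreOut L hm.1.2]
    refine ⟨hm.1.1, ?_⟩
    rw [norm_fibre_sq B hm.1.1]
    linarith [hm.2]
  map_dom y hy := by
    have h1 : coreIn IQ L b y ∈ fibreDom B T b := ⟨hy.1.2.1, hy.1.2.2.le⟩
    refine ⟨?_, ?_⟩
    · rw [base_ofFibre B hT h1.1]
      exact ⟨h1.1, (extChartAt IQ b).map_target hy.1.1.2⟩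
    · rw [height_ofFibre B hT h1]
      have := hy.1.2.2
      change ‖(coreIn IQ L b y).2‖ ^ 2 < 2 * T at this
      linarith
  left_inv m hm := by
    rw [coreIn_coreOut L hm.1.2, ofFibre_base_fibre B hT hm.1.1]
  right_inv y hy := by
    have h1 : coreIn IQ L b y ∈ fibreDom B T b := ⟨hy.1.2.1, hy.1.2.2.le⟩
    rw [base_ofFibre B hT h1.1, fibre_ofFibre B hT h1, Prod.mk.eta, coreOut_coreIn L hy.1.1]
  continuousOn_toFun := (contMDiffOn_coreOut L b).continuousOn.comp
    ((continuous_base B).continuousOn.prodMk ((continuousOn_fibre B b).mono fun m hm => hm.1.1))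
    fun m hm => ⟨hm.1.2, mem_univ _⟩
  continuousOn_invFun := (continuousOn_ofFibre B hT b).comp
    ((contMDiffOn_coreIn L b).continuousOn.mono fun y hy => hy.1.1)
    fun y hy => ⟨hy.1.2.1, hy.1.2.2.le⟩

/-- The smooth structure of the disc bundle in polar coordinates. -/
lemma contMDiffOn_polar [IsManifold (𝓡 d) ∞ P] (b : Q) :
    ContMDiffOn (𝓘(ℝ, ℝ).prod (𝓡 d)) (IQ.prod 𝓘(ℝ, C)) ∞
      (fun y : ℝ × P => (B.proj y.2, √(2 * (T - y.1)) • B.coord b y.2))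
      {y | y.1 < T ∧ B.proj y.2 ∈ B.U b} := by
  refine ContMDiffOn.prodMk (B.contMDiff_proj.comp contMDiff_snd).contMDiffOn ?_
  have h1 : ContMDiffOn (𝓘(ℝ, ℝ).prod (𝓡 d)) 𝓘(ℝ, ℝ) ∞ (fun y : ℝ × P => √(2 * (T - y.1)))
      {y | y.1 < T ∧ B.proj y.2 ∈ B.U b} := by
    have h1 : ContDiffOn ℝ ∞ (fun s : ℝ => √(2 * (T - s))) (Iio T) :=
      ContDiffOn.sqrt (by fun_prop) fun s hs => by
        have : s < T := hs
        exact ne_of_gt (by linarith)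
    exact h1.contMDiffOn.comp contMDiffOn_fst fun y hy => hy.1
  have h2 : ContMDiffOn (𝓘(ℝ, ℝ).prod (𝓡 d)) 𝓘(ℝ, C) ∞ (fun y : ℝ × P => B.coord b y.2)
      {y | y.1 < T ∧ B.proj y.2 ∈ B.U b} :=
    (B.contMDiffOn_coord b).comp contMDiffOn_snd fun y hy => hy.2
  exact h1.smul h2

lemma contMDiffOn_polar_symm (b : Q) :
    ContMDiffOn (IQ.prod 𝓘(ℝ, C)) (𝓘(ℝ, ℝ).prod (𝓡 d)) ∞
      (fun y : Q × C => (T - ‖y.2‖ ^ 2 / 2, B.param b y.1 y.2)) (B.U b ×ˢ {0}ᶜ) := by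
  refine ContMDiffOn.prodMk ?_ (B.contMDiffOn_param b)
  have h1 : ContDiff ℝ ∞ (fun ζ : C => T - ‖ζ‖ ^ 2 / 2) :=
    contDiff_const.sub ((contDiff_norm_sq ℝ).div_const 2)
  exact (h1.contMDiff.comp contMDiff_snd).contMDiffOn

lemma contMDiffOn_transition (b b' : Q) :
    ContMDiffOn (IQ.prod 𝓘(ℝ, C)) (IQ.prod 𝓘(ℝ, C)) ∞
      (fun y : Q × C => (y.1, B.trans b b' y.1 y.2)) ((B.U b ∩ B.U b') ×ˢ univ) := by
  refine ContMDiffOn.prodMk contMDiffOn_fst ?_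
  exact ((B.contMDiffOn_trans b b').comp contMDiffOn_fst fun y hy => hy.1).clm_apply contMDiffOn_snd

open Classical in
/-- The selection of the preferred charts. -/
def chartIndex (m : B.Collapse T) : P ⊕ Q :=
  if height B m < T then Sum.inl (point B m) else Sum.inr (base B m)

lemma chartIndex_of_lt {m : B.Collapse T} (hm : height B m < T) :
    chartIndex B m = Sum.inl (point B m) := if_pos hm

lemma chartIndex_of_eq {m : B.Collapse T} (hm : height B m = T) :
    chartIndex B m = Sum.inr (base B m) := if_neg (by rw [hm]; exact lt_irrefl T)

variable [IQ.Boundaryless] [IsManifold IQ ∞ Q] [CompactSpace P] [T2Space Q]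

/-- The atlas of the collapsed space. -/
def chart : P ⊕ Q → HalfSpaceChart d (B.Collapse T) :=
  Sum.elim (collarChart B hT) (coreChart B hT L)

lemma mem_chart_source (hT' : 0 < T) (m : B.Collapse T) :
    m ∈ (chart B hT L (chartIndex B m)).source := by
  rcases (height_mem B m).2.lt_or_eq with h | h
  · rw [chartIndex_of_lt B h]
    exact ⟨h, mem_extChartAt_source _⟩
  · rw [chartIndex_of_eq B h]
    exact ⟨⟨B.mem_U _, mem_extChartAt_source _⟩, by rw [h]; exact hT'⟩

lemma contDiffOn_chart_transition [IsManifold (𝓡 d) ∞ P] (i j : P ⊕ Q) :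
    ContDiffOn ℝ ∞ ((chart B hT L j).toFun ∘ (chart B hT L i).invFun)
      {y | y ∈ (chart B hT L i).dom ∩ halfProd d ∧
        (chart B hT L i).invFun y ∈ (chart B hT L j).source} := by
  rw [← contMDiffOn_iff_contDiffOn]
  rcases i with x₀ | b <;> rcases j with x₁ | b'
  · have hpt : ∀ y ∈ {y | y ∈ (chart B hT L (Sum.inl x₀)).dom ∩ halfProd d ∧
        (chart B hT L (Sum.inl x₀)).invFun y ∈ (chart B hT L (Sum.inl x₁)).source},
        height B (collapse B hT (collarIn x₀ y)) = (collarIn x₀ y).1 ∧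
        point B (collapse B hT (collarIn x₀ y)) = (collarIn x₀ y).2 := fun y hy =>
      ⟨height_collapse B hT ⟨hy.1.2, hy.1.1.1.le⟩ _, point_collapse B hT ⟨hy.1.2, hy.1.1.1⟩ _⟩
    refine ((contMDiffOn_collarOut x₁).comp ((contMDiffOn_collarIn x₀).mono ?_) ?_).congr ?_
    · exact fun y hy => ⟨mem_univ _, hy.1.1.2⟩
    · intro y hy
      refine ⟨mem_univ _, ?_⟩
      have h2 := hy.2.2
      change point B (collapse B hT (collarIn x₀ y)) ∈ (extChartAt (𝓡 d) x₁).source at h2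
      rwa [(hpt y hy).2] at h2
    · intro y hy
      change collarOut x₁ (height B (collapse B hT (collarIn x₀ y)),
        point B (collapse B hT (collarIn x₀ y))) = _
      rw [(hpt y hy).1, (hpt y hy).2]
      rfl
  · have hpt : ∀ y ∈ {y | y ∈ (chart B hT L (Sum.inl x₀)).dom ∩ halfProd d ∧
        (chart B hT L (Sum.inl x₀)).invFun y ∈ (chart B hT L (Sum.inr b')).source},
        fibre B b' (collapse B hT (collarIn x₀ y)) =
          √(2 * (T - (collarIn x₀ y).1)) • B.coord b' (collarIn x₀ y).2 := fun y hy =>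
      fibre_collapse B hT b' ⟨hy.1.2, hy.1.1.1.le⟩ _
    refine ((contMDiffOn_coreOut L b').comp ((contMDiffOn_polar B (T := T) b').comp
      ((contMDiffOn_collarIn x₀).mono ?_) ?_) ?_).congr ?_
    · exact fun y hy => ⟨mem_univ _, hy.1.1.2⟩
    · exact fun y hy => ⟨hy.1.1.1, hy.2.1.1⟩
    · exact fun y hy => ⟨hy.2.1.2, mem_univ _⟩
    · intro y hy
      change coreOut (IQ := IQ) L b' (base B (collapse B hT (collarIn x₀ y)),
        fibre B b' (collapse B hT (collarIn x₀ y))) = _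
      rw [hpt y hy, base_collapse]
      rfl
  · have hne : ∀ y ∈ {y | y ∈ (chart B hT L (Sum.inr b)).dom ∩ halfProd d ∧
        (chart B hT L (Sum.inr b)).invFun y ∈ (chart B hT L (Sum.inl x₁)).source},
        (coreIn IQ L b y).2 ≠ 0 ∧
        height B (ofFibre B hT b (coreIn IQ L b y)) = T - ‖(coreIn IQ L b y).2‖ ^ 2 / 2 ∧
        point B (ofFibre B hT b (coreIn IQ L b y)) =
          B.param b (coreIn IQ L b y).1 (coreIn IQ L b y).2 := by
      intro y hy
      have h1 : coreIn IQ L b y ∈ fibreDom B T b := ⟨hy.1.1.2.1, hy.1.1.2.2.le⟩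
      have h2 : height B (ofFibre B hT b (coreIn IQ L b y)) < T := hy.2.1
      have h3 := height_ofFibre B hT h1
      have h4 := base_ofFibre B hT h1.1
      have h5 := fibre_ofFibre B hT h1
      refine ⟨fun h => ?_, h3, ?_⟩
      · rw [h3, h] at h2; simp at h2
      · have h6 := point_eq_param B (b := b) (by rw [h4]; exact h1.1) h2
        rwa [h4, h5] at h6
    refine ((contMDiffOn_collarOut x₁).comp ((contMDiffOn_polar_symm B (T := T) b).comp
      ((contMDiffOn_coreIn L b).mono ?_) ?_) ?_).congr ?_
    · exact fun y hy => hy.1.1.1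
    · exact fun y hy => ⟨hy.1.1.2.1, (hne y hy).1⟩
    · intro y hy
      refine ⟨mem_univ _, ?_⟩
      have h2 := hy.2.2
      change point B (ofFibre B hT b (coreIn IQ L b y)) ∈ (extChartAt (𝓡 d) x₁).source at h2
      rwa [(hne y hy).2.2] at h2
    · intro y hy
      change collarOut x₁ (height B (ofFibre B hT b (coreIn IQ L b y)),
        point B (ofFibre B hT b (coreIn IQ L b y))) = _
      rw [(hne y hy).2.1, (hne y hy).2.2]
      rfl
  · have hpt : ∀ y ∈ {y | y ∈ (chart B hT L (Sum.inr b)).dom ∩ halfProd d ∧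
        (chart B hT L (Sum.inr b)).invFun y ∈ (chart B hT L (Sum.inr b')).source},
        base B (ofFibre B hT b (coreIn IQ L b y)) = (coreIn IQ L b y).1 ∧
        fibre B b' (ofFibre B hT b (coreIn IQ L b y)) =
          B.trans b b' (coreIn IQ L b y).1 (coreIn IQ L b y).2 := by
      intro y hy
      have h1 : coreIn IQ L b y ∈ fibreDom B T b := ⟨hy.1.1.2.1, hy.1.1.2.2.le⟩
      have h4 := base_ofFibre B hT h1.1
      have h7 : base B (ofFibre B hT b (coreIn IQ L b y)) ∈ B.U b' := hy.2.1.1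
      refine ⟨h4, ?_⟩
      rw [fibre_trans B (b := b) (m := ofFibre B hT b (coreIn IQ L b y))
        (by rw [h4]; exact h1.1) h7, h4, fibre_ofFibre B hT h1]
    refine ((contMDiffOn_coreOut L b').comp ((contMDiffOn_transition B b b').comp
      ((contMDiffOn_coreIn L b).mono ?_) ?_) ?_).congr ?_
    · exact fun y hy => hy.1.1.1
    · intro y hy
      have h2 : base B (ofFibre B hT b (coreIn IQ L b y)) ∈ B.U b' := hy.2.1.1
      rw [(hpt y hy).1] at h2
      exact ⟨⟨hy.1.1.2.1, h2⟩, mem_univ _⟩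
    · intro y hy
      have h2 : base B (ofFibre B hT b (coreIn IQ L b y)) ∈ (extChartAt IQ b').source := hy.2.1.2
      rw [(hpt y hy).1] at h2
      exact ⟨h2, mem_univ _⟩
    · intro y hy
      change coreOut (IQ := IQ) L b' (base B (ofFibre B hT b (coreIn IQ L b y)),
        fibre B b' (ofFibre B hT b (coreIn IQ L b y))) = _
      rw [(hpt y hy).1, (hpt y hy).2]
      rfl

end Charts

end Collapse

end SphereBundle

/-! ### The smooth structure of the disc bundle -/

namespace SphereBundle

namespace Collapse

section SmoothStructure

variable {d : ℕ} {P : Type*} [TopologicalSpace P] [ChartedSpace (EuclideanSpace ℝ (Fin d)) P]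
  {EQ : Type*} [NormedAddCommGroup EQ] [NormedSpace ℝ EQ] {HQ : Type*} [TopologicalSpace HQ]
  {IQ : ModelWithCorners ℝ EQ HQ} {Q : Type*} [TopologicalSpace Q] [ChartedSpace HQ Q]
  {C : Type*} [NormedAddCommGroup C] [InnerProductSpace ℝ C]
  (B : SphereBundle d P IQ Q C) {T : ℝ}

lemma height_eq {b : Q} {m : B.Collapse T} (hm : base B m ∈ B.U b) :
    height B m = T - ‖fibre B b m‖ ^ 2 / 2 := by
  rw [norm_fibre_sq B hm]; ring

variable [hT : Fact (0 < T)]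

/-- The collapsing map from `ℝ × P` to the disc bundle, the polar coordinates of the disc bundle. -/
abbrev ofPolar : ℝ × P → B.Collapse T := collapse B hT.out.le

lemma ofPolar_image_Ico : ofPolar B '' (Ico 0 T ×ˢ univ) = {m : B.Collapse T | height B m < T} := by
  ext m
  constructor
  · rintro ⟨⟨s, x⟩, hs, rfl⟩
    rw [mem_ofPred_eq, height_collapse B hT.out.le (Ico_subset_Icc_self hs.1)]
    exact hs.1.2
  · intro hm
    exact ⟨(height B m, point B m), ⟨⟨(height_mem B m).1, hm⟩, mem_univ _⟩,
      collapse_height_point B hT.out.le hm⟩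

lemma dense_ofPolar_image_Ioo : Dense (ofPolar B (T := T) '' (Ioo 0 T ×ˢ univ)) := by
  intro m
  obtain ⟨⟨s, x⟩, rfl⟩ := mk_surjective B m
  have h1 : mk B (s, x) = ofPolar B ((s : ℝ), x) := by simp [ofPolar, collapse]
  rw [h1]
  have h2 : ((s : ℝ), x) ∈ closure (Ioo 0 T ×ˢ (univ : Set P)) := by
    rw [closure_prod_eq, closure_Ioo hT.out.ne, closure_univ]
    exact ⟨s.2, mem_univ _⟩
  exact map_mem_closure (continuous_collapse B hT.out.le) h2 (mapsTo_image _ _)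

lemma ofFibre_trans {b b' : Q} {y : Q × C} (hy : y ∈ fibreDom B T b) (hy' : y.1 ∈ B.U b') :
    ofFibre B hT.out.le b y = ofFibre B hT.out.le b' (y.1, B.trans b b' y.1 y.2) := by
  have h1 := base_ofFibre B hT.out.le hy.1
  have h2 := fibre_ofFibre B hT.out.le hy
  have h3 : base B (ofFibre B hT.out.le b y) ∈ B.U b' := by rwa [h1]
  have h4 := ofFibre_base_fibre B hT.out.le h3
  rwa [fibre_trans B (b := b) (by rw [h1]; exact hy.1) h3, h1, h2, eq_comm] at h4

/-- The zero section. -/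
def zeroSection (q : Q) : B.Collapse T := ofFibre B hT.out.le q (q, 0)

lemma zero_mem_fibreDom (b : Q) {q : Q} (hq : q ∈ B.U b) : (q, (0 : C)) ∈ fibreDom B T b :=
  ⟨hq, by have := hT.out; simp [this.le]⟩

lemma base_zeroSection (q : Q) : base B (zeroSection B (T := T) q) = q :=
  base_ofFibre B hT.out.le (B.mem_U q)

lemma height_zeroSection (q : Q) : height B (zeroSection B (T := T) q) = T := by
  rw [zeroSection, height_ofFibre B hT.out.le (zero_mem_fibreDom B q (B.mem_U q))]
  simp

lemma injective_zeroSection : Function.Injective (zeroSection B (T := T)) :=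
  Function.LeftInverse.injective (base_zeroSection B)

lemma range_zeroSection : range (zeroSection B (T := T)) = {m | height B m < T}ᶜ := by
  ext m
  constructor
  · rintro ⟨q, rfl⟩
    rw [mem_compl_iff, mem_ofPred_eq, height_zeroSection]
    exact lt_irrefl T
  · intro hm
    refine ⟨base B m, eq_of_height_eq B (height_zeroSection B _) ?_ (base_zeroSection B _)⟩
    exact le_antisymm (height_mem B m).2 (not_lt.1 hm)

lemma ofPolar_eq_zeroSection (x : P) : ofPolar B (T, x) = zeroSection B (T := T) (B.proj x) :=
  eq_of_height_eq B (height_collapse B hT.out.le ⟨hT.out.le, le_rfl⟩ x) (height_zeroSection B _)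
    (by rw [base_zeroSection, base_collapse])

variable [IQ.Boundaryless] [IsManifold IQ ∞ Q] [CompactSpace P] [T2Space Q]

/-- The preferred charts are those of `[0, T) × P` for `s < T`, and those around the zero section
for `s = T`. -/
instance : ChartedSpace (EuclideanHalfSpace (d + 1)) (B.Collapse T) :=
  HalfSpaceChart.chartedSpace (chart B hT.out.le B.model) (chartIndex B)
    (mem_chart_source B hT.out.le B.model hT.out)

lemma chart_mem_atlas (i : P ⊕ Q) :
    (chart B hT.out.le B.model i).toOpenPartialHomeomorph ∈
      atlas (EuclideanHalfSpace (d + 1)) (B.Collapse T) :=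
  mem_range_self i

lemma boundary_eq : (𝓡∂ (d + 1)).boundary (B.Collapse T) = ofPolar B '' ({0} ×ˢ univ) := by
  ext m
  have h0 : m ∈ (𝓡∂ (d + 1)).boundary (B.Collapse T) ↔
      ((chart B hT.out.le B.model (chartIndex B m)).toFun m).1 = 0 :=
    HalfSpaceChart.isBoundaryPoint_iff _ _ _ m
  rw [h0]
  rcases (height_mem B m).2.lt_or_eq with h | h
  · rw [chartIndex_of_lt B h]
    change height B m = 0 ↔ _
    constructor
    · intro h1
      refine ⟨(0, point B m), by simp, ?_⟩
      rw [← h1]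
      exact collapse_height_point B hT.out.le h
    · rintro ⟨⟨s, x⟩, ⟨rfl : s = 0, -⟩, rfl⟩
      exact height_collapse B hT.out.le ⟨le_rfl, hT.out.le⟩ x
  · rw [chartIndex_of_eq B h]
    refine iff_of_false (Real.exp_ne_zero _) ?_
    rintro ⟨⟨s, x⟩, ⟨rfl : s = 0, -⟩, rfl⟩
    rw [height_collapse B hT.out.le ⟨le_rfl, hT.out.le⟩] at h
    exact hT.out.ne h

variable [IsManifold (𝓡 d) ∞ P]

instance : IsManifold (𝓡∂ (d + 1)) ∞ (B.Collapse T) :=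
  HalfSpaceChart.isManifold _ _ _ (contDiffOn_chart_transition B hT.out.le B.model)

lemma contMDiffOn_height_point :
    ContMDiffOn (𝓡∂ (d + 1)) (𝓘(ℝ, ℝ).prod (𝓡 d)) ∞
      (fun m : B.Collapse T => (height B m, point B m)) {m | height B m < T} := by
  intro m hm
  have h1 := (chart B hT.out.le B.model (Sum.inl (point B m))).contMDiffOn_toFun
    (chart_mem_atlas B _)
  have hs : (chart B hT.out.le B.model (Sum.inl (point B m))).source ∈ 𝓝 m :=
    (HalfSpaceChart.open_source _).mem_nhds ⟨hm, mem_extChartAt_source _⟩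
  have h2 := (contMDiffOn_collarIn (d := d) (point B m)).comp h1 fun m' hm' =>
    ⟨mem_univ _, (extChartAt (𝓡 d) (point B m)).map_source hm'.2⟩
  refine ((h2.congr fun m' hm' => ?_).contMDiffAt hs).contMDiffWithinAt
  exact Prod.ext rfl ((extChartAt (𝓡 d) (point B m)).left_inv hm'.2).symm

/-- The projection and the coordinate in the fibre are smooth. For `s < T` this is seen in polar
coordinates, and for `s = T` in the charts around the zero section. -/
lemma contMDiffOn_base_fibre (b : Q) :
    ContMDiffOn (𝓡∂ (d + 1)) (IQ.prod 𝓘(ℝ, C)) ∞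
      (fun m : B.Collapse T => (base B m, fibre B b m)) (base B ⁻¹' B.U b) := by
  intro m hm
  rcases (height_mem B m).2.lt_or_eq with h | h
  · have h0 : ∀ m' ∈ {m | height B m < T} ∩ base B ⁻¹' B.U b, (height B m', point B m') ∈
        {y : ℝ × P | y.1 < T ∧ B.proj y.2 ∈ B.U b} := fun m' hm' =>
      ⟨hm'.1, by rw [proj_point B hm'.1]; exact hm'.2⟩
    have h1 := (contMDiffOn_polar B b (T := T)).comp
      ((contMDiffOn_height_point B (T := T)).mono inter_subset_left) h0
    refine ((h1.congr fun m' hm' => ?_).contMDiffAt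
      (((isOpen_height_lt B).inter (isOpen_base_preimage B b)).mem_nhds ⟨h, hm⟩)).contMDiffWithinAt
    have h2 := fibre_collapse B hT.out.le b (height_mem B m') (point B m')
    rw [collapse_height_point B hT.out.le hm'.1] at h2
    rw [h2, ← proj_point B hm'.1]
    rfl
  · set b' := base B m with hb'
    set c := chart B hT.out.le B.model (Sum.inr b') with hc
    have hs : c.source ∩ base B ⁻¹' B.U b ∈ 𝓝 m :=
      ((c.open_source).inter (isOpen_base_preimage B b)).mem_nhds
        ⟨⟨⟨B.mem_U _, mem_extChartAt_source _⟩, by rw [h]; exact hT.out⟩, hm⟩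
    have h0 : MapsTo c.toFun (c.source ∩ base B ⁻¹' B.U b) (coreTarget IQ B.model b') :=
      fun m' hm' => coreOut_mem B.model hm'.1.1.2
    have h1 := (contMDiffOn_coreIn (IQ := IQ) B.model b').comp
      ((c.contMDiffOn_toFun (chart_mem_atlas B _)).mono inter_subset_left) h0
    have h3 : ∀ m' ∈ c.source ∩ base B ⁻¹' B.U b,
        coreIn IQ B.model b' (c.toFun m') = (base B m', fibre B b' m') :=
      fun m' hm' => coreIn_coreOut B.model hm'.1.1.2
    have h4 : MapsTo (coreIn IQ B.model b' ∘ c.toFun) (c.source ∩ base B ⁻¹' B.U b)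
        ((B.U b' ∩ B.U b) ×ˢ univ) := fun m' hm' => by
      rw [Function.comp_apply, h3 m' hm']
      exact ⟨⟨hm'.1.1.1, hm'.2⟩, mem_univ _⟩
    have h2 := (contMDiffOn_transition B b' b).comp h1 h4
    refine ((h2.congr fun m' hm' => ?_).contMDiffAt hs).contMDiffWithinAt
    rw [Function.comp_apply, Function.comp_apply, h3 m' hm', fibre_trans B hm'.1.1.1 hm'.2]

lemma contMDiffOn_fibre (b : Q) : ContMDiffOn (𝓡∂ (d + 1)) 𝓘(ℝ, C) ∞
    (fibre B (T := T) b) (base B ⁻¹' B.U b) :=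
  contMDiff_snd.comp_contMDiffOn (contMDiffOn_base_fibre B b)

lemma contMDiff_base : ContMDiff (𝓡∂ (d + 1)) IQ ∞ (base B (T := T)) := fun m =>
  (contMDiff_fst.comp_contMDiffOn (contMDiffOn_base_fibre B (base B m))).contMDiffAt
    ((isOpen_base_preimage B _).mem_nhds (B.mem_U _))

lemma contMDiff_height : ContMDiff (𝓡∂ (d + 1)) 𝓘(ℝ, ℝ) ∞ (height B (T := T)) := fun m => by
  have h1 : ContDiff ℝ ∞ (fun ζ : C => T - ‖ζ‖ ^ 2 / 2) :=
    contDiff_const.sub ((contDiff_norm_sq ℝ).div_const 2)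
  refine ((h1.contMDiff.comp_contMDiffOn (contMDiffOn_fibre B (base B m))).congr
    fun m' hm' => height_eq B hm').contMDiffAt
    ((isOpen_base_preimage B _).mem_nhds (B.mem_U _))

lemma contMDiffOn_ofPolar :
    ContMDiffOn (𝓘(ℝ, ℝ).prod (𝓡 d)) (𝓡∂ (d + 1)) ∞ (ofPolar B (T := T)) (Ico 0 T ×ˢ univ) := by
  rintro ⟨s, x⟩ hs
  set c := chart B hT.out.le B.model (Sum.inl x) with hc
  have hU : univ ×ˢ (extChartAt (𝓡 d) x).source ∈ 𝓝 (s, x) :=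
    (isOpen_univ.prod (isOpen_extChartAt_source x)).mem_nhds ⟨mem_univ _, mem_extChartAt_source x⟩
  have h0 : MapsTo (collarOut (d := d) x) ((Ico 0 T ×ˢ univ) ∩ univ ×ˢ (extChartAt (𝓡 d) x).source)
      (c.dom ∩ halfProd d) :=
    fun y hy => ⟨⟨hy.1.1.2, (extChartAt (𝓡 d) x).map_source hy.2.2⟩, hy.1.1.1⟩
  have h1 := (c.contMDiffOn_invFun (chart_mem_atlas B _)).comp
    ((contMDiffOn_collarOut x).mono inter_subset_right) h0
  refine ((h1.congr fun y hy => ?_) (s, x) ⟨hs, mem_of_mem_nhds hU⟩).mono_of_mem_nhdsWithin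
    (Filter.inter_mem self_mem_nhdsWithin (nhdsWithin_le_nhds hU))
  change _ = collapse B hT.out.le (y.1, (extChartAt (𝓡 d) x).symm (extChartAt (𝓡 d) x y.2))
  rw [(extChartAt (𝓡 d) x).left_inv hy.2.2]

lemma contMDiffOn_ofFibre (b : Q) :
    ContMDiffOn (IQ.prod 𝓘(ℝ, C)) (𝓡∂ (d + 1)) ∞ (ofFibre B hT.out.le b) (fibreDom B T b) := by
  rintro ⟨q, ζ⟩ hy
  by_cases h : ζ = 0
  · set c := chart B hT.out.le B.model (Sum.inr q) with hc
    set s : Set (Q × C) := {y | y.1 ∈ B.U q ∩ (extChartAt IQ q).source ∧ ‖y.2‖ ^ 2 < 2 * T} with hs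
    have h1 : ∀ y ∈ s, coreIn IQ B.model q (coreOut (IQ := IQ) B.model q y) = y :=
      fun y hy => coreIn_coreOut B.model hy.1.2
    have h0 : MapsTo (coreOut (IQ := IQ) B.model q) s (c.dom ∩ halfProd d) :=
      fun y hy => ⟨⟨coreOut_mem B.model hy.1.2, by
        rw [mem_preimage, h1 y hy]; exact ⟨hy.1.1, hy.2⟩⟩, (Real.exp_pos _).le⟩
    have hss : s ⊆ (extChartAt IQ q).source ×ˢ univ := fun y hy => ⟨hy.1.2, mem_univ _⟩
    have h2 := (c.contMDiffOn_invFun (chart_mem_atlas B _)).comp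
      ((contMDiffOn_coreOut B.model q).mono hss) h0
    have h3 : ContMDiffOn (IQ.prod 𝓘(ℝ, C)) (𝓡∂ (d + 1)) ∞ (ofFibre B hT.out.le q) s := by
      refine h2.congr fun y hy => ?_
      change _ = ofFibre B hT.out.le q (coreIn IQ B.model q (coreOut (IQ := IQ) B.model q y))
      rw [h1 y hy]
    have hso : IsOpen s := (((B.isOpen_U q).inter (isOpen_extChartAt_source q)).preimage
      continuous_fst).inter (isOpen_Iio.preimage (by fun_prop : Continuous fun y : Q × C =>
        ‖y.2‖ ^ 2))
    have hW : (B.U b ∩ B.U q) ×ˢ (univ : Set C) ∈ 𝓝 (q, ζ) :=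
      (((B.isOpen_U b).inter (B.isOpen_U q)).prod isOpen_univ).mem_nhds
        ⟨⟨hy.1, B.mem_U q⟩, mem_univ _⟩
    have h4 := (contMDiffOn_transition B b q).contMDiffAt hW
    have h5 : ContMDiffAt (IQ.prod 𝓘(ℝ, C)) (𝓡∂ (d + 1)) ∞ (ofFibre B hT.out.le q)
        ((fun y : Q × C => (y.1, B.trans b q y.1 y.2)) (q, ζ)) := by
      refine h3.contMDiffAt (hso.mem_nhds ⟨⟨B.mem_U q, mem_extChartAt_source q⟩, ?_⟩)
      simp only [h, map_zero, norm_zero]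
      have := hT.out
      norm_num [this]
    refine (h5.comp (q, ζ) h4).contMDiffWithinAt.congr_of_eventuallyEq ?_ ?_
    · filter_upwards [self_mem_nhdsWithin, nhdsWithin_le_nhds hW] with y hy1 hy2
      exact ofFibre_trans B hy1 hy2.1.2
    · exact ofFibre_trans B hy (B.mem_U q)
  · have h1 : ContMDiffOn (IQ.prod 𝓘(ℝ, C)) (𝓡∂ (d + 1)) ∞
        (fun y : Q × C => collapse B hT.out.le (T - ‖y.2‖ ^ 2 / 2, B.param b y.1 y.2))
        (fibreDom B T b ∩ {y | y.2 ≠ 0}) := by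
      refine (contMDiffOn_ofPolar B (T := T)).comp ((contMDiffOn_polar_symm B b (T := T)).mono
        fun y hy => ⟨hy.1.1, hy.2⟩) fun y hy => ⟨⟨(fibreDom_mem_Icc hy.1).1, ?_⟩, mem_univ _⟩
      have : 0 < ‖y.2‖ := norm_pos_iff.2 hy.2
      exact sub_lt_self _ (by positivity)
    have hne : {y : Q × C | y.2 ≠ 0} ∈ 𝓝 (q, ζ) := continuous_snd.continuousAt.eventually_ne h
    refine ((h1.congr fun y hy => ?_) (q, ζ) ⟨hy, h⟩).mono_of_mem_nhdsWithin
      (Filter.inter_mem self_mem_nhdsWithin (nhdsWithin_le_nhds hne))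
    rw [ofFibre, if_neg hy.2]

/-- The disc bundle is immersed by its projection to `Q` and the coordinate in the fibres. -/
lemma eq_zero_of_mfderiv_base_fibre {b : Q} {m : B.Collapse T} (hm : base B m ∈ B.U b)
    {u : TangentSpace (𝓡∂ (d + 1)) m} (h1 : mfderiv (𝓡∂ (d + 1)) IQ (base B) m u = 0)
    (h2 : mfderiv (𝓡∂ (d + 1)) 𝓘(ℝ, C) (fibre B b) m u = 0) : u = 0 := by
  have hF : HasMFDerivAt (𝓡∂ (d + 1)) (IQ.prod 𝓘(ℝ, C)) (fun m => (base B m, fibre B b m)) m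
      ((mfderiv (𝓡∂ (d + 1)) IQ (base B) m).prod
        (mfderiv (𝓡∂ (d + 1)) 𝓘(ℝ, C) (fibre B b) m)) :=
    ((contMDiff_base B m).mdifferentiableAt (by simp)).hasMFDerivAt.prodMk
      (((contMDiffOn_fibre B b).contMDiffAt
        ((isOpen_base_preimage B b).mem_nhds hm)).mdifferentiableAt (by simp)).hasMFDerivAt
  have hG := ((contMDiffOn_ofFibre B (T := T) b _ (mem_fibreDom B hm)).mdifferentiableWithinAt
    (by simp)).hasMFDerivWithinAt
  have h0 : base B ⁻¹' B.U b ⊆ (fun m => (base B m, fibre B b m)) ⁻¹' fibreDom B T b :=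
    fun m' hm' => mem_fibreDom B hm'
  have h3 := hG.comp m (hF.hasMFDerivWithinAt (s := base B ⁻¹' B.U b)) h0
  have h4 := (h3.hasMFDerivAt ((isOpen_base_preimage B b).mem_nhds hm)).congr_of_eventuallyEq
    (f₁ := id) (Filter.eventuallyEq_of_mem ((isOpen_base_preimage B b).mem_nhds hm)
      fun m' hm' => (ofFibre_base_fibre B hT.out.le hm').symm)
  have h5 := hasMFDerivAt_unique h4 (hasMFDerivAt_id m)
  have h6 := congrArg (fun f : EuclideanSpace ℝ (Fin (d + 1)) →L[ℝ] EuclideanSpace ℝ (Fin (d + 1)) =>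
    f u) h5
  let D : EQ × C →L[ℝ] EuclideanSpace ℝ (Fin (d + 1)) :=
    mfderivWithin (IQ.prod 𝓘(ℝ, C)) (𝓡∂ (d + 1)) (ofFibre B hT.out.le b) (fibreDom B T b)
      (base B m, fibre B b m)
  have h7 : ((mfderiv (𝓡∂ (d + 1)) IQ (base B) m u : EQ),
      (mfderiv (𝓡∂ (d + 1)) 𝓘(ℝ, C) (fibre B b) m u : C)) = 0 := Prod.ext h1 h2
  exact h6.symm.trans ((congrArg D h7).trans D.map_zero)

lemma contMDiff_zeroSection : ContMDiff IQ (𝓡∂ (d + 1)) ∞ (zeroSection B (T := T)) := fun q => by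
  have h1 : ContMDiff IQ (IQ.prod 𝓘(ℝ, C)) ∞ (fun q : Q => (q, (0 : C))) :=
    contMDiff_id.prodMk contMDiff_const
  refine (((contMDiffOn_ofFibre B q).comp h1.contMDiffOn
    (s := B.U q) fun q' hq' => zero_mem_fibreDom B q hq').congr fun q' hq' => ?_).contMDiffAt
    ((B.isOpen_U q).mem_nhds (B.mem_U q))
  simp [zeroSection, ofFibre]

lemma injective_mfderiv_zeroSection (q : Q) :
    Function.Injective (mfderiv IQ (𝓡∂ (d + 1)) (zeroSection B (T := T)) q) := by
  have h1 := ((contMDiff_base B (zeroSection B (T := T) q)).mdifferentiableAt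
    (by simp)).hasMFDerivAt.comp q
    ((contMDiff_zeroSection B (T := T) q).mdifferentiableAt (by simp)).hasMFDerivAt
  have h2 : base B ∘ zeroSection B (T := T) = id := funext (base_zeroSection B)
  rw [h2] at h1
  have h3 := hasMFDerivAt_unique h1 (hasMFDerivAt_id q)
  intro u v huv
  have h4 := congrArg (fun f : EQ →L[ℝ] EQ => f u) h3
  have h5 := congrArg (fun f : EQ →L[ℝ] EQ => f v) h3
  refine h4.symm.trans (Eq.trans ?_ h5)
  exact congrArg (mfderiv (𝓡∂ (d + 1)) IQ (base B) (zeroSection B q)) huv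

lemma contMDiffAt_point {m : B.Collapse T} (hm : height B m < T) :
    ContMDiffAt (𝓡∂ (d + 1)) (𝓡 d) ∞ (point B) m :=
  (contMDiff_snd.comp_contMDiffOn (contMDiffOn_height_point B)).contMDiffAt
    ((isOpen_height_lt B).mem_nhds hm)

/-- The chain rule for the derivative of `ofPolar` within `[0, T) × P`. -/
lemma mfderiv_comp_ofPolar {s : ℝ} (hs : s ∈ Ico 0 T) (x : P)
    {E' H' N : Type*} [NormedAddCommGroup E'] [NormedSpace ℝ E'] [TopologicalSpace H']
    {I' : ModelWithCorners ℝ E' H'} [TopologicalSpace N] [ChartedSpace H' N]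
    {f : B.Collapse T → N} {g : ℝ × P → N}
    (hf : MDifferentiableAt (𝓡∂ (d + 1)) I' f (ofPolar B (s, x)))
    (hg : MDifferentiableAt (𝓘(ℝ, ℝ).prod (𝓡 d)) I' g (s, x))
    (hfg : ∀ y ∈ Ico 0 T ×ˢ univ, f (ofPolar B y) = g y)
    (u : TangentSpace (𝓘(ℝ, ℝ).prod (𝓡 d)) ((s, x) : ℝ × P)) :
    mfderiv (𝓡∂ (d + 1)) I' f (ofPolar B (s, x))
      (mfderivWithin (𝓘(ℝ, ℝ).prod (𝓡 d)) (𝓡∂ (d + 1)) (ofPolar B) (Ico 0 T ×ˢ univ) (s, x) u)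
      = (mfderiv (𝓘(ℝ, ℝ).prod (𝓡 d)) I' g (s, x) u : E') := by
  have hU : UniqueMDiffWithinAt (𝓘(ℝ, ℝ).prod (𝓡 d)) (Ico 0 T ×ˢ (univ : Set P)) (s, x) :=
    ((uniqueDiffOn_Ico 0 T).uniqueMDiffOn s hs).prod (uniqueMDiffWithinAt_univ _)
  have h1 := hf.hasMFDerivAt.comp_hasMFDerivWithinAt (s, x)
    ((contMDiffOn_ofPolar B (s, x) ⟨hs, mem_univ _⟩).mdifferentiableWithinAt
      (by simp)).hasMFDerivWithinAt
  have h2 := hg.hasMFDerivAt.hasMFDerivWithinAt (s := Ico 0 T ×ˢ (univ : Set P))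
  have h3 := hU.eq h1 (h2.congr_of_eventuallyEq
    (Filter.eventuallyEq_of_mem self_mem_nhdsWithin hfg) (hfg _ ⟨hs, mem_univ _⟩))
  exact congrArg (fun f : ℝ × EuclideanSpace ℝ (Fin d) →L[ℝ] E' => f u) h3

lemma mfderiv_height_ofPolar {s : ℝ} (hs : s ∈ Ico 0 T) (x : P)
    (u : TangentSpace (𝓘(ℝ, ℝ).prod (𝓡 d)) ((s, x) : ℝ × P)) :
    mfderiv (𝓡∂ (d + 1)) 𝓘(ℝ, ℝ) (height B) (ofPolar B (T := T) (s, x))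
      (mfderivWithin (𝓘(ℝ, ℝ).prod (𝓡 d)) (𝓡∂ (d + 1)) (ofPolar B) (Ico 0 T ×ˢ univ) (s, x) u)
      = u.1 := by
  rw [mfderiv_comp_ofPolar B hs x ((contMDiff_height B _).mdifferentiableAt (by simp))
    mdifferentiableAt_fst fun y hy => height_collapse B hT.out.le (Ico_subset_Icc_self hy.1) y.2,
    mfderiv_fst]
  rfl

lemma mfderiv_point_ofPolar {s : ℝ} (hs : s ∈ Ico 0 T) (x : P)
    (u : TangentSpace (𝓘(ℝ, ℝ).prod (𝓡 d)) ((s, x) : ℝ × P)) :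
    mfderiv (𝓡∂ (d + 1)) (𝓡 d) (point B) (ofPolar B (T := T) (s, x))
      (mfderivWithin (𝓘(ℝ, ℝ).prod (𝓡 d)) (𝓡∂ (d + 1)) (ofPolar B) (Ico 0 T ×ˢ univ) (s, x) u)
      = u.2 := by
  have h1 : height B (ofPolar B (T := T) (s, x)) < T := by
    rw [height_collapse B hT.out.le (Ico_subset_Icc_self hs)]; exact hs.2
  rw [mfderiv_comp_ofPolar B hs x ((contMDiffAt_point B h1).mdifferentiableAt (by simp))
    mdifferentiableAt_snd fun y hy => point_collapse B hT.out.le hy.1 y.2, mfderiv_snd]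
  rfl

end SmoothStructure

end Collapse

end SphereBundle

/-! ### Differentials of vector-valued functions -/

section VecDeriv

variable {E : Type*} [NormedAddCommGroup E] [NormedSpace ℝ E] {H : Type*} [TopologicalSpace H]
  {I : ModelWithCorners ℝ E H} {M : Type*} [TopologicalSpace M] [ChartedSpace H M]
  {E' : Type*} [NormedAddCommGroup E'] [NormedSpace ℝ E'] {H' : Type*} [TopologicalSpace H']
  {I' : ModelWithCorners ℝ E' H'} {N : Type*} [TopologicalSpace N] [ChartedSpace H' N]
  {W : Type*} [NormedAddCommGroup W] [NormedSpace ℝ W]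

variable (I) in
/-- The differential of a vector-valued function, as a linear map on the model space, to which the
tangent spaces reduce. -/
def vecDeriv (f : M → W) (m : M) : E →L[ℝ] W := mfderiv I 𝓘(ℝ, W) f m

lemma vecDeriv_comp {f : N → W} {g : M → N} {m : M} (hf : MDifferentiableAt I' 𝓘(ℝ, W) f (g m))
    (hg : MDifferentiableAt I I' g m) (u : E) :
    vecDeriv I (fun m => f (g m)) m u = vecDeriv I' f (g m) (mfderiv I I' g m u) :=
  mfderiv_comp_apply m hf hg u

lemma Filter.EventuallyEq.vecDeriv_eq {f g : M → W} {m : M} (h : f =ᶠ[𝓝 m] g) :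
    vecDeriv I f m = vecDeriv I g m := h.mfderiv_eq

lemma vecDeriv_smul {r : M → ℝ} {f : M → W} {m : M} (hr : MDifferentiableAt I 𝓘(ℝ, ℝ) r m)
    (hf : MDifferentiableAt I 𝓘(ℝ, W) f m) (u : E) :
    vecDeriv I (fun m => r m • f m) m u = r m • vecDeriv I f m u + vecDeriv I r m u • f m := by
  have h : HasMFDerivAt I 𝓘(ℝ, W) (fun m => r m • f m) m
      (r m • vecDeriv I f m + (vecDeriv I r m).smulRight (f m) : E →L[ℝ] W) :=
    ⟨hr.hasMFDerivAt.1.smul hf.hasMFDerivAt.1, by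
      simpa only [mfld_simps] using! hr.hasMFDerivAt.2.fun_smul hf.hasMFDerivAt.2⟩
  exact congrArg (fun f : E →L[ℝ] W => f u) h.mfderiv

lemma vecDeriv_norm_sq {C : Type*} [NormedAddCommGroup C] [InnerProductSpace ℝ C] {f : M → C}
    {m : M} (hf : MDifferentiableAt I 𝓘(ℝ, C) f m) (u : E) :
    vecDeriv I (fun m => ‖f m‖ ^ 2) m u = 2 * ⟪f m, vecDeriv I f m u⟫_ℝ := by
  have h1 : HasFDerivAt (fun ζ : C => ‖ζ‖ ^ 2) (2 • innerSL ℝ (f m)) (f m) :=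
    hasStrictFDerivAt_norm_sq (f m) |>.hasFDerivAt
  have h2 := (h1.hasMFDerivAt.comp m hf.hasMFDerivAt).mfderiv
  have h3 := congrArg (fun f : E →L[ℝ] ℝ => f u) h2
  refine h3.trans ?_
  change (2 • innerSL ℝ (f m)) (vecDeriv I f m u) = _
  simp [two_mul]

lemma vecDeriv_comp_real {f : ℝ → ℝ} {f' : ℝ} {g : M → ℝ} {m : M} (hf : HasDerivAt f f' (g m))
    (hg : MDifferentiableAt I 𝓘(ℝ, ℝ) g m) (u : E) :
    vecDeriv I (fun m => f (g m)) m u = f' * vecDeriv I g m u := by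
  have h2 := (hf.hasFDerivAt.hasMFDerivAt.comp m hg.hasMFDerivAt).mfderiv
  refine (congrArg (fun f : E →L[ℝ] ℝ => f u) h2).trans ?_
  exact mul_comm (vecDeriv I g m u) f'

end VecDeriv

/-! ### Hermitian forms in polar coordinates -/

section LinearAlgebra

variable {C : Type*} [NormedAddCommGroup C] [InnerProductSpace ℝ C] {J : C →L[ℝ] C}

/-- The form `bf |Dζ|² + c₁ ⟪ζ, Dζ⟫² + c₂ ⟪Jζ, Dζ⟫²` in polar coordinates `ζ = ρ z`, `|z| = 1`, with
`Dζ = ρ dz + dρ z + e a J ζ`. Here `w`, `r`, `σ` and `a` are the values of `dz`, `dρ`, `-ρ dρ`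
(which is `ds` for `ρ² = 2 (T - s)`) and of the potential of the connection on a tangent vector. The result
is `ds² / (ρ² f) + ρ² f θ²` for `θ = e ⟪J z, dz⟫ + a`, plus `bf ρ²` times the horizontal part of the
round metric. -/
lemma polar_identity (hJ : ∀ x y, ⟪J x, J y⟫_ℝ = ⟪x, y⟫_ℝ) (hJ' : ∀ x, ⟪x, J x⟫_ℝ = 0)
    {z w w' : C} {ρ σ σ' r r' a a' e bf f c₁ c₂ : ℝ} (hz : ⟪z, z⟫_ℝ = 1) (hw : ⟪z, w⟫_ℝ = 0)
    (hw' : ⟪z, w'⟫_ℝ = 0) (hr : ρ * r = -σ) (hr' : ρ * r' = -σ') (hρ : 0 < ρ) (hf : f ≠ 0)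
    (hc₁ : ρ ^ 2 * c₁ = 1 / f - bf) (hc₂ : ρ ^ 2 * c₂ = f - bf) (he : e ^ 2 = 1) :
    bf * ⟪ρ • w + r • z + (e * a) • J (ρ • z), ρ • w' + r' • z + (e * a') • J (ρ • z)⟫_ℝ
      + c₁ * (⟪ρ • z, ρ • w + r • z + (e * a) • J (ρ • z)⟫_ℝ
        * ⟪ρ • z, ρ • w' + r' • z + (e * a') • J (ρ • z)⟫_ℝ)
      + c₂ * (⟪J (ρ • z), ρ • w + r • z + (e * a) • J (ρ • z)⟫_ℝ
        * ⟪J (ρ • z), ρ • w' + r' • z + (e * a') • J (ρ • z)⟫_ℝ)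
      = σ * σ' / (ρ ^ 2 * f) + ρ ^ 2 * f * ((e * ⟪J z, w⟫_ℝ + a) * (e * ⟪J z, w'⟫_ℝ + a'))
        + ρ ^ 2 / 2 * bf * (2 * (⟪w, w'⟫_ℝ - ⟪J z, w⟫_ℝ * ⟪J z, w'⟫_ℝ)) := by
  have h1 : ⟪w, z⟫_ℝ = 0 := by rw [real_inner_comm]; exact hw
  have h2 : ⟪w, J z⟫_ℝ = ⟪J z, w⟫_ℝ := real_inner_comm _ _
  have h3 : ⟪J z, z⟫_ℝ = 0 := by rw [real_inner_comm]; exact hJ' z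
  have h4 := hJ' z
  have h5 : ⟪J z, J z⟫_ℝ = 1 := by rw [hJ, hz]
  have hr1 : r = -σ / ρ := by field_simp; linarith
  have hr2 : r' = -σ' / ρ := by field_simp; linarith
  have hc1 : c₁ = (1 / f - bf) / ρ ^ 2 := by field_simp; field_simp at hc₁; linarith
  have hc2 : c₂ = (f - bf) / ρ ^ 2 := by field_simp; linarith
  simp only [map_smul, inner_add_left, inner_add_right, real_inner_smul_left,
    real_inner_smul_right, hz, hw, hw', h1, h2, h3, h4, h5]
  rw [hr1, hr2, hc1, hc2]
  field_simp
  ring_nf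
  simp only [he]
  ring

/-- The form on the fibres of the disc bundle is positive. For `ζ ≠ 0`, its eigenvalues are `1 / f`
on `ζ`, `f` on `J ζ`, and `bf` on the orthogonal complement. -/
lemma fibre_form_pos (hJ : ∀ x y, ⟪J x, J y⟫_ℝ = ⟪x, y⟫_ℝ) (hJ' : ∀ x, ⟪x, J x⟫_ℝ = 0)
    {ζ x : C} {bf f c₁ c₂ : ℝ} (hbf : 0 < bf) (hf : 0 < f)
    (hc₁ : ‖ζ‖ ^ 2 * c₁ = 1 / f - bf) (hc₂ : ‖ζ‖ ^ 2 * c₂ = f - bf) (hx : x ≠ 0) :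
    0 < bf * ⟪x, x⟫_ℝ + c₁ * (⟪ζ, x⟫_ℝ * ⟪ζ, x⟫_ℝ) + c₂ * (⟪J ζ, x⟫_ℝ * ⟪J ζ, x⟫_ℝ) := by
  have hxx : 0 < ⟪x, x⟫_ℝ := real_inner_self_pos.2 hx
  by_cases h0 : ζ = 0
  · subst h0
    simp only [map_zero, inner_zero_left, mul_zero, add_zero]
    positivity
  have hζ : 0 < ‖ζ‖ ^ 2 := by have := norm_pos_iff.2 h0; positivity
  set ρ := ‖ζ‖ ^ 2 with hρ
  set l := ⟪ζ, x⟫_ℝ with hl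
  set m := ⟪J ζ, x⟫_ℝ with hm
  have hzz : ⟪ζ, ζ⟫_ℝ = ρ := real_inner_self_eq_norm_sq ζ
  -- Bessel's inequality for the orthogonal vectors `ζ` and `J ζ`
  have hB : l ^ 2 + m ^ 2 ≤ ρ * ⟪x, x⟫_ℝ := by
    have h1 : 0 ≤ ⟪ρ • x - l • ζ - m • J ζ, ρ • x - l • ζ - m • J ζ⟫_ℝ := real_inner_self_nonneg
    have h2 : ⟪x, ζ⟫_ℝ = l := real_inner_comm _ _
    have h3 : ⟪x, J ζ⟫_ℝ = m := real_inner_comm _ _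
    have h4 : ⟪J ζ, ζ⟫_ℝ = 0 := by rw [real_inner_comm]; exact hJ' ζ
    have h5 : ⟪J ζ, J ζ⟫_ℝ = ρ := by rw [hJ, hzz]
    simp only [inner_sub_left, inner_sub_right, real_inner_smul_left, real_inner_smul_right, h2, h3,
      h4, h5, hJ', hzz, ← hl, ← hm] at h1
    have h6 : 0 ≤ ρ * (ρ * ⟪x, x⟫_ℝ - (l ^ 2 + m ^ 2)) := by linarith
    linarith [nonneg_of_mul_nonneg_right h6 hζ]
  have key : 0 < ρ * (bf * ⟪x, x⟫_ℝ + c₁ * (l * l) + c₂ * (m * m)) := by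
    have h1 : ρ * (bf * ⟪x, x⟫_ℝ + c₁ * (l * l) + c₂ * (m * m)) =
        bf * (ρ * ⟪x, x⟫_ℝ - (l ^ 2 + m ^ 2)) + (1 / f * l ^ 2 + f * m ^ 2) := by
      linear_combination l ^ 2 * hc₁ + m ^ 2 * hc₂
    rw [h1]
    by_cases h2 : l ^ 2 + m ^ 2 = 0
    · have h3 : 0 ≤ 1 / f * l ^ 2 + f * m ^ 2 := by positivity
      have h4 : 0 < bf * (ρ * ⟪x, x⟫_ℝ) := by positivity
      rw [h2, sub_zero]; linarith
    · have h3 : 0 < 1 / f * l ^ 2 + f * m ^ 2 := by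
        by_cases hl0 : l = 0
        · have hm0 : m ≠ 0 := by rintro h; exact h2 (by rw [hl0, h]; norm_num)
          have : 0 < m ^ 2 := by positivity
          have : 0 < f * m ^ 2 := by positivity
          have : 0 ≤ 1 / f * l ^ 2 := by positivity
          linarith
        · have : 0 < 1 / f * l ^ 2 := by positivity
          have : 0 ≤ f * m ^ 2 := by positivity
          linarith
      have h4 : 0 ≤ bf * (ρ * ⟪x, x⟫_ℝ - (l ^ 2 + m ^ 2)) :=
        mul_nonneg hbf.le (by linarith)
      linarith
  exact pos_of_mul_pos_right key hζ.le

end LinearAlgebra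

/-! ### The metric on the disc bundle -/

section PullBack

variable {E : Type*} [NormedAddCommGroup E] [NormedSpace ℝ E] {H : Type*} [TopologicalSpace H]
  {I : ModelWithCorners ℝ E H} {M : Type*} [TopologicalSpace M] [ChartedSpace H M]
  {E' : Type*} [NormedAddCommGroup E'] [NormedSpace ℝ E'] {H' : Type*} [TopologicalSpace H']
  {I' : ModelWithCorners ℝ E' H'} {N : Type*} [TopologicalSpace N] [ChartedSpace H' N]

variable (I) in
/-- The pull-back of a one-form, as a linear map on the model space. -/
def OneForm.pullback (θ : OneForm I' N) (φ : M → N) (m : M) : E →L[ℝ] ℝ :=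
  let t : E' →L[ℝ] ℝ := θ (φ m)
  let D : E →L[ℝ] E' := mfderiv I I' φ m
  t.comp D

variable (I) in
/-- The pull-back of a metric, as a bilinear map on the model space. -/
def SmoothMetric.pullback [IsManifold I' ∞ N] (h : SmoothMetric I' N) (φ : M → N) (m : M) :
    E →L[ℝ] E →L[ℝ] ℝ :=
  let t : E' →L[ℝ] E' →L[ℝ] ℝ := h.inner (φ m)
  let D : E →L[ℝ] E' := mfderiv I I' φ m
  t.bilinearComp D D

/-- The pull-back of the inner product of `C` by a linear map. -/
def innerPullback {C : Type*} [NormedAddCommGroup C] [InnerProductSpace ℝ C] (D : E →L[ℝ] C) :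
    E →L[ℝ] E →L[ℝ] ℝ :=
  ((isBoundedBilinearMap_inner (𝕜 := ℝ) (E := C)).toContinuousLinearMap).bilinearComp D D

lemma OneForm.pullback_congr (θ : OneForm I' N) {φ ψ : M → N} {m : M} (h : φ =ᶠ[𝓝 m] ψ) :
    θ.pullback I φ m = θ.pullback I ψ m := by
  let t : N → E' →L[ℝ] ℝ := fun n => θ n
  have h1 : t (φ m) = t (ψ m) := congrArg t h.eq_of_nhds
  have h2 : (mfderiv I I' φ m : E →L[ℝ] E') = mfderiv I I' ψ m := h.mfderiv_eq
  exact congrArg₂ ContinuousLinearMap.comp h1 h2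

lemma exists_constField_eq [IsManifold I ∞ M] (m₀ : M) (u : TangentSpace I m₀) :
    ∃ a : E, constField I m₀ a m₀ = u :=
  ⟨_, (trivializationAt E (TangentSpace I : M → Type _) m₀).symmL_continuousLinearMapAt
    (mem_baseSet_trivializationAt E (TangentSpace I : M → Type _) m₀) u⟩

end PullBack

section CollapseMetric

variable {k d : ℕ} {a : Fin k → ℕ} {W : Fin k → Type*} {P C : Type*}
  [∀ j, TopologicalSpace (W j)] [∀ j, ChartedSpace (EuclideanSpace ℝ (Fin (a j))) (W j)]
  [∀ j, IsManifold (𝓡 (a j)) ∞ (W j)]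
  [TopologicalSpace P] [ChartedSpace (EuclideanSpace ℝ (Fin d)) P]
  [NormedAddCommGroup C] [InnerProductSpace ℝ C]

/-- The geometry of a sphere bundle `P` over `∏ W j`: metrics on the factors of the base, a complex
structure `J` on the fibre `C`, a connection form `θ` and a symmetric form `fibreForm` on `P`.
Over `U c`, the connection is given by the potential `∑ weight j • (sec c j)^* form j` on the base,
and `fibreForm` is twice the horizontal part of the round metric of the sphere. The weight of the
connection on the fibre is `sign = ±1`. -/
structure SphereBundle.Geometry
    (B : SphereBundle d P (ModelWithCorners.pi fun j => 𝓡 (a j)) (∀ j, W j) C)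
    (b : Fin k → ℕ) (Λ : Fin k → Type*) [∀ j, TopologicalSpace (Λ j)]
    [∀ j, ChartedSpace (EuclideanSpace ℝ (Fin (b j))) (Λ j)]
    [∀ j, IsManifold (𝓡 (b j)) ∞ (Λ j)] where
  J : C →L[ℝ] C
  inner_J : ∀ x y, ⟪J x, J y⟫_ℝ = ⟪x, y⟫_ℝ
  inner_self_J : ∀ x, ⟪x, J x⟫_ℝ = 0
  metric : ∀ j, SmoothMetric (𝓡 (a j)) (W j)
  form : ∀ j, OneForm (𝓡 (b j)) (Λ j)
  contMDiff_form : ∀ j, ContMDiff (𝓡 (b j)) ((𝓡 (b j)).prod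
    𝓘(ℝ, EuclideanSpace ℝ (Fin (b j)) →L[ℝ] ℝ)) ∞
    (fun x => (TotalSpace.mk' (EuclideanSpace ℝ (Fin (b j)) →L[ℝ] ℝ) x (form j x) :
      TotalSpace (EuclideanSpace ℝ (Fin (b j)) →L[ℝ] ℝ)
        (fun x : Λ j => TangentSpace (𝓡 (b j)) x →L[ℝ] ℝ)))
  weight : Fin k → ℝ
  sec : (∀ j, W j) → ∀ j, W j → Λ j
  contMDiffAt_sec : ∀ c, ∀ q ∈ B.U c, ∀ j, ContMDiffAt (𝓡 (a j)) (𝓡 (b j)) ∞ (sec c j) (q j)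
  sign : ℝ
  sign_sq : sign ^ 2 = 1
  θ : OneForm (𝓡 d) P
  fibreForm : ∀ x : P, TangentSpace (𝓡 d) x → TangentSpace (𝓡 d) x → ℝ
  θ_apply : ∀ c x, B.proj x ∈ B.U c → ∀ u : TangentSpace (𝓡 d) x,
    θ x u = sign * ⟪J (B.coord c x), vecDeriv (𝓡 d) (B.coord c) x u⟫_ℝ +
      ∑ j, weight j * form j (sec c j (B.proj x j))
        (mfderiv (𝓡 d) (𝓡 (b j)) (fun y => sec c j (B.proj y j)) x u)
  fibreForm_apply : ∀ c x, B.proj x ∈ B.U c → ∀ u v : TangentSpace (𝓡 d) x,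
    fibreForm x u v = 2 * (⟪vecDeriv (𝓡 d) (B.coord c) x u, vecDeriv (𝓡 d) (B.coord c) x v⟫_ℝ -
      ⟪J (B.coord c x), vecDeriv (𝓡 d) (B.coord c) x u⟫_ℝ *
        ⟪J (B.coord c x), vecDeriv (𝓡 d) (B.coord c) x v⟫_ℝ)

/-- The coefficient functions of a metric `ds² / α + α θ² + β₀ fibreForm + ∑ β j metric j` that is
smooth at `s = T` in the disc bundle: `α = 2 (T - s) f` and `β₀ = (T - s) (s + T) / 2T`, where
`1 / f` and `f` agree with `(s + T) / 2T` at `T`. -/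
structure CollapseProfile (k : ℕ) (T : ℝ) where
  α : ℝ → ℝ
  β₀ : ℝ → ℝ
  β : Fin k → ℝ → ℝ
  f : ℝ → ℝ
  c₁ : ℝ → ℝ
  c₂ : ℝ → ℝ
  f_pos : ∀ s ∈ Icc 0 T, 0 < f s
  β_pos : ∀ j, ∀ s ∈ Icc 0 T, 0 < β j s
  contDiffOn_β : ∀ j, ContDiffOn ℝ ∞ (β j) (Icc 0 T)
  contDiffOn_c₁ : ContDiffOn ℝ ∞ c₁ (Icc 0 T)
  contDiffOn_c₂ : ContDiffOn ℝ ∞ c₂ (Icc 0 T)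
  α_eq : ∀ s, α s = 2 * (T - s) * f s
  β₀_eq : ∀ s, β₀ s = (T - s) * ((s + T) / (2 * T))
  c₁_eq : ∀ s ∈ Icc 0 T, 2 * (T - s) * c₁ s = 1 / f s - (s + T) / (2 * T)
  c₂_eq : ∀ s ∈ Icc 0 T, 2 * (T - s) * c₂ s = f s - (s + T) / (2 * T)

namespace SphereBundle

namespace Geometry

open Collapse

variable {B : SphereBundle d P (ModelWithCorners.pi fun j => 𝓡 (a j)) (∀ j, W j) C}
  {b : Fin k → ℕ} {Λ : Fin k → Type*}
  [∀ j, TopologicalSpace (Λ j)] [∀ j, ChartedSpace (EuclideanSpace ℝ (Fin (b j))) (Λ j)]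
  [∀ j, IsManifold (𝓡 (b j)) ∞ (Λ j)]
  (G : B.Geometry b Λ)
  {E : Type*} [NormedAddCommGroup E] [NormedSpace ℝ E] {H : Type*} [TopologicalSpace H]
  {I : ModelWithCorners ℝ E H} {X : Type*} [TopologicalSpace X] [ChartedSpace H X]

variable (I) in
/-- The pull-back of the potential of the connection over `U c` by a map to the base. -/
def potential (c : ∀ j, W j) (φ : X → ∀ j, W j) (x : X) : E →L[ℝ] ℝ :=
  ∑ j, G.weight j • (G.form j).pullback I (fun y => G.sec c j (φ y j)) x

lemma potential_apply (c : ∀ j, W j) (φ : X → ∀ j, W j) (x : X) (u : E) :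
    G.potential I c φ x u = ∑ j, G.weight j * G.form j (G.sec c j (φ x j))
      (mfderiv I (𝓡 (b j)) (fun y => G.sec c j (φ y j)) x u) := by
  simp only [potential, sum_apply, smul_apply, smul_eq_mul]
  rfl

variable (I) in
/-- The pull-back of `∑ r j • metric j` by a map to the base. -/
def baseForm (r : Fin k → ℝ) (φ : X → ∀ j, W j) (x : X) : E →L[ℝ] E →L[ℝ] ℝ :=
  ∑ j, r j • SmoothMetric.pullback I (G.metric j) (fun y => φ y j) x

lemma baseForm_apply (r : Fin k → ℝ) (φ : X → ∀ j, W j) (x : X) (u v : E) :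
    G.baseForm I r φ x u v = ∑ j, r j * (G.metric j).inner (φ x j)
      (mfderiv I (𝓡 (a j)) (fun y => φ y j) x u)
      (mfderiv I (𝓡 (a j)) (fun y => φ y j) x v) := by
  simp only [baseForm, sum_apply, smul_apply, smul_eq_mul]
  rfl

lemma potential_comp {E' : Type*} [NormedAddCommGroup E'] [NormedSpace ℝ E'] {H' : Type*}
    [TopologicalSpace H'] {I' : ModelWithCorners ℝ E' H'} {Y : Type*} [TopologicalSpace Y]
    [ChartedSpace H' Y] {c : ∀ j, W j} {φ : X → ∀ j, W j} {ψ : Y → ∀ j, W j} {g : X → Y} {x : X}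
    (h : φ =ᶠ[𝓝 x] fun y => ψ (g y))
    (hψ : ∀ j, MDifferentiableAt I' (𝓡 (b j)) (fun y => G.sec c j (ψ y j)) (g x))
    (hg : MDifferentiableAt I I' g x) (u : E) :
    G.potential I c φ x u = G.potential I' c ψ (g x) (mfderiv I I' g x u) := by
  refine Eq.trans ?_ (G.potential_apply c ψ (g x) _).symm
  simp only [potential, sum_apply, smul_apply, smul_eq_mul]
  refine Finset.sum_congr rfl fun j _ => congrArg (G.weight j * ·) ?_
  have h1 : (fun y => G.sec c j (φ y j)) =ᶠ[𝓝 x] fun y => G.sec c j (ψ (g y) j) :=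
    h.fun_comp fun q => G.sec c j (q j)
  rw [(G.form j).pullback_congr h1]
  exact congrArg (G.form j (G.sec c j (ψ (g x) j))) (mfderiv_comp_apply x (hψ j) hg u)

lemma baseForm_comm (r : Fin k → ℝ) (φ : X → ∀ j, W j) (x : X) (u v : E) :
    G.baseForm I r φ x u v = G.baseForm I r φ x v u := by
  rw [baseForm_apply, baseForm_apply]
  exact Finset.sum_congr rfl fun j _ => congrArg _ ((G.metric j).symm _ _ _)

lemma contMDiffAt_sec_comp {I : ModelWithCorners ℝ E H} {c : ∀ j, W j} {φ : X → ∀ j, W j} {x : X}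
    (hφ : ContMDiffAt I (ModelWithCorners.pi fun j => 𝓡 (a j)) ∞ φ x) (hx : φ x ∈ B.U c)
    (j : Fin k) : ContMDiffAt I (𝓡 (b j)) ∞ (fun y => G.sec c j (φ y j)) x :=
  (G.contMDiffAt_sec c (φ x) hx j).comp x (contMDiffAt_pi_iff.1 hφ j)

lemma contMDiffAt_inner {f g : X → C} {x : X} (hf : ContMDiffAt I 𝓘(ℝ, C) ∞ f x)
    (hg : ContMDiffAt I 𝓘(ℝ, C) ∞ g x) : ContMDiffAt I 𝓘(ℝ, ℝ) ∞ (fun y => ⟪f y, g y⟫_ℝ) x :=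
  (contDiff_inner (𝕜 := ℝ) (E := C) (n := ∞)).contMDiff.contMDiffAt.comp x (hf.prodMk_space hg)

variable {T : ℝ} [hT : Fact (0 < T)] [CompactSpace P] [∀ j, T2Space (W j)] (F : CollapseProfile k T)

/-- The covariant derivative of the coordinate in the fibres of the disc bundle over `U c`. -/
def covDeriv (c : ∀ j, W j) (m : B.Collapse T) : EuclideanSpace ℝ (Fin (d + 1)) →L[ℝ] C :=
  vecDeriv (𝓡∂ (d + 1)) (fibre B c) m +
    (G.sign • G.potential (𝓡∂ (d + 1)) c (base B) m).smulRight (G.J (fibre B c m))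

/-- The metric of the disc bundle over `U c`, in terms of the coordinate `ζ` in the fibre and of its
covariant derivative `Dζ`: it is `∑ β j metric j + b |Dζ|² + c₁ ⟪ζ, Dζ⟫² + c₂ ⟪Jζ, Dζ⟫²` with
`b = (s + T) / 2T`, and thus manifestly smooth at the zero section. -/
def discForm (c : ∀ j, W j) (m : B.Collapse T) :
    EuclideanSpace ℝ (Fin (d + 1)) →L[ℝ] EuclideanSpace ℝ (Fin (d + 1)) →L[ℝ] ℝ :=
  G.baseForm (𝓡∂ (d + 1)) (fun j => F.β j (height B m)) (base B) m +
    ((height B m + T) / (2 * T)) • innerPullback (G.covDeriv c m) +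
    F.c₁ (height B m) • ((innerSL ℝ (fibre B c m)).comp (G.covDeriv c m)).smulRight
      ((innerSL ℝ (fibre B c m)).comp (G.covDeriv c m)) +
    F.c₂ (height B m) • ((innerSL ℝ (G.J (fibre B c m))).comp (G.covDeriv c m)).smulRight
      ((innerSL ℝ (G.J (fibre B c m))).comp (G.covDeriv c m))

lemma covDeriv_apply (c : ∀ j, W j) (m : B.Collapse T) (u : EuclideanSpace ℝ (Fin (d + 1))) :
    G.covDeriv c m u = vecDeriv (𝓡∂ (d + 1)) (fibre B c) m u +
      (G.sign * G.potential (𝓡∂ (d + 1)) c (base B) m u) • G.J (fibre B c m) := rfl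

lemma discForm_apply (c : ∀ j, W j) (m : B.Collapse T) (u v : EuclideanSpace ℝ (Fin (d + 1))) :
    G.discForm F c m u v = G.baseForm (𝓡∂ (d + 1)) (fun j => F.β j (height B m)) (base B) m u v +
      ((height B m + T) / (2 * T) * ⟪G.covDeriv c m u, G.covDeriv c m v⟫_ℝ +
      F.c₁ (height B m) * (⟪fibre B c m, G.covDeriv c m u⟫_ℝ * ⟪fibre B c m, G.covDeriv c m v⟫_ℝ) +
      F.c₂ (height B m) * (⟪G.J (fibre B c m), G.covDeriv c m u⟫_ℝ *
        ⟪G.J (fibre B c m), G.covDeriv c m v⟫_ℝ)) := by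
  simp only [discForm, add_apply, smul_apply, ContinuousLinearMap.smulRight_apply,
    ContinuousLinearMap.comp_apply, innerSL_apply_apply, smul_eq_mul]
  have h : innerPullback (G.covDeriv c m) u v = ⟪G.covDeriv c m u, G.covDeriv c m v⟫_ℝ := rfl
  rw [h]
  ring

lemma discForm_comm (c : ∀ j, W j) (m : B.Collapse T) (u v : EuclideanSpace ℝ (Fin (d + 1))) :
    G.discForm F c m u v = G.discForm F c m v u := by
  rw [discForm_apply, discForm_apply, baseForm_comm,
    real_inner_comm (G.covDeriv c m u) (G.covDeriv c m v)]
  ring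

variable [IsManifold (𝓡 d) ∞ P]

lemma contMDiff_comp_height {f : ℝ → ℝ} (hf : ContDiffOn ℝ ∞ f (Icc 0 T)) :
    ContMDiff (𝓡∂ (d + 1)) 𝓘(ℝ, ℝ) ∞ (fun m : B.Collapse T => f (height B m)) :=
  hf.contMDiffOn.comp_contMDiff (contMDiff_height B) (height_mem B)

lemma contMDiffAt_discForm {c : ∀ j, W j} {m₀ : B.Collapse T} (hm : base B m₀ ∈ B.U c)
    (u v : EuclideanSpace ℝ (Fin (d + 1))) :
    ContMDiffAt (𝓡∂ (d + 1)) 𝓘(ℝ, ℝ) ∞ (fun m => G.discForm F c m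
      (constField (𝓡∂ (d + 1)) m₀ u m) (constField (𝓡∂ (d + 1)) m₀ v m)) m₀ := by
  have hbase := contMDiff_base B (T := T) m₀
  have hfib : ContMDiffAt (𝓡∂ (d + 1)) 𝓘(ℝ, C) ∞ (fibre B (T := T) c) m₀ :=
    (contMDiffOn_fibre B c).contMDiffAt ((isOpen_base_preimage B c).mem_nhds hm)
  have hJ : ContMDiffAt (𝓡∂ (d + 1)) 𝓘(ℝ, C) ∞ (fun m : B.Collapse T => G.J (fibre B c m)) m₀ :=
    G.J.contDiff.contMDiff.contMDiffAt.comp m₀ hfib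
  have hpot : ∀ u, ContMDiffAt (𝓡∂ (d + 1)) 𝓘(ℝ, ℝ) ∞ (fun m =>
      G.potential (𝓡∂ (d + 1)) c (base B) m (constField (𝓡∂ (d + 1)) m₀ u m)) m₀ := by
    intro u
    refine ContMDiffAt.congr_of_eventuallyEq ?_
      (Filter.Eventually.of_forall fun m => G.potential_apply c (base B) m _)
    exact contMDiffAt_finsetSum fun j _ => contMDiffAt_const.mul
      (contMDiffAt_oneForm_pullback (G.contMDiffAt_sec_comp hbase hm j) u (G.contMDiff_form j))
  have hcov : ∀ u, ContMDiffAt (𝓡∂ (d + 1)) 𝓘(ℝ, C) ∞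
      (fun m => G.covDeriv c m (constField (𝓡∂ (d + 1)) m₀ u m)) m₀ := by
    intro u
    have h1 := contMDiffAt_mfderiv_constField_vector hfib u
    have h2 : ContMDiffAt (𝓡∂ (d + 1)) 𝓘(ℝ, ℝ) ∞ (fun m => G.sign *
      G.potential (𝓡∂ (d + 1)) c (base B) m (constField (𝓡∂ (d + 1)) m₀ u m)) m₀ :=
      contMDiffAt_const.mul (hpot u)
    exact h1.add (h2.smul hJ)
  have hbf : ContDiffOn ℝ ∞ (fun s : ℝ => (s + T) / (2 * T)) (Icc 0 T) :=
    ContDiff.contDiffOn (by fun_prop)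
  refine ContMDiffAt.congr_of_eventuallyEq ?_ (Filter.Eventually.of_forall fun m =>
    (G.discForm_apply F c m _ _).trans (congrArg (· + _) (G.baseForm_apply _ (base B) m _ _)))
  refine (contMDiffAt_finsetSum fun j _ => ?_).add ((ContMDiffAt.add ?_ ?_).add ?_)
  · exact (contMDiff_comp_height (F.contDiffOn_β j) m₀).mul
      (contMDiffAt_metric_pullback (contMDiffAt_pi_iff.1 hbase j) u v (G.metric j))
  · exact (contMDiff_comp_height hbf m₀).mul (contMDiffAt_inner (hcov u) (hcov v))
  · exact (contMDiff_comp_height F.contDiffOn_c₁ m₀).mul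
      ((contMDiffAt_inner hfib (hcov u)).mul (contMDiffAt_inner hfib (hcov v)))
  · exact (contMDiff_comp_height F.contDiffOn_c₂ m₀).mul
      ((contMDiffAt_inner hJ (hcov u)).mul (contMDiffAt_inner hJ (hcov v)))

/-- A tangent vector on which the projection to the base and `Dζ` vanish is zero, because the
projection and `ζ` define an immersion. -/
lemma discForm_pos {c : ∀ j, W j} {m : B.Collapse T} (hm : base B m ∈ B.U c)
    {u : EuclideanSpace ℝ (Fin (d + 1))} (hu : u ≠ 0) : 0 < G.discForm F c m u u := by
  have hs := height_mem B m
  have hT' := hT.out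
  have hbf : 0 < (height B m + T) / (2 * T) := div_pos (by linarith [hs.1]) (by linarith)
  have hpos := fun (x : C) (hx : x ≠ 0) => fibre_form_pos (ζ := fibre B c m) (x := x) G.inner_J
    G.inner_self_J hbf (F.f_pos _ hs) (by rw [norm_fibre_sq B hm]; exact F.c₁_eq _ hs)
    (by rw [norm_fibre_sq B hm]; exact F.c₂_eq _ hs) hx
  have hterm : ∀ j, 0 ≤ F.β j (height B m) * (G.metric j).inner (base B m j)
      (mfderiv (𝓡∂ (d + 1)) (𝓡 (a j)) (fun y => base B y j) m u)
      (mfderiv (𝓡∂ (d + 1)) (𝓡 (a j)) (fun y => base B y j) m u) := by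
    intro j
    refine mul_nonneg (F.β_pos j _ hs).le ?_
    by_cases h : mfderiv (𝓡∂ (d + 1)) (𝓡 (a j)) (fun y => base B y j) m u = 0
    · rw [h, map_zero]
    · exact ((G.metric j).pos _ _ h).le
  rw [discForm_apply, baseForm_apply]
  by_cases hb : ∀ j, mfderiv (𝓡∂ (d + 1)) (𝓡 (a j)) (fun y => base B y j) m u = 0
  · refine add_pos_of_nonneg_of_pos (Finset.sum_nonneg fun j _ => hterm j) (hpos _ ?_)
    have hbase := contMDiff_base B (T := T) m
    have hp : G.potential (𝓡∂ (d + 1)) c (base B) m u = 0 := by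
      rw [potential_apply]
      refine Finset.sum_eq_zero fun j _ => ?_
      have h1 := mfderiv_comp_apply m
        ((G.contMDiffAt_sec c _ hm j).mdifferentiableAt (by simp))
        ((contMDiffAt_pi_iff.1 hbase j).mdifferentiableAt (by simp)) u
      have h2 : mfderiv (𝓡∂ (d + 1)) (𝓡 (b j)) (fun y => G.sec c j (base B y j)) m u = 0 := by
        refine h1.trans ?_
        rw [hb j]
        exact map_zero _
      rw [h2, map_zero, mul_zero]
    rw [covDeriv_apply, hp, mul_zero, zero_smul, add_zero]
    intro h0
    refine hu (eq_zero_of_mfderiv_base_fibre B hm ?_ h0)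
    refine funext fun j => ?_
    exact (mfderiv_apply_pi (hbase.mdifferentiableAt (by simp)) j u).symm.trans (hb j)
  · obtain ⟨j₀, hj₀⟩ := not_forall.1 hb
    refine add_pos_of_pos_of_nonneg ?_ ?_
    · refine Finset.sum_pos' (fun j _ => hterm j) ⟨j₀, Finset.mem_univ _, ?_⟩
      exact mul_pos (F.β_pos j₀ _ hs) ((G.metric j₀).pos _ _ hj₀)
    · by_cases h0 : G.covDeriv c m u = 0
      · simp [h0]
      · exact (hpos _ h0).le

/-- Away from the zero section, the metric of the disc bundle is the given metric on
`[0, T) × P`. -/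
lemma discForm_eq {c : ∀ j, W j} {m : B.Collapse T} (hm : base B m ∈ B.U c)
    (hlt : height B m < T) (u v : EuclideanSpace ℝ (Fin (d + 1))) :
    G.discForm F c m u v =
      G.baseForm (𝓡∂ (d + 1)) (fun j => F.β j (height B m)) (base B) m u v +
      (vecDeriv (𝓡∂ (d + 1)) (height B) m u * vecDeriv (𝓡∂ (d + 1)) (height B) m v /
          F.α (height B m) +
        F.α (height B m) * (G.θ (point B m) (mfderiv (𝓡∂ (d + 1)) (𝓡 d) (point B) m u) *
          G.θ (point B m) (mfderiv (𝓡∂ (d + 1)) (𝓡 d) (point B) m v)) +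
        F.β₀ (height B m) * G.fibreForm (point B m) (mfderiv (𝓡∂ (d + 1)) (𝓡 d) (point B) m u)
          (mfderiv (𝓡∂ (d + 1)) (𝓡 d) (point B) m v)) := by
  have hs := height_mem B m
  have hT' := hT.out
  have hpr := proj_point B hlt
  have hx : B.proj (point B m) ∈ B.U c := by rw [hpr]; exact hm
  have hev : ∀ᶠ m' in 𝓝 m, height B m' < T := (isOpen_height_lt B).mem_nhds hlt
  have hheight := (contMDiff_height B m).mdifferentiableAt (n := ∞) (by simp)
  have hpoint := (contMDiffAt_point B hlt).mdifferentiableAt (by simp)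
  have hUx : B.proj ⁻¹' B.U c ∈ 𝓝 (point B m) :=
    ((B.isOpen_U c).preimage B.contMDiff_proj.continuous).mem_nhds hx
  have hcoord := ((B.contMDiffOn_coord c).contMDiffAt hUx).mdifferentiableAt (by simp)
  set ρ := √(2 * (T - height B m)) with hρ
  have hρ0 : 0 < ρ := Real.sqrt_pos.2 (by linarith)
  have hρ2 : ρ ^ 2 = 2 * (T - height B m) := Real.sq_sqrt (by linarith)
  have hsqrt : HasDerivAt (fun s => √(2 * (T - s))) (-1 / ρ) (height B m) := by
    have h1 := (((hasDerivAt_id (height B m)).const_sub T).const_mul 2).sqrt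
      (by simp only [id]; linarith)
    convert! h1 using 1
    simp only [id]
    rw [← hρ]
    field_simp
  have hρm : MDifferentiableAt (𝓡∂ (d + 1)) 𝓘(ℝ, ℝ) (fun m => √(2 * (T - height B m))) m :=
    (hsqrt.differentiableAt.mdifferentiableAt).comp m hheight
  -- the differential of the coordinate in the fibre in polar coordinates
  have hfib : ∀ u, vecDeriv (𝓡∂ (d + 1)) (fibre B c) m u =
      ρ • vecDeriv (𝓡 d) (B.coord c) (point B m) (mfderiv (𝓡∂ (d + 1)) (𝓡 d) (point B) m u) +
        (-1 / ρ * vecDeriv (𝓡∂ (d + 1)) (height B) m u) • B.coord c (point B m) := by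
    intro u
    have h1 : fibre B c =ᶠ[𝓝 m] fun m => √(2 * (T - height B m)) • B.coord c (point B m) := by
      filter_upwards [hev] with m' hm'
      rw [← fibre_collapse B hT.out.le c (height_mem B m'), collapse_height_point B hT.out.le hm']
    rw [h1.vecDeriv_eq]
    refine (vecDeriv_smul (f := fun m => B.coord c (point B m)) hρm (hcoord.comp m hpoint)
      u).trans ?_
    exact congrArg₂ (· + ·) (congrArg (ρ • ·) (vecDeriv_comp hcoord hpoint u))
      (congrArg (· • B.coord c (point B m)) (vecDeriv_comp_real hsqrt hheight u))
  have hval : fibre B c m = ρ • B.coord c (point B m) := by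
    rw [hρ, ← fibre_collapse B hT.out.le c hs, collapse_height_point B hT.out.le hlt]
  have hpot : ∀ u, G.potential (𝓡∂ (d + 1)) c (base B) m u =
      G.potential (𝓡 d) c B.proj (point B m) (mfderiv (𝓡∂ (d + 1)) (𝓡 d) (point B) m u) := by
    intro u
    have h1 : base B =ᶠ[𝓝 m] fun m => B.proj (point B m) := by
      filter_upwards [hev] with m' hm' using (proj_point B hm').symm
    exact G.potential_comp h1 (fun j => ((G.contMDiffAt_sec_comp
      B.contMDiff_proj.contMDiffAt hx j).mdifferentiableAt (by simp))) hpoint u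
  have hnorm : ⟪B.coord c (point B m), B.coord c (point B m)⟫_ℝ = 1 := by
    rw [real_inner_self_eq_norm_sq, B.norm_coord c _ hx, one_pow]
  have horth : ∀ w, ⟪B.coord c (point B m), vecDeriv (𝓡 d) (B.coord c) (point B m) w⟫_ℝ = 0 := by
    intro w
    have h1 := vecDeriv_norm_sq hcoord w
    have h2 : (fun x => ‖B.coord c x‖ ^ 2) =ᶠ[𝓝 (point B m)] fun _ => (1 : ℝ) := by
      filter_upwards [hUx] with x hx
      rw [B.norm_coord c x hx, one_pow]
    have h3 : vecDeriv (𝓡 d) (fun _ : P => (1 : ℝ)) (point B m) = 0 := mfderiv_const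
    rw [h2.vecDeriv_eq, h3, zero_apply] at h1
    linarith
  have key := polar_identity G.inner_J G.inner_self_J hnorm
    (horth (mfderiv (𝓡∂ (d + 1)) (𝓡 d) (point B) m u))
    (horth (mfderiv (𝓡∂ (d + 1)) (𝓡 d) (point B) m v))
    (σ := vecDeriv (𝓡∂ (d + 1)) (height B) m u) (σ' := vecDeriv (𝓡∂ (d + 1)) (height B) m v)
    (r := -1 / ρ * vecDeriv (𝓡∂ (d + 1)) (height B) m u)
    (r' := -1 / ρ * vecDeriv (𝓡∂ (d + 1)) (height B) m v)
    (a := G.potential (𝓡∂ (d + 1)) c (base B) m u) (a' := G.potential (𝓡∂ (d + 1)) c (base B) m v)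
    (bf := (height B m + T) / (2 * T)) (by field_simp) (by field_simp) hρ0
    (F.f_pos _ hs).ne' (by rw [hρ2]; exact F.c₁_eq _ hs) (by rw [hρ2]; exact F.c₂_eq _ hs)
    G.sign_sq
  have hθ : ∀ u, G.θ (point B m) (mfderiv (𝓡∂ (d + 1)) (𝓡 d) (point B) m u) =
      G.sign * ⟪G.J (B.coord c (point B m)), vecDeriv (𝓡 d) (B.coord c) (point B m)
        (mfderiv (𝓡∂ (d + 1)) (𝓡 d) (point B) m u)⟫_ℝ +
      G.potential (𝓡∂ (d + 1)) c (base B) m u := fun u =>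
    (G.θ_apply c _ hx _).trans (congrArg (_ + ·)
      ((hpot u).trans (G.potential_apply c B.proj _ _)).symm)
  rw [discForm_apply, covDeriv_apply, covDeriv_apply, hfib, hfib, hval, key, F.α_eq, F.β₀_eq, hρ2]
  refine congrArg₂ (· + ·) rfl (congrArg₂ (· + ·)
    (congrArg₂ (· + ·) rfl (congrArg₂ (· * ·) rfl ?_)) ?_)
  · exact congrArg₂ (· * ·) (hθ u).symm (hθ v).symm
  · exact congrArg₂ (· * ·) (by ring) (G.fibreForm_apply c _ hx _ _).symm

/-- The metrics over the sets `U c` agree on the overlaps: away from the zero section they are the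
given metric, and the zero section has no interior. -/
lemma discForm_eq_of_mem {c c' : ∀ j, W j} {m₀ : B.Collapse T} (hm : base B m₀ ∈ B.U c)
    (hm' : base B m₀ ∈ B.U c') : G.discForm F c m₀ = G.discForm F c' m₀ := by
  refine ContinuousLinearMap.ext fun u => ContinuousLinearMap.ext fun v => ?_
  obtain ⟨u, rfl⟩ := exists_constField_eq (I := 𝓡∂ (d + 1)) (M := B.Collapse T) m₀ u
  obtain ⟨v, rfl⟩ := exists_constField_eq (I := 𝓡∂ (d + 1)) (M := B.Collapse T) m₀ v
  -- both sides are continuous at `m₀`, and they agree on the dense set `s < T`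
  have h1 := (G.contMDiffAt_discForm F hm u v).continuousAt
  have h2 := (G.contMDiffAt_discForm F hm' u v).continuousAt
  have hd : Dense {m : B.Collapse T | height B m < T} :=
    (dense_ofPolar_image_Ioo B).mono (by
      rw [← ofPolar_image_Ico]
      exact image_mono (prod_mono_left Ioo_subset_Ico_self))
  have h3 : ∃ᶠ m in 𝓝 m₀, height B m < T := mem_closure_iff_frequently.1 (hd m₀)
  have h4 : ∀ᶠ m in 𝓝 m₀, base B m ∈ B.U c ∧ base B m ∈ B.U c' :=
    ((isOpen_base_preimage B c).inter (isOpen_base_preimage B c')).mem_nhds ⟨hm, hm'⟩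
  refine tendsto_nhds_unique_of_frequently_eq h1 h2 ((h3.and_eventually h4).mono ?_)
  rintro m ⟨h5, h6, h7⟩
  exact (G.discForm_eq F h6 h5 _ _).trans (G.discForm_eq F h7 h5 _ _).symm

/-- The smooth metric on the disc bundle. -/
def discMetric : SmoothMetric (𝓡∂ (d + 1)) (B.Collapse T) :=
  SmoothMetric.ofConstField (fun m => G.discForm F (base B m) m)
    (fun m => G.discForm_comm F (base B m) m) (fun _ _ hu => G.discForm_pos F (B.mem_U _) hu)
    fun m₀ u v => (G.contMDiffAt_discForm F (B.mem_U (base B m₀)) u v).congr_of_eventuallyEq (by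
      filter_upwards [(isOpen_base_preimage B (base B m₀)).mem_nhds (B.mem_U (base B m₀))] with m hm
      rw [G.discForm_eq_of_mem F (B.mem_U (base B m)) hm]
      rfl)

lemma discMetric_ofPolar {s : ℝ} (hs : s ∈ Ico 0 T) (x : P)
    (u v : TangentSpace (𝓘(ℝ, ℝ).prod (𝓡 d)) ((s, x) : ℝ × P)) :
    (G.discMetric F).inner (ofPolar B (T := T) (s, x))
      (mfderivWithin (𝓘(ℝ, ℝ).prod (𝓡 d)) (𝓡∂ (d + 1)) (ofPolar B) (Ico 0 T ×ˢ univ) (s, x) u)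
      (mfderivWithin (𝓘(ℝ, ℝ).prod (𝓡 d)) (𝓡∂ (d + 1)) (ofPolar B) (Ico 0 T ×ˢ univ) (s, x) v) =
    u.1 * v.1 / F.α s + F.α s * (G.θ x u.2 * G.θ x v.2) + (F.β₀ s * G.fibreForm x u.2 v.2 +
      ∑ j, F.β j s * (G.metric j).inner (B.proj x j)
        (mfderiv (𝓡 d) (𝓡 (a j)) (fun y => B.proj y j) x u.2)
        (mfderiv (𝓡 d) (𝓡 (a j)) (fun y => B.proj y j) x v.2)) := by
  have hS : height B (ofPolar B (T := T) (s, x)) = s :=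
    height_collapse B hT.out.le (Ico_subset_Icc_self hs) x
  have hX : point B (ofPolar B (T := T) (s, x)) = x := point_collapse B hT.out.le hs x
  let D := mfderivWithin (𝓘(ℝ, ℝ).prod (𝓡 d)) (𝓡∂ (d + 1)) (ofPolar B (T := T))
    (Ico 0 T ×ˢ univ) (s, x)
  have h1 := G.discForm_eq F (m := ofPolar B (T := T) (s, x)) (B.mem_U _) (by rw [hS]; exact hs.2)
    (D u) (D v)
  have hbase : ∀ j (u : TangentSpace (𝓘(ℝ, ℝ).prod (𝓡 d)) ((s, x) : ℝ × P)),
      mfderiv (𝓡∂ (d + 1)) (𝓡 (a j)) (fun m => base B m j) (ofPolar B (T := T) (s, x)) (D u) =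
        mfderiv (𝓡 d) (𝓡 (a j)) (fun y => B.proj y j) x u.2 := by
    intro j u
    have h2 := (contMDiff_pi_iff.1 B.contMDiff_proj j x).mdifferentiableAt (n := ∞) (by simp)
    have h3 : MDifferentiableAt (𝓘(ℝ, ℝ).prod (𝓡 d)) (𝓡 (a j)) (fun y : ℝ × P => B.proj y.2 j)
      (s, x) := h2.comp (s, x) mdifferentiableAt_snd
    refine (mfderiv_comp_ofPolar B hs x
      ((contMDiff_pi_iff.1 (contMDiff_base B (T := T)) j _).mdifferentiableAt (n := ∞) (by simp))
      h3 (fun y _ => rfl) u).trans ?_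
    have h4 := mfderiv_comp_apply (s, x) (f := fun y : ℝ × P => y.2) h2 mdifferentiableAt_snd u
    refine h4.trans ?_
    rw [mfderiv_snd]
    rfl
  have hu : ∀ u, mfderiv (𝓡∂ (d + 1)) (𝓡 d) (point B) (ofPolar B (T := T) (s, x)) (D u) = u.2 :=
    mfderiv_point_ofPolar B hs x
  have hσ : ∀ u, vecDeriv (𝓡∂ (d + 1)) (height B) (ofPolar B (T := T) (s, x)) (D u) = u.1 :=
    mfderiv_height_ofPolar B hs x
  refine h1.trans ?_
  rw [add_comm, add_assoc]
  let t : P → EuclideanSpace ℝ (Fin d) → ℝ := fun y w => G.θ y w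
  let t' : P → EuclideanSpace ℝ (Fin d) → EuclideanSpace ℝ (Fin d) → ℝ := G.fibreForm
  have hθ : ∀ u, t (point B (ofPolar B (T := T) (s, x)))
      (mfderiv (𝓡∂ (d + 1)) (𝓡 d) (point B) (ofPolar B (T := T) (s, x)) (D u)) = t x u.2 :=
    fun u => congrArg₂ t hX (hu u)
  refine congrArg₂ (· + ·) (congrArg₂ (· + ·) ?_ ?_) (congrArg₂ (· + ·) ?_ ?_)
  · rw [hS]
    exact congrArg (· / F.α s) (congrArg₂ (· * ·) (hσ u) (hσ v))
  · rw [hS]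
    exact congrArg (F.α s * ·) (congrArg₂ (· * ·) (hθ u) (hθ v))
  · rw [hS]
    refine congrArg (F.β₀ s * ·) ?_
    exact (congrArg (fun y => t' y _ _) hX).trans (congrArg₂ (t' x) (hu u) (hu v))
  · refine (G.baseForm_apply _ (base B) _ _ _).trans ?_
    rw [hS]
    exact Finset.sum_congr rfl fun j _ => congrArg (F.β j s * ·)
      (congrArg₂ (fun w w' => (G.metric j).inner (B.proj x j) w w') (hbase j u) (hbase j v))

end Geometry

end SphereBundle

end CollapseMetric

/-! ### Principal circle bundles -/

namespace IsPrincipalCircleBundle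

variable {E : Type*} [NormedAddCommGroup E] [NormedSpace ℝ E] {H : Type*} [TopologicalSpace H]
  {I : ModelWithCorners ℝ E H}
  {E' : Type*} [NormedAddCommGroup E'] [NormedSpace ℝ E'] {H' : Type*} [TopologicalSpace H']
  {I' : ModelWithCorners ℝ E' H'}
  {L B : Type*} [TopologicalSpace L] [ChartedSpace H L] [MulAction Circle L]
  [TopologicalSpace B] [ChartedSpace H' B] {pr : L → B} (h : IsPrincipalCircleBundle I I' pr)

/-- A neighbourhood of `b` over which the bundle is trivial. -/
def trivSet (b : B) : Set B := (h.locally_trivial b).choose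

/-- A section of the bundle over `trivSet b`. -/
def localSec (b : B) : B → L := (h.locally_trivial b).choose_spec.2.2.choose

/-- The coordinate in the fibres that is defined by `localSec b`. -/
def localCoord (b : B) : L → Circle := (h.locally_trivial b).choose_spec.2.2.choose_spec.choose

lemma isOpen_trivSet (b : B) : IsOpen (h.trivSet b) := (h.locally_trivial b).choose_spec.1

lemma mem_trivSet (b : B) : b ∈ h.trivSet b := (h.locally_trivial b).choose_spec.2.1

lemma contMDiffOn_localSec (b : B) : ContMDiffOn I' I ∞ (h.localSec b) (h.trivSet b) :=
  (h.locally_trivial b).choose_spec.2.2.choose_spec.choose_spec.1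

lemma proj_localSec {b y : B} (hy : y ∈ h.trivSet b) : pr (h.localSec b y) = y :=
  (h.locally_trivial b).choose_spec.2.2.choose_spec.choose_spec.2.1 y hy

lemma contMDiffOn_localCoord (b : B) :
    ContMDiffOn I (𝓡 1) ∞ (h.localCoord b) (pr ⁻¹' h.trivSet b) :=
  (h.locally_trivial b).choose_spec.2.2.choose_spec.choose_spec.2.2.1

lemma eq_localCoord_smul {b : B} {x : L} (hx : pr x ∈ h.trivSet b) :
    x = h.localCoord b x • h.localSec b (pr x) :=
  (h.locally_trivial b).choose_spec.2.2.choose_spec.choose_spec.2.2.2 x hx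

/-- The coordinate of `x` with respect to `y`, for points of the same fibre. -/
lemma eq_div_smul {b : B} {x y : L} (hx : pr x ∈ h.trivSet b) (hxy : pr x = pr y) :
    x = (h.localCoord b x / h.localCoord b y) • y := by
  have h1 := h.eq_localCoord_smul hx
  have h2 := h.eq_localCoord_smul (x := y) (hxy ▸ hx)
  rw [← hxy] at h2
  calc x = (h.localCoord b x / h.localCoord b y * h.localCoord b y) • h.localSec b (pr x) := by
        rw [div_mul_cancel]; exact h1
    _ = (h.localCoord b x / h.localCoord b y) • y := by rw [mul_smul, ← h2]

include h in
lemma exists_eq_smul {x y : L} (hxy : pr x = pr y) : ∃ c : Circle, x = c • y :=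
  ⟨_, h.eq_div_smul (h.mem_trivSet _) hxy⟩

include h in
/-- Two smooth maps to the total space with the same projection differ by a smooth map to `U(1)`. -/
lemma exists_contMDiffAt_smul {EX : Type*} [NormedAddCommGroup EX] [NormedSpace ℝ EX] {HX : Type*}
    [TopologicalSpace HX] {IX : ModelWithCorners ℝ EX HX} {X : Type*} [TopologicalSpace X]
    [ChartedSpace HX X] {f g : X → L} {x : X} (hf : ContMDiffAt IX I ∞ f x)
    (hg : ContMDiffAt IX I ∞ g x) (hfg : ∀ᶠ y in 𝓝 x, pr (f y) = pr (g y)) :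
    ∃ c : X → Circle, ContMDiffAt IX (𝓡 1) ∞ c x ∧ ∀ᶠ y in 𝓝 x, f y = c y • g y := by
  have hU : pr ⁻¹' h.trivSet (pr (f x)) ∈ 𝓝 (f x) :=
    ((h.isOpen_trivSet _).preimage h.contMDiff_proj.continuous).mem_nhds (h.mem_trivSet _)
  have hU' : pr ⁻¹' h.trivSet (pr (f x)) ∈ 𝓝 (g x) :=
    ((h.isOpen_trivSet _).preimage h.contMDiff_proj.continuous).mem_nhds
      (by rw [mem_preimage, ← hfg.self_of_nhds]; exact h.mem_trivSet _)
  have : LieGroup (𝓡 1) ∞ Circle := LieGroup.of_le (n := ω) le_top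
  refine ⟨fun y => h.localCoord (pr (f x)) (f y) / h.localCoord (pr (f x)) (g y), ?_, ?_⟩
  · exact (((h.contMDiffOn_localCoord _).contMDiffAt hU).comp x hf).div
      (((h.contMDiffOn_localCoord _).contMDiffAt hU').comp x hg)
  · filter_upwards [hfg, hf.continuousAt hU] with y h1 h2
    exact h.eq_div_smul h2 h1

include h in
lemma compactSpace [CompactSpace B] [T2Space B] : CompactSpace L := by
  have hK : ∀ b : B, ∃ K : Set B, IsCompact K ∧ K ∈ 𝓝 b ∧ K ⊆ h.trivSet b := fun b => by
    obtain ⟨K, hK, hKb, hKs⟩ := local_compact_nhds ((h.isOpen_trivSet b).mem_nhds (h.mem_trivSet b))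
    exact ⟨K, hKs, hK, hKb⟩
  choose K hKc hKn hKs using hK
  obtain ⟨t, ht⟩ := finite_cover_nhds hKn
  have h1 : ∀ b, IsCompact ((fun y : Circle × B => y.1 • h.localSec b y.2) '' (univ ×ˢ K b)) := by
    intro b
    refine (isCompact_univ.prod (hKc b)).image_of_continuousOn ?_
    have h2 : ContinuousOn (fun y : Circle × B => h.localSec b y.2) (univ ×ˢ K b) :=
      (h.contMDiffOn_localSec b).continuousOn.comp continuousOn_snd fun y hy => hKs b hy.2
    exact h.contMDiff_smul.continuous.comp_continuousOn (continuousOn_fst.prodMk h2)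
  refine ⟨?_⟩
  convert! t.isCompact_biUnion fun b _ => h1 b
  refine (eq_univ_of_forall fun x => ?_).symm
  have h3 : pr x ∈ ⋃ b ∈ t, K b := by rw [ht]; exact mem_univ _
  obtain ⟨b, hb, hxb⟩ := mem_iUnion₂.1 h3
  exact mem_iUnion₂.2 ⟨b, hb, (h.localCoord b x, pr x), ⟨mem_univ _, hxb⟩,
    (h.eq_localCoord_smul (hKs b hxb)).symm⟩

end IsPrincipalCircleBundle

/-! ### Spheres -/

section Spheres

lemma contMDiff_circle_coe : ContMDiff (𝓡 1) 𝓘(ℝ, ℂ) ∞ (fun c : Circle => (c : ℂ)) := by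
  have : Fact (Module.finrank ℝ ℂ = 1 + 1) := finrank_real_complex_fact'
  exact contMDiff_coe_sphere (E := ℂ) (n := 1)

variable {a : ℕ}

/-- The direction of a vector of `ℂ^{a+1}`; the direction of `0` is an arbitrary unit vector. -/
def ComplexSphere.direction (ζ : EuclideanSpace ℂ (Fin (a + 1))) : ComplexSphere a :=
  open Classical in
  if h : ζ = 0 then ⟨EuclideanSpace.single 0 1, by simp⟩ else ⟨‖ζ‖⁻¹ • ζ, by simp [norm_smul, h]⟩

lemma ComplexSphere.coe_direction {ζ : EuclideanSpace ℂ (Fin (a + 1))} (h : ζ ≠ 0) :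
    (ComplexSphere.direction ζ : EuclideanSpace ℂ (Fin (a + 1))) = ‖ζ‖⁻¹ • ζ := by
  rw [ComplexSphere.direction, dif_neg h]

lemma ComplexSphere.direction_smul (z : ComplexSphere a) {r : ℝ} (hr : 0 < r) :
    ComplexSphere.direction (r • (z : EuclideanSpace ℂ (Fin (a + 1)))) = z := by
  have hz : ‖(z : EuclideanSpace ℂ (Fin (a + 1)))‖ = 1 := norm_eq_of_mem_sphere z
  have h0 : (z : EuclideanSpace ℂ (Fin (a + 1))) ≠ 0 := by
    rw [← norm_ne_zero_iff, hz]; exact one_ne_zero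
  refine Subtype.ext ?_
  rw [ComplexSphere.coe_direction (smul_ne_zero hr.ne' h0), norm_smul, hz, mul_one,
    Real.norm_of_nonneg hr.le, smul_smul, inv_mul_cancel₀ hr.ne', one_smul]

lemma ComplexSphere.contMDiffOn_direction :
    ContMDiffOn 𝓘(ℝ, EuclideanSpace ℂ (Fin (a + 1))) (𝓡 (2 * a + 1)) ∞
      (ComplexSphere.direction (a := a)) {0}ᶜ := by
  let U : TopologicalSpace.Opens (EuclideanSpace ℂ (Fin (a + 1))) := ⟨{0}ᶜ, isOpen_compl_singleton⟩
  have h1 : ContMDiff 𝓘(ℝ, EuclideanSpace ℂ (Fin (a + 1))) 𝓘(ℝ, EuclideanSpace ℂ (Fin (a + 1))) ∞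
      (fun ζ : U => ‖(ζ : EuclideanSpace ℂ (Fin (a + 1)))‖⁻¹ •
        (ζ : EuclideanSpace ℂ (Fin (a + 1)))) := by
    intro ζ
    have h2 : ContDiffAt ℝ ∞ (fun ζ : EuclideanSpace ℂ (Fin (a + 1)) => ‖ζ‖⁻¹ • ζ) ζ :=
      ((contDiffAt_norm ℝ ζ.2).inv (norm_ne_zero_iff.2 ζ.2)).smul contDiffAt_id
    exact h2.contMDiffAt.comp ζ contMDiff_subtype_val.contMDiffAt
  have h2 := h1.codRestrict_sphere (n := 2 * a + 1) fun ζ => by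
    have h3 : (ζ : EuclideanSpace ℂ (Fin (a + 1))) ≠ 0 := ζ.2
    simp [norm_smul, h3]
  intro ζ hζ
  refine ContMDiffAt.contMDiffWithinAt ?_
  have h3 := h2.contMDiffAt (x := ⟨ζ, hζ⟩)
  refine (contMDiffAt_subtype_iff (U := U) (x := ⟨ζ, hζ⟩)).1 (h3.congr_of_eventuallyEq
    (Filter.Eventually.of_forall fun ζ' => Subtype.ext ?_))
  exact ComplexSphere.coe_direction ζ'.2

/-- Multiplication by a complex number. -/
def complexSMul (a : ℕ) : ℂ →L[ℝ] EuclideanSpace ℂ (Fin (a + 1)) →L[ℝ]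
    EuclideanSpace ℂ (Fin (a + 1)) :=
  ContinuousLinearMap.lsmul ℝ ℂ

lemma inner_I_smul (v w : EuclideanSpace ℂ (Fin (a + 1))) :
    ⟪Complex.I • v, Complex.I • w⟫_ℝ = ⟪v, w⟫_ℝ := by
  simp only [PiLp.inner_apply, PiLp.smul_apply, smul_eq_mul, Complex.inner]
  refine Finset.sum_congr rfl fun i _ => ?_
  simp

lemma inner_self_I_smul (v : EuclideanSpace ℂ (Fin (a + 1))) : ⟪v, Complex.I • v⟫_ℝ = 0 := by
  simp only [PiLp.inner_apply, PiLp.smul_apply, smul_eq_mul, Complex.inner]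
  refine Finset.sum_eq_zero fun i _ => ?_
  simp
  ring

end Spheres

/-! ### Circle bundles that fibre in spheres -/

/-- The point `c z` of the sphere. -/
def ComplexSphere.rotate {a : ℕ} (c : Circle) (z : ComplexSphere a) : ComplexSphere a :=
  ⟨(c : ℂ) • (z : EuclideanSpace ℂ (Fin (a + 1))), by
    simp [norm_smul, Circle.norm_coe]⟩

lemma contMDiffWithinAt_cons {k : ℕ} {n : Fin (k + 1) → ℕ} {L : Fin (k + 1) → Type*}
    [∀ i, TopologicalSpace (L i)] [∀ i, ChartedSpace (EuclideanSpace ℝ (Fin (2 * n i + 1))) (L i)]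
    {EX : Type*} [NormedAddCommGroup EX] [NormedSpace ℝ EX] {HX : Type*} [TopologicalSpace HX]
    {IX : ModelWithCorners ℝ EX HX} {X : Type*} [TopologicalSpace X] [ChartedSpace HX X]
    {f : X → L 0} {g : ∀ j : Fin k, X → L j.succ} {s : Set X} {x : X}
    (hf : ContMDiffWithinAt IX (𝓡 (2 * n 0 + 1)) ∞ f s x)
    (hg : ∀ j : Fin k, ContMDiffWithinAt IX (𝓡 (2 * n j.succ + 1)) ∞ (g j) s x) :
    ContMDiffWithinAt IX (ModelWithCorners.pi fun i => 𝓡 (2 * n i + 1)) ∞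
      (fun y => (Fin.cons (f y) (fun j => g j y) : ∀ i, L i)) s x :=
  contMDiffWithinAt_pi_iff.2 (Fin.cases hf hg)

section HopfFibres

variable {k d : ℕ} {n : Fin (k + 1) → ℕ} {V L : Fin (k + 1) → Type*} {P : Type*}
  [∀ i, TopologicalSpace (V i)] [∀ i, ChartedSpace (EuclideanSpace ℝ (Fin (2 * n i))) (V i)]
  [∀ i, IsManifold (𝓡 (2 * n i)) ∞ (V i)]
  [∀ i, TopologicalSpace (L i)] [∀ i, ChartedSpace (EuclideanSpace ℝ (Fin (2 * n i + 1))) (L i)]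
  [∀ i, IsManifold (𝓡 (2 * n i + 1)) ∞ (L i)] [∀ i, MulAction Circle (L i)]
  [TopologicalSpace P] [ChartedSpace (EuclideanSpace ℝ (Fin d)) P] [MulAction Circle P]

/-- A circle bundle `P` associated with `∏ L i` through the character `c ↦ ∏ c i ^ q i`, where
`L 0` is the Hopf fibration and `|q 0| = 1`. The projection of `P` to the factors of positive index
is then a bundle of spheres of dimension `2 n 0 + 1`. The map `κ` is the quotient map of the
associated bundle, and `F` identifies the unit sphere of `ℂ^{n 0 + 1}` with `L 0`. -/
structure HopfAssociated (q : Fin (k + 1) → ℤ) (h : ∀ i, SmoothMetric (𝓡 (2 * n i)) (V i))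
    (proj : ∀ i, L i → V i) (ϑ : ∀ i, OneForm (𝓡 (2 * n i + 1)) (L i))
    (pr : P → ∀ i, V i) (θ : OneForm (𝓡 d) P) where
  κ : (∀ i, L i) → P
  F : Diffeomorph (𝓡 (2 * n 0 + 1)) (𝓡 (2 * n 0 + 1)) (ComplexSphere (n 0)) (L 0) ∞
  dim : d = 2 * (∑ i, n i) + 1
  abs_q : |q 0| = 1
  principal : ∀ i, IsPrincipalCircleBundle (𝓡 (2 * n i + 1)) (𝓡 (2 * n i)) (proj i)
  principal_pr : IsPrincipalCircleBundle (𝓡 d) (ModelWithCorners.pi fun i => 𝓡 (2 * n i)) pr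
  contMDiff_form : ∀ i, ContMDiff (𝓡 (2 * n i + 1))
    ((𝓡 (2 * n i + 1)).prod 𝓘(ℝ, EuclideanSpace ℝ (Fin (2 * n i + 1)) →L[ℝ] ℝ)) ∞
    (fun x => (TotalSpace.mk' (EuclideanSpace ℝ (Fin (2 * n i + 1)) →L[ℝ] ℝ) x (ϑ i x) :
      TotalSpace (EuclideanSpace ℝ (Fin (2 * n i + 1)) →L[ℝ] ℝ)
        (fun x : L i => TangentSpace (𝓡 (2 * n i + 1)) x →L[ℝ] ℝ)))
  contMDiff_κ : ContMDiff (ModelWithCorners.pi fun i => 𝓡 (2 * n i + 1)) (𝓡 d) ∞ κ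
  pr_κ : ∀ (l : ∀ i, L i) (i : Fin (k + 1)), pr (κ l) i = proj i (l i)
  κ_smul : ∀ (c : Fin (k + 1) → Circle) (l : ∀ i, L i),
    κ (fun i => c i • l i) = (∏ i, c i ^ q i) • κ l
  θ_κ : ∀ (l : ∀ i, L i) (u : ∀ i, TangentSpace (𝓡 (2 * n i + 1)) (l i)),
    θ (κ l) (mfderiv (ModelWithCorners.pi fun i => 𝓡 (2 * n i + 1)) (𝓡 d) κ l u) =
      ∑ i, (q i : ℝ) * ϑ i (l i) (u i)
  F_smul : ∀ (c : Circle) (z z' : ComplexSphere (n 0)),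
    (z' : EuclideanSpace ℂ (Fin (n 0 + 1))) = (c : ℂ) • (z : EuclideanSpace ℂ (Fin (n 0 + 1))) →
      F z' = c • F z
  form_F : ∀ (z : ComplexSphere (n 0)) (u : TangentSpace (𝓡 (2 * n 0 + 1)) z),
    ϑ 0 (F z) (mfderiv (𝓡 (2 * n 0 + 1)) (𝓡 (2 * n 0 + 1)) F z u) = z.stdForm u
  metric_F : ∀ (z : ComplexSphere (n 0)) (u v : TangentSpace (𝓡 (2 * n 0 + 1)) z),
    (h 0).inner (proj 0 (F z))
        (mfderiv (𝓡 (2 * n 0 + 1)) (𝓡 (2 * n 0)) (fun y : ComplexSphere (n 0) => proj 0 (F y)) z u)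
        (mfderiv (𝓡 (2 * n 0 + 1)) (𝓡 (2 * n 0)) (fun y : ComplexSphere (n 0) => proj 0 (F y)) z v)
      = 2 * (⟪z.tangentCoe u, z.tangentCoe v⟫_ℝ - z.stdForm u * z.stdForm v)

namespace HopfAssociated

variable {q : Fin (k + 1) → ℤ} {h : ∀ i, SmoothMetric (𝓡 (2 * n i)) (V i)}
  {proj : ∀ i, L i → V i} {ϑ : ∀ i, OneForm (𝓡 (2 * n i + 1)) (L i)}
  {pr : P → ∀ i, V i} {θ : OneForm (𝓡 d) P} (D : HopfAssociated q h proj ϑ pr θ)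

include D in
lemma q_zero_mul_self : q 0 * q 0 = 1 := by
  rw [← abs_mul_abs_self, D.abs_q, mul_one]

include D in
lemma zpow_zpow (c : Circle) : (c ^ q 0) ^ q 0 = c := by
  rw [← zpow_mul, D.q_zero_mul_self, zpow_one]

include D in
lemma contMDiff_zpow : ContMDiff (𝓡 1) (𝓡 1) ∞ fun c : Circle => c ^ q 0 := by
  have : LieGroup (𝓡 1) ∞ Circle := LieGroup.of_le (n := ω) le_top
  rcases (abs_eq zero_le_one).1 D.abs_q with h | h
  · simpa [h] using! contMDiff_id
  · simpa [h] using contMDiff_inv (𝓡 1) ∞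

/-- The product of the neighbourhoods over which the bundles `L j` are trivial, `j ≠ 0`. -/
def trivSet (b : ∀ j : Fin k, V j.succ) : Set (∀ j : Fin k, V j.succ) :=
  {y | ∀ j, y j ∈ (D.principal j.succ).trivSet (b j)}

/-- The local sections of the bundles `L j`, `j ≠ 0`. -/
def sec (b : ∀ j : Fin k, V j.succ) (j : Fin k) : V j.succ → L j.succ :=
  (D.principal j.succ).localSec (b j)

lemma isOpen_trivSet (b : ∀ j : Fin k, V j.succ) : IsOpen (D.trivSet b) := by
  have h1 : D.trivSet b = univ.pi fun j => (D.principal j.succ).trivSet (b j) := by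
    ext y
    simp [trivSet]
  rw [h1]
  exact isOpen_set_pi finite_univ fun j _ => (D.principal j.succ).isOpen_trivSet (b j)

lemma mem_trivSet (b : ∀ j : Fin k, V j.succ) : b ∈ D.trivSet b :=
  fun j => (D.principal j.succ).mem_trivSet (b j)

lemma contMDiffAt_sec {b y : ∀ j : Fin k, V j.succ} (hy : y ∈ D.trivSet b) (j : Fin k) :
    ContMDiffAt (𝓡 (2 * n j.succ)) (𝓡 (2 * n j.succ + 1)) ∞ (D.sec b j) (y j) :=
  ((D.principal j.succ).contMDiffOn_localSec (b j)).contMDiffAt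
    (((D.principal j.succ).isOpen_trivSet (b j)).mem_nhds (hy j))

lemma proj_sec {b y : ∀ j : Fin k, V j.succ} (hy : y ∈ D.trivSet b) (j : Fin k) :
    proj j.succ (D.sec b j (y j)) = y j :=
  (D.principal j.succ).proj_localSec (hy j)

/-- The point of `∏ L i` with the components `F z` and `sec b j (y j)`. -/
def tuple (b : ∀ j : Fin k, V j.succ) (z : ComplexSphere (n 0)) (y : ∀ j : Fin k, V j.succ) :
    ∀ i, L i :=
  Fin.cons (D.F z) fun j => D.sec b j (y j)

/-- The point over `y` of the bundle of spheres which corresponds to `z`. -/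
def lift (b : ∀ j : Fin k, V j.succ) (z : ComplexSphere (n 0)) (y : ∀ j : Fin k, V j.succ) : P :=
  D.κ (D.tuple b z y)

include D in
lemma contMDiff_base : ContMDiff (𝓡 d) (ModelWithCorners.pi fun j : Fin k => 𝓡 (2 * n j.succ)) ∞
    (fun (x : P) (j : Fin k) => pr x j.succ) :=
  contMDiff_pi_iff.2 fun j => contMDiff_pi_iff.1 D.principal_pr.contMDiff_proj j.succ

lemma pr_lift_zero (b : ∀ j : Fin k, V j.succ) (z : ComplexSphere (n 0))
    (y : ∀ j : Fin k, V j.succ) : pr (D.lift b z y) 0 = proj 0 (D.F z) :=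
  D.pr_κ _ 0

lemma pr_lift_succ {b y : ∀ j : Fin k, V j.succ} (hy : y ∈ D.trivSet b) (z : ComplexSphere (n 0))
    (j : Fin k) : pr (D.lift b z y) j.succ = y j :=
  (D.pr_κ _ j.succ).trans (D.proj_sec hy j)

/-- The action of the torus on the image of a point with given components. -/
lemma κ_cons_smul (c₀ : Circle) (c : Fin k → Circle) (l₀ : L 0) (l : ∀ j : Fin k, L j.succ) :
    D.κ (Fin.cons (c₀ • l₀) fun j => c j • l j) =
      (c₀ ^ q 0 * ∏ j, c j ^ q j.succ) • D.κ (Fin.cons l₀ l) := by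
  have h1 := D.κ_smul (Fin.cons c₀ c) (Fin.cons l₀ l)
  rw [Fin.prod_univ_succ] at h1
  refine Eq.trans (congrArg D.κ (funext (Fin.cases rfl fun j => rfl))) h1

lemma κ_cons_smul_zero (c₀ : Circle) (l₀ : L 0) (l : ∀ j : Fin k, L j.succ) :
    D.κ (Fin.cons (c₀ • l₀) l) = c₀ ^ q 0 • D.κ (Fin.cons l₀ l) := by
  simpa using D.κ_cons_smul c₀ 1 l₀ l

lemma F_rotate (c : Circle) (z : ComplexSphere (n 0)) : D.F (z.rotate c) = c • D.F z :=
  D.F_smul c z _ rfl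

lemma lift_injective (b y : ∀ j : Fin k, V j.succ) {z z' : ComplexSphere (n 0)}
    (hz : D.lift b z y = D.lift b z' y) : z = z' := by
  have h1 : proj 0 (D.F z) = proj 0 (D.F z') := by
    rw [← D.pr_lift_zero b z y, hz, D.pr_lift_zero]
  obtain ⟨c, hc⟩ := (D.principal 0).exists_eq_smul h1
  have h2 : D.lift b z y = c ^ q 0 • D.lift b z' y := by
    rw [lift, tuple, hc]
    exact D.κ_cons_smul_zero _ _ _
  have h3 : c ^ q 0 = 1 := D.principal_pr.free _ _ (h2.symm.trans hz)
  have h4 : c = 1 := by rw [← D.zpow_zpow c, h3, one_zpow]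
  rw [h4, one_smul] at hc
  exact D.F.injective hc

lemma lift_zpow_smul {b : ∀ j : Fin k, V j.succ} {x : P} {l₀ : L 0} {c : Circle}
    (hc : x = c • D.κ (Fin.cons l₀ fun j => D.sec b j (pr x j.succ))) :
    D.lift b (D.F.symm (c ^ q 0 • l₀)) (fun j => pr x j.succ) = x := by
  rw [lift, tuple, D.F.apply_symm_apply]
  refine (D.κ_cons_smul_zero _ _ _).trans ?_
  rw [D.zpow_zpow]
  exact hc.symm

/-- The point of the sphere which corresponds to `x`, with an arbitrary value if there is none. -/
def dir (b : ∀ j : Fin k, V j.succ) (x : P) : ComplexSphere (n 0) :=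
  open Classical in
  if h : ∃ z, D.lift b z (fun j => pr x j.succ) = x then h.choose else ComplexSphere.direction 0

lemma eq_dir {b : ∀ j : Fin k, V j.succ} {x : P} {z : ComplexSphere (n 0)}
    (hz : D.lift b z (fun j => pr x j.succ) = x) : D.dir b x = z := by
  have h1 : ∃ z, D.lift b z (fun j => pr x j.succ) = x := ⟨z, hz⟩
  rw [dir, dif_pos h1]
  exact D.lift_injective b _ (h1.choose_spec.trans hz.symm)

/-- Over `trivSet b`, the bundle `P` is trivialized by a map which is smooth because it is the
quotient of two smooth local sections of a principal circle bundle. -/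
lemma contMDiffAt_dir_and_lift {b : ∀ j : Fin k, V j.succ} {x : P}
    (hx : (fun j : Fin k => pr x j.succ) ∈ D.trivSet b) :
    ContMDiffAt (𝓡 d) (𝓡 (2 * n 0 + 1)) ∞ (D.dir b) x ∧
      D.lift b (D.dir b x) (fun j => pr x j.succ) = x := by
  have hpr : ∀ i, ContMDiff (𝓡 d) (𝓡 (2 * n i)) ∞ fun y => pr y i :=
    contMDiff_pi_iff.1 D.principal_pr.contMDiff_proj
  have hU : ∀ᶠ y in 𝓝 x, (fun j : Fin k => pr y j.succ) ∈ D.trivSet b :=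
    ((D.isOpen_trivSet b).preimage D.contMDiff_base.continuous).mem_nhds hx
  have hU₀ : ∀ᶠ y in 𝓝 x, pr y 0 ∈ (D.principal 0).trivSet (pr x 0) :=
    (((D.principal 0).isOpen_trivSet _).preimage (hpr 0).continuous).mem_nhds
      ((D.principal 0).mem_trivSet _)
  let σ : P → L 0 := fun y => (D.principal 0).localSec (pr x 0) (pr y 0)
  have hσ : ContMDiffAt (𝓡 d) (𝓡 (2 * n 0 + 1)) ∞ σ x :=
    (((D.principal 0).contMDiffOn_localSec (pr x 0)).contMDiffAt
      (((D.principal 0).isOpen_trivSet _).mem_nhds ((D.principal 0).mem_trivSet _))).comp x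
        (hpr 0 x)
  let l : P → ∀ i, L i := fun y => Fin.cons (σ y) fun j => D.sec b j (pr y j.succ)
  have hl : ContMDiffAt (𝓡 d) (ModelWithCorners.pi fun i => 𝓡 (2 * n i + 1)) ∞ l x := by
    refine contMDiffWithinAt_cons (g := fun j y => D.sec b j (pr y j.succ)) hσ fun j => ?_
    exact ContMDiffAt.comp x (D.contMDiffAt_sec hx j) (hpr j.succ x)
  have hκ : ContMDiffAt (𝓡 d) (𝓡 d) ∞ (fun y => D.κ (l y)) x := D.contMDiff_κ.contMDiffAt.comp x hl
  have hprκ : ∀ᶠ y in 𝓝 x, pr y = pr (D.κ (l y)) := by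
    filter_upwards [hU, hU₀] with y h1 h2
    refine funext (Fin.cases ?_ fun j => ?_)
    · exact ((D.pr_κ (l y) 0).trans ((D.principal 0).proj_localSec h2)).symm
    · exact ((D.pr_κ (l y) j.succ).trans (D.proj_sec h1 j)).symm
  obtain ⟨c, hc, hcx⟩ := D.principal_pr.exists_contMDiffAt_smul contMDiffAt_id hκ hprκ
  have h1 : ∀ᶠ y in 𝓝 x,
      D.lift b (D.F.symm (c y ^ q 0 • σ y)) (fun j => pr y j.succ) = y := by
    filter_upwards [hcx] with y h3
    exact D.lift_zpow_smul h3
  have h2 : ContMDiffAt (𝓡 d) (𝓡 (2 * n 0 + 1)) ∞ (fun y => D.F.symm (c y ^ q 0 • σ y)) x := by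
    have h3 : ContMDiffAt (𝓡 d) (𝓡 1) ∞ (fun y => c y ^ q 0) x :=
      D.contMDiff_zpow.contMDiffAt.comp x hc
    have h4 : ContMDiffAt (𝓡 d) (𝓡 (2 * n 0 + 1)) ∞ (fun y => c y ^ q 0 • σ y) x :=
      (D.principal 0).contMDiff_smul.contMDiffAt.comp x (h3.prodMk hσ)
    exact D.F.symm.contMDiff.contMDiffAt.comp x h4
  refine ⟨h2.congr_of_eventuallyEq (h1.mono fun y hy => D.eq_dir hy), ?_⟩
  rw [D.eq_dir h1.self_of_nhds]
  exact h1.self_of_nhds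

lemma contMDiffAt_dir {b : ∀ j : Fin k, V j.succ} {x : P}
    (hx : (fun j : Fin k => pr x j.succ) ∈ D.trivSet b) :
    ContMDiffAt (𝓡 d) (𝓡 (2 * n 0 + 1)) ∞ (D.dir b) x := (D.contMDiffAt_dir_and_lift hx).1

lemma lift_dir {b : ∀ j : Fin k, V j.succ} {x : P}
    (hx : (fun j : Fin k => pr x j.succ) ∈ D.trivSet b) :
    D.lift b (D.dir b x) (fun j => pr x j.succ) = x := (D.contMDiffAt_dir_and_lift hx).2

lemma dir_lift {b y : ∀ j : Fin k, V j.succ} (hy : y ∈ D.trivSet b) (z : ComplexSphere (n 0)) :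
    D.dir b (D.lift b z y) = z := by
  refine D.eq_dir ?_
  have h1 : (fun j : Fin k => pr (D.lift b z y) j.succ) = y := funext fun j => D.pr_lift_succ hy z j
  rw [h1]

/-- The transition function between the trivializations of index `b` and `b'`. -/
def transCircle (b b' y : ∀ j : Fin k, V j.succ) : Circle :=
  (∏ j, (D.principal j.succ).localCoord (b' j) (D.sec b j (y j)) ^ q j.succ) ^ q 0

lemma dir_eq_rotate {b b' : ∀ j : Fin k, V j.succ} {x : P}
    (hx : (fun j : Fin k => pr x j.succ) ∈ D.trivSet b)
    (hx' : (fun j : Fin k => pr x j.succ) ∈ D.trivSet b') :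
    D.dir b' x = (D.dir b x).rotate (D.transCircle b b' fun j => pr x j.succ) := by
  refine D.eq_dir (Eq.trans ?_ (D.lift_dir hx))
  have h1 : ∀ j : Fin k, D.sec b j (pr x j.succ) =
      (D.principal j.succ).localCoord (b' j) (D.sec b j (pr x j.succ)) •
        D.sec b' j (pr x j.succ) := fun j => by
    have h2 := (D.principal j.succ).eq_localCoord_smul (b := b' j) (x := D.sec b j (pr x j.succ))
      (by rw [D.proj_sec hx j]; exact hx' j)
    rwa [D.proj_sec hx j] at h2
  have h3 : D.lift b (D.dir b x) (fun j => pr x j.succ) = D.κ (Fin.cons ((1 : Circle) •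
      D.F (D.dir b x)) fun j => (D.principal j.succ).localCoord (b' j) (D.sec b j (pr x j.succ)) •
        D.sec b' j (pr x j.succ)) := by
    rw [one_smul, lift, tuple]
    exact congrArg (fun l : ∀ j : Fin k, L j.succ => D.κ (Fin.cons _ l)) (funext h1)
  rw [h3, D.κ_cons_smul, lift, tuple, F_rotate, D.κ_cons_smul_zero, transCircle, D.zpow_zpow,
    one_zpow, one_mul]

lemma contMDiffOn_transCircle (b b' : ∀ j : Fin k, V j.succ) :
    ContMDiffOn (ModelWithCorners.pi fun j : Fin k => 𝓡 (2 * n j.succ)) (𝓡 1) ∞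
      (D.transCircle b b') (D.trivSet b ∩ D.trivSet b') := by
  have : LieGroup (𝓡 1) ∞ Circle := LieGroup.of_le (n := ω) le_top
  rintro y ⟨hy, hy'⟩
  refine ContMDiffAt.contMDiffWithinAt ?_
  refine ContMDiffAt.comp y D.contMDiff_zpow.contMDiffAt ?_
  refine ContMDiffAt.prod fun j _ => ?_
  have h1 : ContMDiffAt (ModelWithCorners.pi fun j : Fin k => 𝓡 (2 * n j.succ))
      (𝓡 (2 * n j.succ + 1)) ∞ (fun y : ∀ j : Fin k, V j.succ => D.sec b j (y j)) y :=
    ContMDiffAt.comp y (D.contMDiffAt_sec hy j) (contMDiff_eval j).contMDiffAt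
  have h2 : ContMDiffAt (𝓡 (2 * n j.succ + 1)) (𝓡 1) ∞ ((D.principal j.succ).localCoord (b' j))
      (D.sec b j (y j)) :=
    ((D.principal j.succ).contMDiffOn_localCoord (b' j)).contMDiffAt
      ((((D.principal j.succ).isOpen_trivSet (b' j)).preimage
        (D.principal j.succ).contMDiff_proj.continuous).mem_nhds
          (by rw [mem_preimage, D.proj_sec hy j]; exact hy' j))
  have h3 := ContMDiffAt.comp y h2 h1
  have h4 : ContMDiff (𝓡 1) (𝓡 1) ∞ fun c : Circle => c ^ q j.succ := by
    rcases q j.succ with m | m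
    · simpa using contMDiff_pow (I := 𝓡 1) (n := ∞) (G := Circle) m
    · simpa using (contMDiff_pow (I := 𝓡 1) (n := ∞) (G := Circle) (m + 1)).inv
  exact ContMDiffAt.comp y h4.contMDiffAt h3

end HopfAssociated

end HopfFibres

/-! ### The sphere bundle and its geometry -/

section HopfFibresGeometry

variable {k d : ℕ} {n : Fin (k + 1) → ℕ} {V L : Fin (k + 1) → Type*} {P : Type*}
  [∀ i, TopologicalSpace (V i)] [∀ i, ChartedSpace (EuclideanSpace ℝ (Fin (2 * n i))) (V i)]
  [∀ i, IsManifold (𝓡 (2 * n i)) ∞ (V i)]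
  [∀ i, TopologicalSpace (L i)] [∀ i, ChartedSpace (EuclideanSpace ℝ (Fin (2 * n i + 1))) (L i)]
  [∀ i, IsManifold (𝓡 (2 * n i + 1)) ∞ (L i)] [∀ i, MulAction Circle (L i)]
  [TopologicalSpace P] [ChartedSpace (EuclideanSpace ℝ (Fin d)) P] [MulAction Circle P]

namespace HopfAssociated

variable {q : Fin (k + 1) → ℤ} {h : ∀ i, SmoothMetric (𝓡 (2 * n i)) (V i)}
  {proj : ∀ i, L i → V i} {ϑ : ∀ i, OneForm (𝓡 (2 * n i + 1)) (L i)}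
  {pr : P → ∀ i, V i} {θ : OneForm (𝓡 d) P} (D : HopfAssociated q h proj ϑ pr θ)

lemma contMDiffAt_coe_dir {b : ∀ j : Fin k, V j.succ} {x : P}
    (hx : (fun j : Fin k => pr x j.succ) ∈ D.trivSet b) :
    ContMDiffAt (𝓡 d) 𝓘(ℝ, EuclideanSpace ℂ (Fin (n 0 + 1))) ∞
      (fun x => (D.dir b x : EuclideanSpace ℂ (Fin (n 0 + 1)))) x :=
  ContMDiffAt.comp x (contMDiff_coe_sphere (n := 2 * n 0 + 1)).contMDiffAt (D.contMDiffAt_dir hx)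

lemma contMDiffOn_lift_direction (b : ∀ j : Fin k, V j.succ) :
    ContMDiffOn ((ModelWithCorners.pi fun j : Fin k => 𝓡 (2 * n j.succ)).prod
        𝓘(ℝ, EuclideanSpace ℂ (Fin (n 0 + 1)))) (𝓡 d) ∞
      (fun y : (∀ j : Fin k, V j.succ) × EuclideanSpace ℂ (Fin (n 0 + 1)) =>
        D.lift b (ComplexSphere.direction y.2) y.1) (D.trivSet b ×ˢ {0}ᶜ) := by
  rintro ⟨y, ζ⟩ ⟨hy, hζ⟩
  refine ContMDiffAt.comp_contMDiffWithinAt _ D.contMDiff_κ.contMDiffAt ?_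
  refine contMDiffWithinAt_cons (g := fun j
    (y : (∀ j : Fin k, V j.succ) × EuclideanSpace ℂ (Fin (n 0 + 1))) => D.sec b j (y.1 j)) ?_ ?_
  · refine ContMDiffAt.comp_contMDiffWithinAt _ D.F.contMDiff.contMDiffAt ?_
    have h1 : ContMDiffAt 𝓘(ℝ, EuclideanSpace ℂ (Fin (n 0 + 1))) (𝓡 (2 * n 0 + 1)) ∞
        (ComplexSphere.direction (a := n 0)) ζ :=
      ComplexSphere.contMDiffOn_direction.contMDiffAt (isOpen_compl_singleton.mem_nhds hζ)
    have h2 : ContMDiffAt ((ModelWithCorners.pi fun j : Fin k => 𝓡 (2 * n j.succ)).prod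
        𝓘(ℝ, EuclideanSpace ℂ (Fin (n 0 + 1)))) 𝓘(ℝ, EuclideanSpace ℂ (Fin (n 0 + 1))) ∞
        (fun y : (∀ j : Fin k, V j.succ) × EuclideanSpace ℂ (Fin (n 0 + 1)) => y.2) (y, ζ) :=
      contMDiffAt_snd
    exact (ContMDiffAt.comp (y, ζ) h1 h2).contMDiffWithinAt
  · intro j
    have h1 : ContMDiffAt ((ModelWithCorners.pi fun j : Fin k => 𝓡 (2 * n j.succ)).prod
        𝓘(ℝ, EuclideanSpace ℂ (Fin (n 0 + 1)))) (𝓡 (2 * n j.succ)) ∞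
        (fun y : (∀ j : Fin k, V j.succ) × EuclideanSpace ℂ (Fin (n 0 + 1)) => y.1 j) (y, ζ) :=
      ContMDiffAt.comp (y, ζ) (contMDiff_eval j).contMDiffAt contMDiffAt_fst
    exact (ContMDiffAt.comp (y, ζ) (D.contMDiffAt_sec hy j) h1).contMDiffWithinAt

/-- `P` as a bundle of spheres in `ℂ^{n 0 + 1}` over the product of the factors of positive
index. -/
def sphereBundle : SphereBundle d P (ModelWithCorners.pi fun j : Fin k => 𝓡 (2 * n j.succ))
    (∀ j : Fin k, V j.succ) (EuclideanSpace ℂ (Fin (n 0 + 1))) where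
  model := ContinuousLinearEquiv.ofFinrankEq (by
    have h1 := (fact_finrank_complexEuclidean (n 0)).out
    rw [Module.finrank_prod, Module.finrank_prod, h1, Module.finrank_pi_fintype]
    simp only [finrank_euclideanSpace, Fintype.card_fin, Module.finrank_self, D.dim,
      Fin.sum_univ_succ, ← Finset.mul_sum]
    ring)
  proj x j := pr x j.succ
  U := D.trivSet
  coord b x := (D.dir b x : EuclideanSpace ℂ (Fin (n 0 + 1)))
  param b y ζ := D.lift b (ComplexSphere.direction ζ) y
  trans b b' y := complexSMul (n 0) (D.transCircle b b' y : ℂ)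
  contMDiff_proj := D.contMDiff_base
  surjective_proj y := by
    choose l hl using fun j => (⟨_, D.proj_sec (D.mem_trivSet y) j⟩ :
      ∃ l : L j.succ, proj j.succ l = y j)
    exact ⟨D.κ (Fin.cons (D.F (ComplexSphere.direction 0)) l),
      funext fun j => (D.pr_κ _ j.succ).trans (hl j)⟩
  isOpen_U := D.isOpen_trivSet
  mem_U := D.mem_trivSet
  norm_coord b x _ := norm_eq_of_mem_sphere (D.dir b x)
  contMDiffOn_coord b x hx := (D.contMDiffAt_coe_dir hx).contMDiffWithinAt
  contMDiffOn_param := D.contMDiffOn_lift_direction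
  proj_param b y hy ζ _ := funext fun j => D.pr_lift_succ hy _ j
  coord_param b y hy ζ hζ := by rw [D.dir_lift hy, ComplexSphere.coe_direction hζ]
  param_coord b x hx r hr := by
    rw [ComplexSphere.direction_smul _ hr]
    exact D.lift_dir hx
  contMDiffOn_trans b b' := by
    have h1 : ContMDiffOn (ModelWithCorners.pi fun j : Fin k => 𝓡 (2 * n j.succ)) 𝓘(ℝ, ℂ) ∞
        (fun y => (D.transCircle b b' y : ℂ)) (D.trivSet b ∩ D.trivSet b') :=
      contMDiff_circle_coe.comp_contMDiffOn (D.contMDiffOn_transCircle b b')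
    exact (complexSMul (n 0)).contDiff.contMDiff.comp_contMDiffOn h1
  trans_coord b b' x hx hx' := by
    rw [D.dir_eq_rotate hx hx']
    rfl

lemma tangentCoe_mfderiv_dir {b : ∀ j : Fin k, V j.succ} {x : P}
    (hx : (fun j : Fin k => pr x j.succ) ∈ D.trivSet b) (u : TangentSpace (𝓡 d) x) :
    (D.dir b x).tangentCoe (mfderiv (𝓡 d) (𝓡 (2 * n 0 + 1)) (D.dir b) x u) =
      vecDeriv (𝓡 d) (fun x => (D.dir b x : EuclideanSpace ℂ (Fin (n 0 + 1)))) x u :=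
  (vecDeriv_comp ((contMDiff_coe_sphere (n := 2 * n 0 + 1) (m := ∞)).mdifferentiableAt (by simp))
    ((D.contMDiffAt_dir hx).mdifferentiableAt (by simp)) u).symm

/-- The connection form in a trivialization: `P` is the image of `∏ L i`, and the potentials of the
connections of `L j`, `j ≠ 0`, are the pull-backs by the local sections. -/
lemma form_eq {b : ∀ j : Fin k, V j.succ} {x : P}
    (hx : (fun j : Fin k => pr x j.succ) ∈ D.trivSet b) (u : TangentSpace (𝓡 d) x) :
    θ x u = (q 0 : ℝ) * ⟪complexSMul (n 0) Complex.I (D.dir b x),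
        vecDeriv (𝓡 d) (fun x => (D.dir b x : EuclideanSpace ℂ (Fin (n 0 + 1)))) x u⟫_ℝ +
      ∑ j : Fin k, (q j.succ : ℝ) * ϑ j.succ (D.sec b j (pr x j.succ))
        (mfderiv (𝓡 d) (𝓡 (2 * n j.succ + 1)) (fun y => D.sec b j (pr y j.succ)) x u) := by
  let l : P → ∀ i, L i := fun y => D.tuple b (D.dir b y) fun j => pr y j.succ
  have hl0 : ContMDiffAt (𝓡 d) (𝓡 (2 * n 0 + 1)) ∞ (fun y => D.F (D.dir b y)) x :=
    D.F.contMDiff.contMDiffAt.comp x (D.contMDiffAt_dir hx)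
  have hlj : ∀ j : Fin k, ContMDiffAt (𝓡 d) (𝓡 (2 * n j.succ + 1)) ∞
      (fun y => D.sec b j (pr y j.succ)) x := fun j =>
    ContMDiffAt.comp x (D.contMDiffAt_sec hx j)
      (contMDiff_pi_iff.1 D.principal_pr.contMDiff_proj j.succ x)
  have hl : MDifferentiableAt (𝓡 d) (ModelWithCorners.pi fun i => 𝓡 (2 * n i + 1)) l x :=
    ContMDiffAt.mdifferentiableAt (n := ∞)
      (contMDiffWithinAt_cons (g := fun j y => D.sec b j (pr y j.succ)) hl0 hlj) (by simp)
  have hκl : (fun y => D.κ (l y)) =ᶠ[𝓝 x] id := by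
    filter_upwards [((D.isOpen_trivSet b).preimage D.contMDiff_base.continuous).mem_nhds hx]
      with y hy
    exact D.lift_dir hy
  have hκ : MDifferentiableAt (ModelWithCorners.pi fun i => 𝓡 (2 * n i + 1)) (𝓡 d) D.κ (l x) :=
    D.contMDiff_κ.mdifferentiableAt (by simp)
  have h1 : mfderiv (ModelWithCorners.pi fun i => 𝓡 (2 * n i + 1)) (𝓡 d) D.κ (l x)
      (mfderiv (𝓡 d) (ModelWithCorners.pi fun i => 𝓡 (2 * n i + 1)) l x u) = u := by
    refine (mfderiv_comp_apply x hκ hl u).symm.trans ?_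
    have h2 := (hκl.mfderiv_eq (I := 𝓡 d) (I' := 𝓡 d)).trans mfderiv_id
    exact congrArg (fun f : EuclideanSpace ℝ (Fin d) →L[ℝ] EuclideanSpace ℝ (Fin d) => f u) h2
  let t : P → EuclideanSpace ℝ (Fin d) →L[ℝ] ℝ := fun y => θ y
  have h3 : t x u = t (D.κ (l x)) u :=
    congrArg (fun y => t y u) (hκl.self_of_nhds).symm
  refine h3.trans ((congrArg (fun u => t (D.κ (l x)) u) h1).symm.trans
    ((D.θ_κ (l x) (mfderiv (𝓡 d) (ModelWithCorners.pi fun i => 𝓡 (2 * n i + 1)) l x u)).trans ?_))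
  rw [Fin.sum_univ_succ]
  refine congrArg₂ (· + ·) (congrArg (fun r => (q 0 : ℝ) * r) ?_)
    (Finset.sum_congr rfl fun j _ => congrArg (fun r => (q j.succ : ℝ) * r) ?_)
  · refine Eq.trans (congrArg (fun u => ϑ 0 (l x 0) u) (mfderiv_apply_pi hl 0 u).symm) ?_
    have h4 := mfderiv_comp_apply (I := 𝓡 d) (I' := 𝓡 (2 * n 0 + 1)) (I'' := 𝓡 (2 * n 0 + 1))
      x (D.F.contMDiff.mdifferentiableAt (by simp))
      ((D.contMDiffAt_dir hx).mdifferentiableAt (by simp)) u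
    refine Eq.trans (congrArg (fun u => ϑ 0 (D.F (D.dir b x)) u) h4) ?_
    refine (D.form_F _ _).trans ?_
    exact congrArg (fun w => ⟪Complex.I • (D.dir b x : EuclideanSpace ℂ (Fin (n 0 + 1))), w⟫_ℝ)
      (D.tangentCoe_mfderiv_dir hx u)
  · exact congrArg (fun u => ϑ j.succ (l x j.succ) u) (mfderiv_apply_pi hl j.succ u).symm

/-- In a trivialization, the pull-back of the metric of the base of the Hopf fibration is twice the
horizontal part of the round metric of the sphere. -/
lemma metric_zero_eq {b : ∀ j : Fin k, V j.succ} {x : P}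
    (hx : (fun j : Fin k => pr x j.succ) ∈ D.trivSet b) (u v : TangentSpace (𝓡 d) x) :
    (h 0).inner (pr x 0) (mfderiv (𝓡 d) (𝓡 (2 * n 0)) (fun y => pr y 0) x u)
        (mfderiv (𝓡 d) (𝓡 (2 * n 0)) (fun y => pr y 0) x v) =
      2 * (⟪vecDeriv (𝓡 d) (fun x => (D.dir b x : EuclideanSpace ℂ (Fin (n 0 + 1)))) x u,
          vecDeriv (𝓡 d) (fun x => (D.dir b x : EuclideanSpace ℂ (Fin (n 0 + 1)))) x v⟫_ℝ -
        ⟪complexSMul (n 0) Complex.I (D.dir b x),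
          vecDeriv (𝓡 d) (fun x => (D.dir b x : EuclideanSpace ℂ (Fin (n 0 + 1)))) x u⟫_ℝ *
        ⟪complexSMul (n 0) Complex.I (D.dir b x),
          vecDeriv (𝓡 d) (fun x => (D.dir b x : EuclideanSpace ℂ (Fin (n 0 + 1)))) x v⟫_ℝ) := by
  have hF : ContMDiff (𝓡 (2 * n 0 + 1)) (𝓡 (2 * n 0)) ∞ (fun z => proj 0 (D.F z)) :=
    (D.principal 0).contMDiff_proj.comp D.F.contMDiff
  have h1 : (fun y => pr y 0) =ᶠ[𝓝 x] fun y => proj 0 (D.F (D.dir b y)) := by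
    filter_upwards [((D.isOpen_trivSet b).preimage D.contMDiff_base.continuous).mem_nhds hx]
      with y hy
    exact (congrArg (fun x => pr x 0) (D.lift_dir hy)).symm.trans (D.pr_lift_zero b _ _)
  have h2 : ∀ u : TangentSpace (𝓡 d) x,
      (mfderiv (𝓡 d) (𝓡 (2 * n 0)) (fun y => pr y 0) x u : EuclideanSpace ℝ (Fin (2 * n 0))) =
        mfderiv (𝓡 (2 * n 0 + 1)) (𝓡 (2 * n 0)) (fun z => proj 0 (D.F z)) (D.dir b x)
          (mfderiv (𝓡 d) (𝓡 (2 * n 0 + 1)) (D.dir b) x u) := fun u => by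
    have h3 := h1.mfderiv_eq (I := 𝓡 d) (I' := 𝓡 (2 * n 0))
    refine (congrArg (fun f : EuclideanSpace ℝ (Fin d) →L[ℝ] EuclideanSpace ℝ (Fin (2 * n 0)) =>
      f u) h3).trans ?_
    exact mfderiv_comp_apply (I := 𝓡 d) (I' := 𝓡 (2 * n 0 + 1)) (I'' := 𝓡 (2 * n 0))
      x (hF.mdifferentiableAt (by simp)) ((D.contMDiffAt_dir hx).mdifferentiableAt (by simp)) u
  let t : V 0 → EuclideanSpace ℝ (Fin (2 * n 0)) →L[ℝ] EuclideanSpace ℝ (Fin (2 * n 0)) →L[ℝ] ℝ :=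
    fun y => (h 0).inner y
  have h3 : t (pr x 0) = t (proj 0 (D.F (D.dir b x))) := congrArg t h1.self_of_nhds
  refine (congrArg₂ (fun (f : _ →L[ℝ] ℝ) w => f w)
    (congrArg₂ (fun (f : _ →L[ℝ] _ →L[ℝ] ℝ) w => f w) h3 (h2 u)) (h2 v)).trans ?_
  refine (D.metric_F _ _ _).trans ?_
  have h4 : ∀ u : TangentSpace (𝓡 d) x,
      (D.dir b x).stdForm (mfderiv (𝓡 d) (𝓡 (2 * n 0 + 1)) (D.dir b) x u) =
        ⟪complexSMul (n 0) Complex.I (D.dir b x),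
          vecDeriv (𝓡 d) (fun x => (D.dir b x : EuclideanSpace ℂ (Fin (n 0 + 1)))) x u⟫_ℝ :=
    fun u => congrArg
      (fun w => ⟪Complex.I • (D.dir b x : EuclideanSpace ℂ (Fin (n 0 + 1))), w⟫_ℝ)
      (D.tangentCoe_mfderiv_dir hx u)
  exact congrArg (fun r => 2 * r) (congrArg₂ (· - ·)
    (congrArg₂ (fun v w => ⟪v, w⟫_ℝ) (D.tangentCoe_mfderiv_dir hx u)
      (D.tangentCoe_mfderiv_dir hx v)) (congrArg₂ (· * ·) (h4 u) (h4 v)))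

/-- The geometry of the bundle of spheres `P`. -/
def geometry : D.sphereBundle.Geometry (fun j : Fin k => 2 * n j.succ + 1)
    (fun j : Fin k => L j.succ) where
  J := complexSMul (n 0) Complex.I
  inner_J := inner_I_smul
  inner_self_J := inner_self_I_smul
  metric j := h j.succ
  form j := ϑ j.succ
  contMDiff_form j := D.contMDiff_form j.succ
  weight j := q j.succ
  sec := D.sec
  contMDiffAt_sec _ _ hy j := D.contMDiffAt_sec hy j
  sign := q 0
  sign_sq := by exact_mod_cast (sq (q 0)).trans D.q_zero_mul_self
  θ := θ
  fibreForm x u v := (h 0).inner (pr x 0) (mfderiv (𝓡 d) (𝓡 (2 * n 0)) (fun y => pr y 0) x u)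
    (mfderiv (𝓡 d) (𝓡 (2 * n 0)) (fun y => pr y 0) x v)
  θ_apply _ _ hx u := D.form_eq hx u
  fibreForm_apply _ _ hx u v := D.metric_zero_eq hx u v

end HopfAssociated

end HopfFibresGeometry

/-! ### The compactification -/

section Compactification

variable {k d : ℕ} {n : Fin (k + 1) → ℕ} {V L : Fin (k + 1) → Type*} {P : Type*}
  [∀ i, TopologicalSpace (V i)] [∀ i, ChartedSpace (EuclideanSpace ℝ (Fin (2 * n i))) (V i)]
  [∀ i, IsManifold (𝓡 (2 * n i)) ∞ (V i)] [∀ i, T2Space (V i)] [∀ i, CompactSpace (V i)]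
  [∀ i, TopologicalSpace (L i)] [∀ i, ChartedSpace (EuclideanSpace ℝ (Fin (2 * n i + 1))) (L i)]
  [∀ i, IsManifold (𝓡 (2 * n i + 1)) ∞ (L i)] [∀ i, MulAction Circle (L i)]
  [TopologicalSpace P] [ChartedSpace (EuclideanSpace ℝ (Fin d)) P] [IsManifold (𝓡 d) ∞ P]
  [T2Space P] [MulAction Circle P]
  {q : Fin (k + 1) → ℤ} {h : ∀ i, SmoothMetric (𝓡 (2 * n i)) (V i)}
  {proj : ∀ i, L i → V i} {ϑ : ∀ i, OneForm (𝓡 (2 * n i + 1)) (L i)}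
  {pr : P → ∀ i, V i} {θ : OneForm (𝓡 d) P}

open SphereBundle.Collapse in
/-- The compactification is the disc bundle whose boundary is the sphere bundle `P`, and where
`s = T` is the zero section. -/
theorem HopfAssociated.compactifiesSmoothly (D : HopfAssociated q h proj ϑ pr θ) {T : ℝ}
    (hT : 0 < T) (C : CollapseProfile k T) {β : Fin (k + 1) → ℝ → ℝ} (hβ₀ : β 0 = C.β₀)
    (hβ : ∀ j : Fin k, β j.succ = C.β j) : CompactifiesSmoothly h pr θ C.α β T := by
  have : Fact (0 < T) := ⟨hT⟩
  have : CompactSpace P := D.principal_pr.compactSpace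
  let B := D.sphereBundle
  have hU : ofPolar B '' (Ico 0 T ×ˢ univ) = {m : B.Collapse T | height B m < T} :=
    ofPolar_image_Ico B
  refine ⟨B.Collapse T, inferInstance, inferInstance, inferInstance, inferInstance, inferInstance,
    D.geometry.discMetric C, ofPolar B, fun m => (height B m, point B m), zeroSection B, height B,
    contMDiffOn_ofPolar B, ?_, ?_, ?_, dense_ofPolar_image_Ioo B, boundary_eq B, ?_,
    (continuous_collapse B hT.le).continuousOn, ofPolar_eq_zeroSection B, contMDiff_zeroSection B,
    injective_zeroSection B, injective_mfderiv_zeroSection B, ?_, contMDiff_height B,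
    fun s hs x => height_collapse B hT.le hs x⟩
  · rw [hU]
    exact isOpen_height_lt B
  · rw [hU]
    exact contMDiffOn_height_point B
  · rintro ⟨s, x⟩ ⟨hs, -⟩
    exact Prod.ext (height_collapse B hT.le (Ico_subset_Icc_self hs) x)
      (point_collapse B hT.le hs x)
  · intro s hs x u v
    refine (D.geometry.discMetric_ofPolar C hs x u v).trans ?_
    rw [Fin.sum_univ_succ, hβ₀]
    simp only [hβ]
    rfl
  · rw [hU]
    exact range_zeroSection B

/-- The profile given by the coefficients `betaFun A q`, where `A 0 = -1 / (2 T)` and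
`|q 0| = 1` for `T = sStar A`. -/
def collapseProfileOfBeta {A : Fin (k + 1) → ℝ} (hA : A 0 < 0) (hq₀ : |q 0| = 1)
    (hβ : ∀ i, ∀ s ∈ Ico 0 (sStar A), 0 < betaFun A q i s)
    (hβT : ∀ i, i ≠ 0 → 0 < betaFun A q i (sStar A)) (α f c₁ c₂ : ℝ → ℝ)
    (hc₁ : ContDiffOn ℝ ∞ c₁ (Icc 0 (sStar A))) (hc₂ : ContDiffOn ℝ ∞ c₂ (Icc 0 (sStar A)))
    (hf : ∀ s ∈ Icc 0 (sStar A), 0 < f s) (hα : ∀ s, α s = 2 * (sStar A - s) * f s)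
    (hf₁ : ∀ s ∈ Icc 0 (sStar A),
      2 * (sStar A - s) * c₁ s = 1 / f s - (s + sStar A) / (2 * sStar A))
    (hf₂ : ∀ s ∈ Icc 0 (sStar A),
      2 * (sStar A - s) * c₂ s = f s - (s + sStar A) / (2 * sStar A)) :
    CollapseProfile k (sStar A) where
  α := α
  β₀ := betaFun A q 0
  β j := betaFun A q j.succ
  f := f
  c₁ := c₁
  c₂ := c₂
  f_pos := hf
  β_pos j s hs := by
    rcases hs.2.lt_or_eq with h | h
    · exact hβ _ s ⟨hs.1, h⟩
    · rw [h]
      exact hβT _ (Fin.succ_ne_zero j)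
  contDiffOn_β j :=
    (contDiff_const.mul ((contDiff_id.pow 2).sub contDiff_const)).contDiffOn
  contDiffOn_c₁ := hc₁
  contDiffOn_c₂ := hc₂
  α_eq := hα
  β₀_eq s := by
    have hq2 : (q 0 : ℝ) ^ 2 = 1 := by
      have h1 : (q 0) ^ 2 = 1 := by rw [← sq_abs, hq₀, one_pow]
      exact_mod_cast h1
    have h0 := hA.ne
    rw [betaFun, hq2, sStar]
    field_simp
    ring
  c₁_eq := hf₁
  c₂_eq := hf₂

end Compactification

end

theorem mainTheorem11 {k : ℕ} (n p : Fin (k + 1) → ℕ) (q : Fin (k + 1) → ℤ)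
    (V L : Fin (k + 1) → Type*) (P : Type*)
    [∀ i, TopologicalSpace (V i)] [∀ i, ChartedSpace (EuclideanSpace ℝ (Fin (2 * n i))) (V i)]
    [∀ i, IsManifold (𝓡 (2 * n i)) ∞ (V i)]
    [∀ i, T2Space (V i)] [∀ i, CompactSpace (V i)] [∀ i, ConnectedSpace (V i)]
    [∀ i, TopologicalSpace (L i)] [∀ i, ChartedSpace (EuclideanSpace ℝ (Fin (2 * n i + 1))) (L i)]
    [∀ i, IsManifold (𝓡 (2 * n i + 1)) ∞ (L i)] [∀ i, T2Space (L i)]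
    [∀ i, MulAction Circle (L i)]
    [TopologicalSpace P] [ChartedSpace (EuclideanSpace ℝ (Fin (2 * (∑ i, n i) + 1))) P]
    [IsManifold (𝓡 (2 * (∑ i, n i) + 1)) ∞ P] [T2Space P] [MulAction Circle P]
    (h : ∀ i, SmoothMetric (𝓡 (2 * n i)) (V i))
    (J : ∀ i, ∀ x : V i, TangentSpace (𝓡 (2 * n i)) x →L[ℝ] TangentSpace (𝓡 (2 * n i)) x)
    (proj : ∀ i, L i → V i) (ϑ : ∀ i, OneForm (𝓡 (2 * n i + 1)) (L i))
    (pr : P → ∀ i, V i) (θ : OneForm (𝓡 (2 * (∑ i, n i) + 1)) P)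
    (hJ : ∀ i, IsAlmostHermitian (h i) (J i))
    (hL : ∀ i, IsPrequantumBundle (h i) (J i) (proj i) (ϑ i))
    (hHopf : IsHopfFibration (h 0) (proj 0) (ϑ 0))
    (hP : IsCircleBundleOfWeight q proj ϑ pr θ)
    (hp : ∀ i, 0 < p i) (hp₀ : p 0 = n 0 + 1) (hq : ∀ i, q i ≠ 0) (hq₀ : |q 0| = 1)
    (m dimN pdim : ℕ) (hm : m = 2 + ∑ i, 2 * n i) (hm4 : 4 ≤ m) (hpdim : pdim = m + dimN)
    (ε ν : ℝ) (hN : dimN = 1 → ε = 0) (A : Fin (k + 1) → ℝ) :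
    (phiMin p q ≤ (p 0 : ℝ) ^ 2 ∧
      ((∃ i, i ≠ 0 ∧ (p i : ℤ) < p 0 * |q i|) → phiMin p q < (p 0 : ℝ) ^ 2) ∧
      ((∀ i, i ≠ 0 → p 0 * |q i| ≤ (p i : ℤ)) → phiMin p q = (p 0 : ℝ) ^ 2)) ∧
    (AdmissibleConstants p q ε ν A →
      (∀ i, A i < 0 ∧ ε * (q i : ℝ) ^ 2 / (4 * A i ^ 2) + p i / A i = ν) ∧
      0 < sStar A ∧
      (∀ i, ∀ s ∈ Ico 0 (sStar A), 0 < betaFun A q i s) ∧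
      betaFun A q 0 (sStar A) = 0 ∧ HasDerivAt (betaFun A q 0) (-1) (sStar A) ∧
      (∀ i, i ≠ 0 → 0 < betaFun A q i (sStar A)) ∧
      ∃ α : ℝ → ℝ,
        (∀ s ∈ Ioo 0 (sStar A), α s = alphaFun pdim n A q ε ν s) ∧
        ContDiffOn ℝ ∞ α (Icc 0 (sStar A)) ∧
        (∀ s ∈ Ico 0 (sStar A), 0 < α s) ∧
        α 0 = ν / (1 - pdim) ∧
        α (sStar A) = 0 ∧ HasDerivWithinAt α (-2) (Icc 0 (sStar A)) (sStar A) ∧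
        (∀ κ₁ : ℝ, 0 < κ₁ → ∀ s ∈ Ioo 0 (sStar A),
          SatisfiesODE pdim n p q ε α (varphiFun pdim κ₁) (betaFun A q) s) ∧
        CompactifiesSmoothly h pr θ α (betaFun A q) (sStar A)) := by
  refine ⟨phiMin_properties hq hq₀, fun hadm => ?_⟩
  obtain ⟨hν, hA, hlt⟩ := hadm.properties hp hq hq₀
  obtain ⟨hT, hβ, hβ₀, hβ₀', hβT⟩ := betaFun_properties hq₀ (fun i => (hA i).1) hlt
  obtain ⟨α, f, c₁, c₂, hαs, hfs, hc₁, hc₂, hf, hαf, hfT, hf₁, hf₂, hα, hα0, hα'⟩ :=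
    exists_profile hm hm4 hpdim hN hq₀ hp₀ hν (hA 0).1 (hA 0).2 hβ hβT
  refine ⟨hA, hT, hβ, hβ₀, hβ₀', hβT, α, hα, hαs, fun s hs => ?_, hα0, ?_, ?_, fun κ₁ _ s hs =>
    satisfiesODE_of_hasDerivAt (by omega) hA hβ hα' κ₁ hs, ?_⟩
  · rw [hαf]
    exact mul_pos (mul_pos two_pos (sub_pos.2 hs.2)) (hf s (Ico_subset_Icc_self hs))
  · rw [hαf, sub_self, mul_zero, zero_mul]
  · have hTmem : sStar A ∈ Icc 0 (sStar A) := ⟨hT.le, le_rfl⟩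
    have h1 := ((hfs.differentiableOn (by simp)) _ hTmem).hasDerivWithinAt
    have h2 := (((hasDerivAt_id (sStar A)).const_sub (sStar A)).const_mul 2).hasDerivWithinAt
      (s := Icc 0 (sStar A))
    have h3 := h2.mul h1
    simp only [id, sub_self, mul_zero, zero_mul, add_zero, hfT, mul_one, mul_neg] at h3
    exact h3.congr (fun s _ => hαf s) (hαf _)
  · obtain ⟨F, hF, hFϑ, hFh⟩ := hHopf
    obtain ⟨κ, hκ, hprκ, hκsmul, hθκ⟩ := hP.associated
    let D : HopfAssociated q h proj ϑ pr θ :=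
      { κ := κ
        F := F
        dim := rfl
        abs_q := hq₀
        principal := fun i => (hL i).principal
        principal_pr := hP.principal
        contMDiff_form := fun i => (hL i).connection.contMDiff
        contMDiff_κ := hκ
        pr_κ := hprκ
        κ_smul := hκsmul
        θ_κ := hθκ
        F_smul := hF
        form_F := hFϑ
        metric_F := hFh }
    exact D.compactifiesSmoothly hT
      (collapseProfileOfBeta (hA 0).1 hq₀ hβ hβT α f c₁ c₂ hc₁ hc₂ hf hαf hf₁ hf₂)
      rfl fun _ => rfl
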